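/- **Setting.** Let $\Omega\subseteq\mathbb{R}^n$ be open, $D\subseteq\mathbb{R}^n$ bounded and open, $m\ge 1$ and $p\in(1,\infty)$. Let $|\cdot|_2$ denote the Euclidean norm and, on $\mathbb{R}^{m\times n}$, the induced operator norm. Let $\Gamma$ be the group of the maps $x\mapsto \varepsilon x+h$ with $\varepsilon>0$, $h\in\mathbb{R}^n$ (the case $\mathcal G=\{\mathrm{id}\}$), and let $\mathcal{E}$ be the class of all sets $F(D)$ with $F\in\Gamma$. For a linear map $\mathfrak{L}:\mathbb{R}^{m\times n}\to\mathbb{R}^{m\times n}$, an open set $U$ and $u\in L^1_{\mathrm{loc}}(U;\mathbb{R}^m)$, let $D_{\mathfrak L}u$ be the matrix of distributions on $U$ given by $$\langle D_{\mathfrak L}u,\phi\rangle=-\int_U \mathfrak{L}(u\otimes\nabla\phi)\,dx ,\qquad \phi\in C_c^\infty(U).$$ Write $D_{\mathfrak L}u\in L^p(U)$ if it is represented by a function in $L^p(U;\mathbb{R}^{m\times n})$, which is then denoted by the same symbol. Let $W^{\mathfrak{L},p}(U;\mathbb{R}^m)$ be the set of all $u\in L^p(U;\mathbb{R}^m)$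 with $D_{\mathfrak L}u\in L^p(U)$. For $\mathfrak{L}=\mathrm{id}$ this is $W^{1,p}(U;\mathbb{R}^m)$, and $D_{\mathfrak{L}}u=\nabla u$. A *$p$-core functional* is a map $\alpha_p:L^p_{\mathrm{loc}}(\mathbb{R}^n;\mathbb{R}^m)\times\mathcal{E}\to[0,\infty)$ such that, for all $D'\in\mathcal E$ and all $u,v\in L^p_{\mathrm{loc}}(\mathbb{R}^n;\mathbb{R}^m)$: - $\alpha_p(u,D')=\alpha_p(v,D')$ whenever $u=v$ a.e. on $D'$; - $\alpha_p(\cdot,D')$ is convex; - $\alpha_p(tu,D')=|t|^p\alpha_p(u,D')$ for all $t\in\mathbb{R}$; - $\alpha_p(u+h,D')=\alpha_p(u,D')$ for all $h\in\mathbb{R}^m$; - $\alpha_p(u\circ F,D')=\alpha_p(u,F(D'))$ for all $F\in\Gamma$; - for some $c_1>0$, $\alpha_p(w,D)\le c_1\int_D|\nabla w|_2^p\,dx$ for all $w\in L^p_{\mathrm{loc}}(\mathbb{R}^n;\mathbb{R}^m)$ with $w|_D\in W^{1,p}(D;\mathbb{R}^m)$. For $\varepsilon>0$ and an open set $U$ put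 $$G_\varepsilon^{\alpha_p}(u,U)=\varepsilon^{n-p}\sup_{\mathcal F}\sum_{D'\in\mathcal F}\alpha_p(u,D')\in[0,\infty],$$ where $\mathcal F$ runs over all (possibly empty) families of pairwise disjoint sets of the form $\varepsilon D+h\subseteq U$, $h\in\mathbb{R}^n$. Put $$\psi_{\alpha_p}(A)=\lim_{\varepsilon\to0^+}G_\varepsilon^{\alpha_p}\big(x\mapsto Ax,(-\tfrac12,\tfrac12)^n\big),\qquad \mathcal N=\{A\in\mathbb{R}^{m\times n}:\psi_{\alpha_p}(A)=0\};$$ $\mathcal N$ is a linear subspace of $\mathbb{R}^{m\times n}$. For a linear subspace $\mathcal P$ with $\mathbb{R}^{m\times n}=\mathcal P\oplus\mathcal N$, let $\pi_{\mathcal P}$ be the projection onto $\mathcal P$ along $\mathcal N$. A $p$-core functional $\alpha_p$ is *strong* if for some such $\mathcal{P}$ there is $c_3>0$ with $\alpha_p(w,D)\le c_3\int_D|D_{\pi_{\mathcal P}}w|_2^p\,dx$ for all $w\in L^p_{\mathrm{loc}}(\mathbb{R}^n;\mathbb{R}^m)$ with $w|_D\in W^{\pi_{\mathcal P},p}(D;\mathbb{R}^m)$.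 **Statement.** Let $\alpha_p$ be a strong $p$-core functional such that for every $D'\in\mathcal E$ the restriction of $\alpha_p(\cdot,D')$ to $L^p(\mathbb{R}^n;\mathbb{R}^m)$ is lower semicontinuous. Let $\mathcal P$ be any linear subspace with $\mathbb{R}^{m\times n}=\mathcal P\oplus\mathcal N$, and let $u\in L^p_{\mathrm{loc}}(\mathbb{R}^n;\mathbb{R}^m)$. Then the limit defining $\psi_{\alpha_p}(A)$ exists and is finite for every $A\in\mathbb{R}^{m\times n}$, and $$\liminf_{\varepsilon\to0^+}G_\varepsilon^{\alpha_p}(u,\Omega)<\infty\iff D_{\pi_{\mathcal P}}(u|_\Omega)\in L^p(\Omega;\mathbb{R}^{m\times n}).$$ Moreover, if one of these two equivalent conditions holds, then $$\lim_{\varepsilon\to0^+}G_\varepsilon^{\alpha_p}(u,\Omega)=\int_\Omega\psi_{\alpha_p}\big(D_{\pi_{\mathcal P}}(u|_\Omega)\big)\,dx .$$ -/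

import Mathlib

open MeasureTheory Filter Topology Set
open scoped ENNReal NNReal ContDiff

noncomputable section

namespace CoreBMO

/-- `ℝⁿ` with its Euclidean norm. -/
abbrev E (n : ℕ) : Type := EuclideanSpace ℝ (Fin n)

/-- The `m × n` real matrices, identified with the linear maps `ℝⁿ → ℝᵐ` that they represent; the
norm is the operator norm with respect to the Euclidean norms. Coerced to a function, `A` is the
linear function `x ↦ A x`. -/
abbrev Mat (m n : ℕ) : Type := E n →L[ℝ] E m

/-! ### Function spaces -/

/-- `u ∈ L^p_loc(ℝⁿ; ℝᵐ)`. -/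
def LpLoc {n m : ℕ} (p : ℝ) (u : E n → E m) : Prop :=
  ∀ K : Set (E n), IsCompact K → MemLp u (ENNReal.ofReal p) (volume.restrict K)

/-- `φ ∈ C_c^∞(Ω)`. -/
structure IsTest {n : ℕ} (Ω : Set (E n)) (φ : E n → ℝ) : Prop where
  smooth : ContDiff ℝ ∞ φ
  compact : HasCompactSupport φ
  support : tsupport φ ⊆ Ω

/-- The (matrix-valued) distribution `D_𝔏 u` on `Ω`:
`⟨D_𝔏 u, φ⟩ = - ∫_Ω 𝔏 (u ⊗ ∇φ) dx`, where `u ⊗ ∇φ` is the matrix `(u_k ∂_l φ)_{k l}`. -/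
def distD {n m : ℕ} (L : Mat m n →ₗ[ℝ] Mat m n) (Ω : Set (E n)) (u : E n → E m)
    (φ : E n → ℝ) : Mat m n :=
  - ∫ x in Ω, L ((fderiv ℝ φ x).smulRight (u x))

/-- `g ∈ L^p(Ω; ℝ^{m×n})` and the distribution `D_𝔏 u` on `Ω` is represented by `g`. -/
structure IsLpD {n m : ℕ} (p : ℝ) (L : Mat m n →ₗ[ℝ] Mat m n) (Ω : Set (E n)) (u : E n → E m)
    (g : E n → Mat m n) : Prop where
  memLp : MemLp g (ENNReal.ofReal p) (volume.restrict Ω)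
  represents : ∀ φ : E n → ℝ, IsTest Ω φ → distD L Ω u φ = ∫ x in Ω, φ x • g x

/-- `D_𝔏 u ∈ L^p(Ω; ℝ^{m×n})`. -/
def MemLpD {n m : ℕ} (p : ℝ) (L : Mat m n →ₗ[ℝ] Mat m n) (Ω : Set (E n)) (u : E n → E m) : Prop :=
  ∃ g : E n → Mat m n, IsLpD p L Ω u g

/-- The bound `a ≤ c ∫_Ω |D_𝔏 u|^p dx` for some `c > 0` that is independent of `u`, for all
`u ∈ L^p_loc(ℝⁿ; ℝᵐ)` with `u ∈ W^{𝔏,p}(Ω; ℝᵐ)`, that is, `u ∈ L^p(Ω)` and `D_𝔏 u ∈ L^p(Ω)`.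
Here `a = a(u)`. For `𝔏 = id` one has `W^{𝔏,p} = W^{1,p}` and `D_𝔏 u = ∇u`. -/
def GradientBound {n m : ℕ} (p : ℝ) (L : Mat m n →ₗ[ℝ] Mat m n) (Ω : Set (E n))
    (a : (E n → E m) → ℝ≥0) : Prop :=
  ∃ c : ℝ≥0, 0 < c ∧ ∀ (u : E n → E m) (g : E n → Mat m n), LpLoc p u →
    MemLp u (ENNReal.ofReal p) (volume.restrict Ω) → IsLpD p L Ω u g →
      (a u : ℝ≥0∞) ≤ c * ∫⁻ x in Ω, ‖g x‖ₑ ^ p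

/-! ### Admissible sets -/

/-- The set of all `F(D)` with `F ∈ Γ` and `F(D) ⊆ Ω`. -/
def images {n : ℕ} (Γ : Set (E n ≃ᵃ[ℝ] E n)) (D Ω : Set (E n)) : Set (Set (E n)) :=
  {D' | ∃ F ∈ Γ, D' = F '' D ∧ D' ⊆ Ω}

/-- The maps `x ↦ ε R x + h` with `R ∈ 𝒢` and `h ∈ ℝⁿ`. -/
def scaledMotions {n : ℕ} (𝒢 : Subgroup (Matrix.specialOrthogonalGroup (Fin n) ℝ)) (ε : ℝ) :
    Set (E n ≃ᵃ[ℝ] E n) :=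
  {F | ∃ R ∈ 𝒢, ∃ h : E n, ∀ x : E n,
    F x = ε • Matrix.toEuclideanCLM (𝕜 := ℝ) (R : Matrix (Fin n) (Fin n) ℝ) x + h}

/-- The group `Γ^𝒢` of all maps `x ↦ ε R x + h` with `ε > 0`, `R ∈ 𝒢` and `h ∈ ℝⁿ`. -/
def similarities {n : ℕ} (𝒢 : Subgroup (Matrix.specialOrthogonalGroup (Fin n) ℝ)) :
    Subgroup (E n ≃ᵃ[ℝ] E n) where
  carrier := ⋃ ε ∈ Ioi (0 : ℝ), scaledMotions 𝒢 ε
  one_mem' := by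
    simp only [mem_iUnion]
    exact ⟨1, by simp, 1, one_mem _, 0, fun x => by simp⟩
  mul_mem' := by
    intro F F' hF hF'
    simp only [mem_iUnion] at hF hF' ⊢
    obtain ⟨ε, hε, R, hR, h, hx⟩ := hF
    obtain ⟨ε', hε', R', hR', h', hx'⟩ := hF'
    refine ⟨ε * ε', mem_Ioi.2 (mul_pos hε hε'), R * R', mul_mem hR hR',
      ε • Matrix.toEuclideanCLM (𝕜 := ℝ) (R : Matrix (Fin n) (Fin n) ℝ) h' + h, fun x => ?_⟩
    simp [hx, hx', mul_smul, add_assoc]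
  inv_mem' := by
    intro F hF
    simp only [mem_iUnion] at hF ⊢
    obtain ⟨ε, hε, R, hR, h, hx⟩ := hF
    have hε' : ε ≠ 0 := ne_of_gt hε
    refine ⟨ε⁻¹, mem_Ioi.2 (inv_pos.2 hε), R⁻¹, inv_mem hR,
      -(ε⁻¹ • Matrix.toEuclideanCLM (𝕜 := ℝ)
        ((R⁻¹ : Matrix.specialOrthogonalGroup (Fin n) ℝ) : Matrix (Fin n) (Fin n) ℝ) h),
      fun x => ?_⟩
    have hRR : ((R : Matrix.specialOrthogonalGroup (Fin n) ℝ) : Matrix (Fin n) (Fin n) ℝ) *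
        ((R⁻¹ : Matrix.specialOrthogonalGroup (Fin n) ℝ) : Matrix (Fin n) (Fin n) ℝ) = 1 := by
      rw [← Submonoid.coe_mul, mul_inv_cancel, Submonoid.coe_one]
    have key : ∀ y : E n, Matrix.toEuclideanCLM (𝕜 := ℝ) (R : Matrix (Fin n) (Fin n) ℝ)
        (Matrix.toEuclideanCLM (𝕜 := ℝ)
          ((R⁻¹ : Matrix.specialOrthogonalGroup (Fin n) ℝ) : Matrix (Fin n) (Fin n) ℝ) y) = y := by
      intro y
      rw [← mul_apply_eq_comp, ← map_mul, hRR, map_one,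
        one_apply_eq_self]
    apply F.injective
    have h1 : F (F⁻¹ x) = x := F.apply_symm_apply x
    rw [h1, hx, map_add, map_neg, map_smul, map_smul, key, key, smul_add, smul_neg,
      smul_smul, smul_smul, mul_inv_cancel₀ hε', one_smul, one_smul]
    abel

/-! ### Core functionals -/

/-- A `p`-core functional subordinated to the reference set `D`, the group `Γ` and `m`. Its domain is
`L^p_loc(ℝⁿ; ℝᵐ) × images Γ D ℝⁿ`; the values of `toFun` outside this domain play no role.
Elements of `L^p_loc` are identified when they agree almost everywhere, hence so are their
restrictions in `ext_indep`. -/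
structure CoreFunctional {n : ℕ} (m : ℕ) (p : ℝ) (D : Set (E n))
    (Γ : Subgroup (E n ≃ᵃ[ℝ] E n)) where
  toFun : (E n → E m) → Set (E n) → ℝ≥0
  one_le_p : 1 ≤ p
  ext_indep : ∀ D' ∈ images (Γ : Set (E n ≃ᵃ[ℝ] E n)) D univ, ∀ u v : E n → E m,
    LpLoc p u → LpLoc p v → u =ᵐ[volume.restrict D'] v → toFun u D' = toFun v D'
  convex : ∀ D' ∈ images (Γ : Set (E n ≃ᵃ[ℝ] E n)) D univ,
    ∀ u v : E n → E m, LpLoc p u → LpLoc p v → ∀ s t : ℝ≥0, s + t = 1 →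
      toFun ((s : ℝ) • u + (t : ℝ) • v) D' ≤ s * toFun u D' + t * toFun v D'
  homogeneous : ∀ D' ∈ images (Γ : Set (E n ≃ᵃ[ℝ] E n)) D univ, ∀ u : E n → E m, LpLoc p u →
    ∀ t : ℝ, toFun (t • u) D' = ‖t‖₊ ^ p * toFun u D'
  transl : ∀ D' ∈ images (Γ : Set (E n ≃ᵃ[ℝ] E n)) D univ, ∀ u : E n → E m, LpLoc p u →
    ∀ h : E m, toFun (fun x => u x + h) D' = toFun u D'
  change_var : ∀ D' ∈ images (Γ : Set (E n ≃ᵃ[ℝ] E n)) D univ, ∀ u : E n → E m, LpLoc p u →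
    ∀ F ∈ Γ, toFun (u ∘ F) D' = toFun u (F '' D')
  grad_bound : GradientBound p (LinearMap.id : Mat m n →ₗ[ℝ] Mat m n) D fun u => toFun u D

variable {n m : ℕ} {p : ℝ} {D : Set (E n)}
  {𝒢 : Subgroup (Matrix.specialOrthogonalGroup (Fin n) ℝ)}

/-- The functional `G_ε(u, Ω) = ε^{n-p} sup ∑_{D' ∈ 𝓕} α(u, D')`, the supremum being over all
families `𝓕` of pairwise disjoint sets `D' = ε R D + h ⊆ Ω` with `R ∈ 𝒢` and `h ∈ ℝⁿ`. -/
def bmo (α : CoreFunctional m p D (similarities 𝒢)) (ε : ℝ) (u : E n → E m)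
    (Ω : Set (E n)) : ℝ≥0∞ :=
  ENNReal.ofReal (ε ^ ((n : ℝ) - p)) *
    ⨆ (𝓕 : Set (Set (E n))) (_ : 𝓕 ⊆ images (scaledMotions 𝒢 ε) D Ω)
      (_ : 𝓕.PairwiseDisjoint id), ∑' D' : 𝓕, (α.toFun u D' : ℝ≥0∞)

/-- The lower limit of `G_ε(u, Ω)` as `ε → 0⁺`. -/
def bmoLower (α : CoreFunctional m p D (similarities 𝒢)) (u : E n → E m)
    (Ω : Set (E n)) : ℝ≥0∞ :=
  liminf (fun ε => bmo α ε u Ω) (𝓝[>] (0 : ℝ))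

/-- The cube `(-1/2, 1/2)ⁿ`. -/
def unitCube (n : ℕ) : Set (E n) := {x | ∀ i, x i ∈ Ioo (-(1 / 2) : ℝ) (1 / 2)}

/-- `ψ(A) = lim_{ε → 0⁺} G_ε(x ↦ A x, (-1/2, 1/2)ⁿ)`. It is written as an upper limit, so that it is
meaningful before the limit is known to exist. -/
def psi (α : CoreFunctional m p D (similarities 𝒢)) (A : Mat m n) : ℝ≥0∞ :=
  limsup (fun ε => bmo α ε A (unitCube n)) (𝓝[>] (0 : ℝ))

/-! ### The zero set of `psi` is a linear subspace -/

theorem lpLoc_of_continuous {u : E n → E m} (hu : Continuous u) : LpLoc p u := by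
  intro K hK
  have : IsFiniteMeasure (volume.restrict K) :=
    ⟨by rw [Measure.restrict_apply_univ]; exact hK.measure_lt_top⟩
  obtain ⟨C, hC⟩ := hK.exists_bound_of_continuousOn hu.continuousOn
  exact MemLp.of_bound hu.aestronglyMeasurable C (ae_restrict_of_forall_mem hK.measurableSet hC)

theorem LpLoc.smul {u : E n → E m} (hu : LpLoc p u) (t : ℝ) : LpLoc p (t • u) :=
  fun K hK => (hu K hK).const_smul t

theorem images_subset (𝒢 : Subgroup (Matrix.specialOrthogonalGroup (Fin n) ℝ)) {ε : ℝ}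
    (hε : 0 < ε) (D Ω : Set (E n)) : images (scaledMotions 𝒢 ε) D Ω ⊆
      images (similarities 𝒢 : Set (E n ≃ᵃ[ℝ] E n)) D univ := by
  rintro D' ⟨F, hF, hD', -⟩
  exact ⟨F, mem_iUnion₂.2 ⟨ε, hε, hF⟩, hD', subset_univ _⟩

theorem CoreFunctional.add_le {Γ : Subgroup (E n ≃ᵃ[ℝ] E n)} (α : CoreFunctional m p D Γ)
    {D' : Set (E n)} (hD' : D' ∈ images (Γ : Set (E n ≃ᵃ[ℝ] E n)) D univ) {u v : E n → E m}
    (hu : LpLoc p u) (hv : LpLoc p v) :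
    α.toFun (u + v) D' ≤ 2 ^ p * (α.toFun u D' + α.toFun v D') := by
  have h1 := α.convex D' hD' _ _ (hu.smul 2) (hv.smul 2) (1 / 2) (1 / 2) (by norm_num)
  have h2 : ((1 / 2 : ℝ≥0) : ℝ) • ((2 : ℝ) • u) + ((1 / 2 : ℝ≥0) : ℝ) • ((2 : ℝ) • v) = u + v := by
    simp [smul_smul]
  rw [h2, α.homogeneous D' hD' u hu, α.homogeneous D' hD' v hv] at h1
  have h3 : ‖(2 : ℝ)‖₊ = 2 := by ext; simp
  rw [h3] at h1
  have h4 : (1 / 2 : ℝ≥0) ≤ 1 := by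
    rw [← NNReal.coe_le_coe]; norm_num
  calc α.toFun (u + v) D'
      ≤ 1 / 2 * (2 ^ p * α.toFun u D') + 1 / 2 * (2 ^ p * α.toFun v D') := h1
    _ ≤ 1 * (2 ^ p * α.toFun u D') + 1 * (2 ^ p * α.toFun v D') := by gcongr
    _ = 2 ^ p * (α.toFun u D' + α.toFun v D') := by ring

theorem bmo_le (α : CoreFunctional m p D (similarities 𝒢)) {ε : ℝ} (hε : 0 < ε) {Ω : Set (E n)}
    {u v w : E n → E m} {c : ℝ≥0}
    (h : ∀ D' ∈ images (similarities 𝒢 : Set (E n ≃ᵃ[ℝ] E n)) D univ,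
      α.toFun w D' ≤ c * (α.toFun u D' + α.toFun v D')) :
    bmo α ε w Ω ≤ c * (bmo α ε u Ω + bmo α ε v Ω) := by
  unfold bmo
  rw [← mul_add, mul_left_comm]
  gcongr
  refine iSup_le fun 𝓕 => iSup_le fun h𝓕 => iSup_le fun hd => ?_
  calc ∑' D' : 𝓕, (α.toFun w D' : ℝ≥0∞)
      ≤ ∑' D' : 𝓕, (c : ℝ≥0∞) * (α.toFun u D' + α.toFun v D') := by
        refine ENNReal.tsum_le_tsum fun D' => ?_
        exact_mod_cast h D' (images_subset 𝒢 hε D Ω (h𝓕 D'.2))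
    _ = c * (∑' D' : 𝓕, (α.toFun u D' : ℝ≥0∞) + ∑' D' : 𝓕, (α.toFun v D' : ℝ≥0∞)) := by
        rw [ENNReal.tsum_mul_left, ENNReal.tsum_add]
    _ ≤ _ := by
        gcongr
        · exact le_iSup₂_of_le 𝓕 h𝓕 (le_iSup_of_le hd le_rfl)
        · exact le_iSup₂_of_le 𝓕 h𝓕 (le_iSup_of_le hd le_rfl)

theorem psi_eq_zero_of_le (α : CoreFunctional m p D (similarities 𝒢)) {A B C : Mat m n} {c : ℝ≥0}
    (h : ∀ D' ∈ images (similarities 𝒢 : Set (E n ≃ᵃ[ℝ] E n)) D univ,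
      α.toFun C D' ≤ c * (α.toFun A D' + α.toFun B D'))
    (hA : psi α A = 0) (hB : psi α B = 0) : psi α C = 0 := by
  have tA : Tendsto (fun ε => bmo α ε A (unitCube n)) (𝓝[>] (0 : ℝ)) (𝓝 0) :=
    tendsto_of_le_liminf_of_limsup_le bot_le hA.le
  have tB : Tendsto (fun ε => bmo α ε B (unitCube n)) (𝓝[>] (0 : ℝ)) (𝓝 0) :=
    tendsto_of_le_liminf_of_limsup_le bot_le hB.le
  have tC : Tendsto (fun ε => (c : ℝ≥0∞) * (bmo α ε A (unitCube n) + bmo α ε B (unitCube n)))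
      (𝓝[>] (0 : ℝ)) (𝓝 0) := by
    simpa using ENNReal.Tendsto.const_mul (tA.add tB) (Or.inr (ENNReal.coe_ne_top (r := c)))
  refine (tendsto_of_tendsto_of_tendsto_of_le_of_le' tendsto_const_nhds tC
    (Eventually.of_forall fun _ => bot_le) ?_).limsup_eq
  filter_upwards [self_mem_nhdsWithin] with ε hε
  exact bmo_le α hε h

/-- The linear subspace `𝒩 = {A | ψ(A) = 0}` of `ℝ^{m×n}`. -/
def nullSpace (α : CoreFunctional m p D (similarities 𝒢)) : Submodule ℝ (Mat m n) where
  carrier := {A | psi α A = 0}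
  add_mem' := by
    intro A B hA hB
    refine psi_eq_zero_of_le α (c := 2 ^ p) (fun D' hD' => ?_) hA hB
    exact α.add_le hD' (lpLoc_of_continuous A.continuous) (lpLoc_of_continuous B.continuous)
  zero_mem' := by
    have h0 : ∀ D' ∈ images (similarities 𝒢 : Set (E n ≃ᵃ[ℝ] E n)) D univ,
        α.toFun (0 : Mat m n) D' = 0 := by
      intro D' hD'
      have h := α.homogeneous D' hD' (0 : Mat m n)
        (lpLoc_of_continuous (0 : Mat m n).continuous) 0
      have hp : p ≠ 0 := by linarith [α.one_le_p]
      rw [nnnorm_zero, NNReal.zero_rpow hp, zero_mul] at h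
      rw [← h]
      congr 1
      ext1 x
      simp
    have hz : ∀ ε ∈ Ioi (0 : ℝ), bmo α ε (0 : Mat m n) (unitCube n) = 0 := by
      intro ε hε
      unfold bmo
      refine mul_eq_zero_of_right _ ?_
      simp only [ENNReal.iSup_eq_zero, ENNReal.tsum_eq_zero, ENNReal.coe_eq_zero]
      intro 𝓕 h𝓕 _ D'
      exact h0 D' (images_subset 𝒢 hε D _ (h𝓕 D'.2))
    have hz' : (fun ε => bmo α ε (0 : Mat m n) (unitCube n)) =ᶠ[𝓝[>] (0 : ℝ)] fun _ => 0 := by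
      filter_upwards [self_mem_nhdsWithin] with ε hε using hz ε hε
    exact (tendsto_const_nhds.congr' hz'.symm).limsup_eq
  smul_mem' := by
    intro t A hA
    refine psi_eq_zero_of_le α (c := ‖t‖₊ ^ p) (fun D' hD' => ?_) hA hA
    have h := α.homogeneous D' hD' A (lpLoc_of_continuous A.continuous) t
    have h2 : ((t • A : Mat m n) : E n → E m) = t • (A : E n → E m) := rfl
    rw [h2, h]
    gcongr
    exact le_self_add

/-! ### Strong core functionals and lower semicontinuity -/

/-- `α` is a strong `p`-core functional: for some linear subspace `P` with `ℝ^{m×n} = P ⊕ 𝒩` it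
satisfies the gradient bound with `∇` replaced by `D_π`, where `π` is the projection onto `P`
along `𝒩`. -/
def IsStrong (α : CoreFunctional m p D (similarities 𝒢)) : Prop :=
  ∃ (P : Submodule ℝ (Mat m n)) (hP : IsCompl P (nullSpace α)),
    GradientBound p (P.projection (nullSpace α) hP) D fun u => α.toFun u D

/-- For every `D'` in the domain of `α`, the restriction of `α(·, D')` to `L^p(ℝⁿ; ℝᵐ)` is lower
semicontinuous. -/
def IsLpLowerSemicontinuous {Γ : Subgroup (E n ≃ᵃ[ℝ] E n)} (α : CoreFunctional m p D Γ) : Prop :=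
  haveI : Fact (1 ≤ ENNReal.ofReal p) := ⟨by simpa using α.one_le_p⟩
  ∀ D' ∈ images (Γ : Set (E n ≃ᵃ[ℝ] E n)) D univ,
    LowerSemicontinuous fun u : Lp (E m) (ENNReal.ofReal p) (volume : Measure (E n)) =>
      α.toFun u D'

end CoreBMO

end

/-! Two mechanisms carry the proof: an asymptotic law for packings and the seminorm `root α`, which
is the `p`-th root of `α(·, D)`.

Packings. For `D` nonempty, `ε ^ n` times the largest number of disjoint translates of `ε D` in the
unit cube tends to a constant `κ ∈ (0, ∞)` (`exists_tendsto_density`). For a continuous compactly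
supported weight `f`, the largest sum `∑ f(h)` over packings of an open set, times `ε ^ n`, is
asymptotically at least `κ ∫ f` over that set and at most `κ ∫ f` over the whole space
(`le_liminf_packSup`, `limsup_packSup_le`). On a linear map `A` every copy of `ε D` contributes `ε ^
p * α(A, D)`, so `ψ(A) = κ α(A, D)`, and `𝒩` is the kernel of `root α` on matrices.

From `D_π u = g ∈ L^p` to the limit (`tendsto_bmo_of_isLpD`). Approximate `g`, extended by zero, by
a continuous compactly supported `k`. On the copy at `h` replace `u` by the linear map `k h`. The
strong bound controls the error by the integral of `‖g - k h‖ ^ p` over the copy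
(`exists_strong_bound`), and these integrals add up to little over disjoint copies
(`eventually_packSup_oscillation_le`). Minkowski's inequality for packings reduces `G_ε(u, Ω)` to
the weights `α(k h, D)`, to which the packing law applies.

From a finite lower limit to `D_π u ∈ L^p` (`exists_root_tensorInt_le`). A lower semicontinuous
seminorm on the Banach space `L^p` is continuous, so Jensen's inequality applies to `v(y) = ∫ φ(x)
u(ε y + x) dx`. Averaging a periodic packing over its translates (`packCount_mul_lintegral_le`)
bounds the integral of `root α (u(ε · + x)) ^ p` over the support of `φ` by a multiple of `ε ^ p
G_ε(u, Ω)`, and Hölder's inequality yields `root α (v / ε) ≤ C ‖φ‖_q`. Up to an additive constant,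
`v / ε` converges to the linear map `-∫ u ⊗ ∇φ`, so `root α (∫ u ⊗ ∇φ) ≤ C ‖φ‖_q`. Since `root α`
dominates the norm of `π`, duality between `L^q` and `L^p` produces the density
(`memLpD_of_bmoLower_lt_top`). -/

noncomputable section

namespace CoreBMO

variable {n m : ℕ}

/-! ### Scaled copies and packings -/

/-- The set `ε D + h`. -/
def copy (D : Set (E n)) (ε : ℝ) (h : E n) : Set (E n) := (fun y => ε • y + h) '' D

/-- The centred open cube of side `t`. -/
def cube (n : ℕ) (t : ℝ) : Set (E n) := {x | ∀ i, x i ∈ Ioo (-(t / 2)) (t / 2)}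

/-- `T` is the set of translations of a packing of `U` by copies of `ε D`. -/
structure IsPacking (D : Set (E n)) (ε : ℝ) (U T : Set (E n)) : Prop where
  subset : ∀ h ∈ T, copy D ε h ⊆ U
  disjoint : T.PairwiseDisjoint (copy D ε)

/-- The supremum of `∑_{h ∈ T} f h` over all packings `T`. -/
def packSup (D : Set (E n)) (ε : ℝ) (U : Set (E n)) (f : E n → ℝ≥0∞) : ℝ≥0∞ :=
  ⨆ (T : Set (E n)) (_ : IsPacking D ε U T), ∑' h : T, f h

/-- The packing number of the cube of side `t`. -/
def packCount (D : Set (E n)) (ε t : ℝ) : ℝ≥0∞ := packSup D ε (cube n t) fun _ => 1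

variable {D U : Set (E n)} {ε t R : ℝ}

theorem mem_copy {h x : E n} : x ∈ copy D ε h ↔ ∃ y ∈ D, ε • y + h = x := Iff.rfl

theorem IsPacking.sum_le {T : Set (E n)} (hT : IsPacking D ε U T) (f : E n → ℝ≥0∞) :
    ∑' h : T, f h ≤ packSup D ε U f :=
  le_iSup₂_of_le T hT le_rfl

theorem packSup_le {f : E n → ℝ≥0∞} {C : ℝ≥0∞}
    (h : ∀ T, IsPacking D ε U T → ∑' h : T, f h ≤ C) : packSup D ε U f ≤ C :=
  iSup₂_le h

theorem packSup_mono {f g : E n → ℝ≥0∞} (h : ∀ x, copy D ε x ⊆ U → f x ≤ g x) :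
    packSup D ε U f ≤ packSup D ε U g :=
  packSup_le fun _ hT => (ENNReal.tsum_le_tsum fun x => h _ (hT.subset _ x.2)).trans (hT.sum_le g)

theorem packSup_const_mul (c : ℝ≥0∞) (f : E n → ℝ≥0∞) :
    packSup D ε U (fun x => c * f x) = c * packSup D ε U f := by
  simp only [packSup, ENNReal.tsum_mul_left, ENNReal.mul_iSup]

/-- Families of disjoint copies indexed by an arbitrary type; indices with vanishing weight need
not be admissible. -/
theorem tsum_le_packSup {ι : Type*} (hne : D.Nonempty) (f : E n → ℝ≥0∞) (c : ι → E n)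
    (hsub : ∀ i, f (c i) ≠ 0 → copy D ε (c i) ⊆ U)
    (hdisj : ∀ i j, i ≠ j → Disjoint (copy D ε (c i)) (copy D ε (c j))) :
    ∑' i, f (c i) ≤ packSup D ε U f := by
  have hinj : Function.Injective c := by
    intro i j hij
    by_contra hne'
    have h1 := hdisj i j hne'
    rw [hij, disjoint_self] at h1
    exact (hne.image _).ne_empty h1
  set S : Set ι := {i | f (c i) ≠ 0}
  have hT : IsPacking D ε U (c '' S) := by
    constructor
    · rintro _ ⟨i, hi, rfl⟩
      exact hsub i hi
    · rintro _ ⟨i, hi, rfl⟩ _ ⟨j, hj, rfl⟩ hij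
      exact hdisj i j (fun h => hij (by rw [h]))
  refine le_trans (le_of_eq ?_) (hT.sum_le f)
  rw [tsum_image f hinj.injOn]
  exact (tsum_subtype_eq_of_support_subset (f := fun i => f (c i)) (fun i hi => hi)).symm

theorem copy_eq_preimage (hε : 0 < ε) (h : E n) :
    copy D ε h = (fun x => ε⁻¹ • (x - h)) ⁻¹' D := by
  ext x
  simp only [mem_copy, mem_preimage]
  constructor
  · rintro ⟨y, hy, rfl⟩
    simpa [smul_smul, hε.ne'] using hy
  · intro hx
    exact ⟨_, hx, by simp [smul_smul, hε.ne']⟩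

theorem isOpen_copy (hD : IsOpen D) (hε : 0 < ε) (h : E n) : IsOpen (copy D ε h) := by
  rw [copy_eq_preimage hε]
  exact hD.preimage (by fun_prop)

open scoped Pointwise in
theorem volume_copy (hε : 0 < ε) (D : Set (E n)) (h : E n) :
    volume (copy D ε h) = ENNReal.ofReal (ε ^ n) * volume D := by
  have : copy D ε h = (fun x => x + h) '' (ε • D) := by
    ext x; simp [mem_copy, mem_smul_set, ← sub_eq_add_neg, eq_sub_iff_add_eq]
  rw [this, image_add_right, measure_preimage_add_right, Measure.addHaar_smul, abs_of_nonneg]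
  · simp
  · positivity

theorem copy_subset_closedBall (hε : 0 < ε) (hR : D ⊆ Metric.closedBall 0 R) (h : E n) :
    copy D ε h ⊆ Metric.closedBall h (ε * R) := by
  rintro _ ⟨y, hy, rfl⟩
  have := hR hy
  simp only [Metric.mem_closedBall, dist_eq_norm, sub_zero, add_sub_cancel_right,
    norm_smul, Real.norm_eq_abs, abs_of_pos hε] at this ⊢
  gcongr

theorem IsPacking.countable (hD : IsOpen D) (hne : D.Nonempty) (hε : 0 < ε) {T : Set (E n)}
    (hT : IsPacking D ε U T) : T.Countable :=
  hT.disjoint.countable_of_isOpen (fun h _ => isOpen_copy hD hε h) (fun _ _ => hne.image _)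

theorem volume_box (s : Fin n → Set ℝ) (hs : ∀ i, MeasurableSet (s i)) :
    volume {x : E n | ∀ i, x i ∈ s i} = ∏ i, volume (s i) := by
  rw [← volume_pi_pi, ← (PiLp.volume_preserving_ofLp (Fin n)).measure_preimage
    (MeasurableSet.univ_pi hs).nullMeasurableSet]
  congr 1
  ext x
  simp

theorem isOpen_cube (t : ℝ) : IsOpen (cube n t) := by
  have : cube n t = ⋂ i, (fun x : E n => x i) ⁻¹' Ioo (-(t / 2)) (t / 2) := by
    ext x; simp [cube]
  rw [this]
  exact isOpen_iInter_of_finite fun i => isOpen_Ioo.preimage (by fun_prop)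

theorem volume_cube (t : ℝ) : volume (cube n t) = ENNReal.ofReal t ^ n := by
  rw [cube, volume_box _ fun _ => measurableSet_Ioo]
  simp

theorem unitCube_eq : unitCube n = cube n 1 := rfl

theorem abs_coord_le (x : E n) (i : Fin n) : |x i| ≤ ‖x‖ := by
  simpa using PiLp.norm_apply_le x i

theorem norm_le_of_coord {x : E n} {r : ℝ} (h : ∀ i, |x i| ≤ r) : ‖x‖ ≤ n * r := by
  have h1 : x = ∑ i, x i • EuclideanSpace.basisFun (Fin n) ℝ i := by
    simpa using ((EuclideanSpace.basisFun (Fin n) ℝ).sum_repr x).symm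
  rw [h1]
  refine (norm_sum_le _ _).trans ?_
  have : ∀ i ∈ Finset.univ, ‖x i • EuclideanSpace.basisFun (Fin n) ℝ i‖ ≤ r := by
    intro i _
    rw [norm_smul, OrthonormalBasis.norm_eq_one, mul_one]
    exact h i
  simpa using Finset.sum_le_card_nsmul _ _ _ this

/-- For `D` open, the set of `x` whose copy contains a given `z ∉ U` is open. The purpose is
measurability of the set of admissible translations. -/
theorem isClosed_admissible (hD : IsOpen D) (hε : 0 < ε) (U : Set (E n)) :
    IsClosed {x : E n | copy D ε x ⊆ U} := by
  have : {x : E n | copy D ε x ⊆ U} = ⋂ z ∈ Uᶜ, {x | ε⁻¹ • (z - x) ∉ D} := by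
    ext x
    simp only [copy_eq_preimage hε, mem_ofPred_eq, mem_iInter, subset_def, mem_preimage, mem_compl_iff]
    exact forall_congr' fun z => not_imp_not.symm
  rw [this]
  refine isClosed_biInter fun z _ => ?_
  exact (hD.preimage (f := fun x => ε⁻¹ • (z - x)) (by fun_prop)).isClosed_compl

/-- Averaging a periodic packing over its translates. -/
theorem packCount_mul_lintegral_le (hD : IsOpen D) (hne : D.Nonempty) (hε : 0 < ε) (ht : 0 < t)
    {f : E n → ℝ≥0∞} (hf : Measurable f) (hfU : ∀ x, f x ≠ 0 → copy D ε x ⊆ U) :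
    packCount D ε t * ∫⁻ x, f x ≤ ENNReal.ofReal t ^ n * packSup D ε U f := by
  rw [packCount, packSup, ENNReal.iSup_mul]
  refine iSup_le fun T => ?_
  rw [ENNReal.iSup_mul]
  refine iSup_le fun hT => ?_
  -- The lattice `tℤⁿ`: its fundamental domain is a half-open cube of side `t`, hence of volume `t ^
  -- n`.
  let b : Module.Basis (Fin n) ℝ (E n) :=
    (EuclideanSpace.basisFun (Fin n) ℝ).toBasis.isUnitSMul (w := fun _ => t)
      (fun _ => (isUnit_iff_ne_zero.2 ht.ne'))
  have hb : ∀ (x : E n) i, b.repr x i = t⁻¹ * x i := by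
    intro x i
    simp [b, Module.Basis.repr_isUnitSMul, Units.smul_def]
  have hF := ZSpan.isAddFundamentalDomain b (volume : Measure (E n))
  have hvol : volume (ZSpan.fundamentalDomain b) = ENNReal.ofReal t ^ n := by
    have : ZSpan.fundamentalDomain b = {x : E n | ∀ i, x i ∈ Ico 0 t} := by
      ext x
      simp only [ZSpan.mem_fundamentalDomain, hb, mem_ofPred_eq, mem_Ico]
      refine forall_congr' fun i => ?_
      rw [inv_mul_lt_iff₀ ht, mul_one, mul_nonneg_iff_of_pos_left (inv_pos.2 ht)]
    rw [this, volume_box _ fun _ => measurableSet_Ico]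
    simp
  have hcT : Countable T := (hT.countable hD hne hε).to_subtype
  -- For each shift `z`, the periodic family `z + T + tℤⁿ` has disjoint copies, and those with
  -- nonzero weight lie in `U` by `hfU`.
  have key : ∀ z : E n, ∑' (h : T) (k : Submodule.span ℤ (range b)), f (k +ᵥ (z + h)) ≤
      packSup D ε U f := by
    intro z
    rw [← ENNReal.tsum_prod (f := fun (h : T) (k : Submodule.span ℤ (range b)) =>
      f (k +ᵥ (z + (h : E n))))]
    refine tsum_le_packSup hne f
      (fun q : T × Submodule.span ℤ (range b) => q.2 +ᵥ (z + (q.1 : E n)))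
      (fun i => hfU _) ?_
    rintro ⟨h, k⟩ ⟨h', k'⟩ hne'
    rw [Set.disjoint_left]
    rintro _ ⟨y, hy, rfl⟩ ⟨y', hy', h2⟩
    simp only [Submodule.vadd_def, vadd_eq_add] at h2
    by_cases hk : k = k'
    · subst hk
      have hh : h ≠ h' := fun h => hne' (by rw [h])
      refine Set.disjoint_left.1 (hT.disjoint h.2 h'.2 (fun h => hh (Subtype.ext h)))
        ⟨y, hy, rfl⟩ ⟨y', hy', ?_⟩
      have h3 : ε • y' + (h' : E n) + (k + z) = ε • y + (h : E n) + (k + z) := by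
        rw [show ε • y' + (h' : E n) + (k + z) = ε • y' + ((k : E n) + (z + h')) by abel, h2]
        abel
      exact add_right_cancel h3
    -- Distinct lattice vectors differ in some coordinate by at least `t`, whereas two points of the
    -- open cube of side `t` differ there by less than `t`.
    · have h3 : ∃ i, (k : E n) i ≠ (k' : E n) i := by
        by_contra! hcon
        exact hk (Subtype.ext (PiLp.ext hcon))
      obtain ⟨i, hi⟩ := h3
      obtain ⟨a, ha⟩ := (b.mem_span_iff_repr_mem ℤ _).1 k.2 i
      obtain ⟨a', ha'⟩ := (b.mem_span_iff_repr_mem ℤ _).1 k'.2 i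
      rw [hb] at ha ha'
      have e1 : (k : E n) i = t * a := by
        rw [show ((a : ℝ)) = _ from ha]; field_simp
      have e2 : (k' : E n) i = t * a' := by
        rw [show ((a' : ℝ)) = _ from ha']; field_simp
      have m1 := hT.subset _ h.2 ⟨y, hy, rfl⟩ i
      have m2 := hT.subset _ h'.2 ⟨y', hy', rfl⟩ i
      have h4 := congrArg (fun x : E n => x i) h2
      simp only [PiLp.add_apply, PiLp.smul_apply, smul_eq_mul, mem_Ioo, e1, e2] at h4 m1 m2
      have h5 : a ≠ a' := by
        rintro rfl
        exact hi (by rw [e1, e2])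
      have h6 : t * (a - a' : ℝ) < t * 1 := by linarith
      have h7 : t * (a' - a : ℝ) < t * 1 := by linarith
      have h8 : ((a - a' : ℤ) : ℝ) < (1 : ℤ) := by
        push_cast; exact lt_of_mul_lt_mul_left h6 ht.le
      have h9 : ((a' - a : ℤ) : ℝ) < (1 : ℤ) := by
        push_cast; exact lt_of_mul_lt_mul_left h7 ht.le
      have := Int.cast_lt.1 h8
      have := Int.cast_lt.1 h9
      omega
  have : VAddInvariantMeasure (Submodule.span ℤ (range b)) (E n) volume :=
    ⟨fun c s _ => measure_preimage_add volume (c : E n) s⟩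
  -- Unfolding: an integral over the whole space is the sum over the lattice of integrals over one
  -- cell, whatever the shift `h`.
  have hshift : ∀ h : E n, ∫⁻ x, f x =
      ∑' k : Submodule.span ℤ (range b), ∫⁻ z in ZSpan.fundamentalDomain b, f (k +ᵥ (z + h)) := by
    intro h
    rw [← lintegral_add_right_eq_self f h, hF.lintegral_eq_tsum'']
    simp only [Submodule.vadd_def, vadd_eq_add, add_assoc]
  have hmeas : ∀ (h : T) (k : Submodule.span ℤ (range b)),
      Measurable fun z : E n => f (k +ᵥ (z + (h : E n))) := by
    intro h k
    simp only [Submodule.vadd_def, vadd_eq_add]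
    fun_prop
  calc (∑' _ : T, (1 : ℝ≥0∞)) * ∫⁻ x, f x
      = ∑' h : T, ∫⁻ x, f x := by rw [← ENNReal.tsum_mul_right]; simp
    _ = ∑' (h : T) (k : Submodule.span ℤ (range b)),
          ∫⁻ z in ZSpan.fundamentalDomain b, f (k +ᵥ (z + h)) :=
        tsum_congr fun h => hshift h
    _ = ∫⁻ z in ZSpan.fundamentalDomain b,
          ∑' (h : T) (k : Submodule.span ℤ (range b)), f (k +ᵥ (z + h)) := by
        rw [lintegral_tsum fun h => (Measurable.tsum fun k => hmeas h k).aemeasurable]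
        exact tsum_congr fun h => (lintegral_tsum fun k => (hmeas h k).aemeasurable).symm
    _ ≤ ∫⁻ z in ZSpan.fundamentalDomain b, packSup D ε U f := lintegral_mono fun z => key z
    _ = ENNReal.ofReal t ^ n * packSup D ε U f := by
        rw [setLIntegral_const, hvol, mul_comm]

end CoreBMO

end

/-! ### Packing numbers of cubes at different scales, and the packing constant. -/

noncomputable section

namespace CoreBMO

variable {n m : ℕ}
variable {D U : Set (E n)} {ε t R : ℝ}

/-- Comparison of an arbitrary packing with the densest packings of cubes of side `t`. -/
theorem mul_packSup_le (hD : IsOpen D) (hne : D.Nonempty) (hε : 0 < ε) (hR0 : 0 ≤ R)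
    (hR : D ⊆ Metric.closedBall 0 R) {f F : E n → ℝ≥0∞} (hF : Measurable F)
    (hfF : ∀ h z, copy D ε h ⊆ U → (∀ i, |z i - h i| ≤ t) → f h ≤ F z) :
    ENNReal.ofReal (t - 2 * ε * R) ^ n * packSup D ε U f ≤ packCount D ε t * ∫⁻ x, F x := by
  rw [← packSup_const_mul]
  refine packSup_le fun T hT => ?_
  -- The margin `ε * R` on each side ensures that for `z ∈ W h` the copy at `h` stays in the cube of
  -- side `t` centred at `z`.
  set s := t - 2 * ε * R with hs
  have hεR : 0 ≤ ε * R := by positivity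
  let W : E n → Set (E n) := fun h => (fun z => z - h) ⁻¹' cube n s
  have hW : ∀ h, MeasurableSet (W h) := fun h =>
    ((isOpen_cube s).preimage (f := fun z => z - h) (by fun_prop)).measurableSet
  have hvW : ∀ h, volume (W h) = ENNReal.ofReal s ^ n := by
    intro h
    rw [← volume_cube (n := n) s, ← measure_preimage_add_right volume (-h) (cube n s)]
    simp only [W, sub_eq_add_neg]
  have hcT : Countable T := (hT.countable hD hne hε).to_subtype
  -- The translations `h` with `z ∈ W h`, moved by `-z`, form a packing of the cube of side `t`. The
  -- lemma is this count, weighted by `F` and integrated in `z`.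
  have hcount : ∀ z, ∑' h : T, (W h).indicator (fun _ => (1 : ℝ≥0∞)) z ≤ packCount D ε t := by
    intro z
    have e : ∑' h : T, (W h).indicator (fun _ => (1 : ℝ≥0∞)) z =
        ∑' h : {h : T | z ∈ W h}, (1 : ℝ≥0∞) := by
      rw [tsum_subtype {h : T | z ∈ W h} (fun _ => (1 : ℝ≥0∞))]
      refine tsum_congr fun h => ?_
      by_cases hz : z ∈ W h <;> simp [hz]
    rw [e]
    refine tsum_le_packSup hne (fun _ => 1) (fun h : {h : T | z ∈ W h} => (h : E n) - z) ?_ ?_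
    · rintro ⟨h, hz⟩ - _ ⟨y, hy, rfl⟩ i
      have h1 := hz i
      have h2 : |y i| ≤ R := (abs_coord_le y i).trans (by simpa using hR hy)
      have h3 : ε * |y i| ≤ ε * R := by gcongr
      have h4 : |ε * y i| ≤ ε * R := by rwa [abs_mul, abs_of_pos hε]
      have h5 := abs_le.1 h4
      simp only [PiLp.add_apply, PiLp.smul_apply, PiLp.sub_apply, smul_eq_mul, mem_Ioo] at h1 ⊢
      constructor <;> linarith [h1.1, h1.2, h5.1, h5.2]
    · rintro ⟨h, hz⟩ ⟨h', hz'⟩ hne'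
      have hd := hT.disjoint h.2 h'.2 fun e => hne' (Subtype.ext (Subtype.ext e))
      rw [Set.disjoint_left]
      rintro _ ⟨y, hy, rfl⟩ ⟨y', hy', h2⟩
      refine Set.disjoint_left.1 hd ⟨y, hy, rfl⟩ ⟨y', hy', ?_⟩
      simpa [← add_sub_assoc] using h2
  calc ∑' h : T, ENNReal.ofReal s ^ n * f h
      = ∑' h : T, ∫⁻ z, (W h).indicator (fun _ => f h) z := by
        refine tsum_congr fun h => ?_
        rw [lintegral_indicator_const (hW h), hvW, mul_comm]
    _ ≤ ∑' h : T, ∫⁻ z, (W h).indicator (fun _ => (1 : ℝ≥0∞)) z * F z := by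
        refine ENNReal.tsum_le_tsum fun h => lintegral_mono fun z => ?_
        by_cases hz : z ∈ W h
        · simp only [hz, indicator_of_mem, one_mul]
          refine hfF _ _ (hT.subset _ h.2) fun i => ?_
          have h1 := hz i
          simp only [PiLp.sub_apply, mem_Ioo] at h1
          rw [abs_le]
          constructor <;> linarith [h1.1, h1.2]
        · simp [hz]
    _ = ∫⁻ z, (∑' h : T, (W h).indicator (fun _ => (1 : ℝ≥0∞)) z) * F z := by
        simp only [← ENNReal.tsum_mul_right]
        refine (lintegral_tsum fun h : T => ?_).symm
        exact ((measurable_const.indicator (hW h)).mul hF).aemeasurable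
    _ ≤ ∫⁻ z, packCount D ε t * F z := lintegral_mono fun z => by gcongr; exact hcount z
    _ = _ := lintegral_const_mul _ hF

theorem packCount_scale_le (hne : D.Nonempty) {c : ℝ} (hc : 0 < c) :
    packCount D (c * ε) (c * t) ≤ packCount D ε t := by
  refine packSup_le fun T hT => ?_
  have key : ∀ h y : E n, ε • y + c⁻¹ • h = c⁻¹ • ((c * ε) • y + h) := by
    intro h y
    rw [smul_add, smul_smul, inv_mul_cancel_left₀ hc.ne']
  refine tsum_le_packSup hne (fun _ => 1) (fun h : T => c⁻¹ • (h : E n)) ?_ ?_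
  · rintro h - _ ⟨y, hy, rfl⟩ i
    have h1 := hT.subset _ h.2 ⟨y, hy, rfl⟩ i
    simp only [key]
    simp only [PiLp.smul_apply, smul_eq_mul, mem_Ioo] at h1 ⊢
    rw [lt_inv_mul_iff₀ hc, inv_mul_lt_iff₀ hc]
    constructor <;> linarith [h1.1, h1.2]
  · intro h h' hne'
    have hd := hT.disjoint h.2 h'.2 fun e => hne' (Subtype.ext e)
    rw [Set.disjoint_left]
    rintro _ ⟨y, hy, rfl⟩ ⟨y', hy', h2⟩
    simp only [key] at h2
    exact Set.disjoint_left.1 hd ⟨y, hy, rfl⟩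
      ⟨y', hy', smul_right_injective _ (inv_ne_zero hc.ne') h2⟩

theorem packCount_scale (hne : D.Nonempty) {c : ℝ} (hc : 0 < c) :
    packCount D (c * ε) (c * t) = packCount D ε t := by
  refine le_antisymm (packCount_scale_le hne hc) ?_
  have := packCount_scale_le (ε := c * ε) (t := c * t) hne (inv_pos.2 hc)
  rwa [inv_mul_cancel_left₀ hc.ne', inv_mul_cancel_left₀ hc.ne'] at this

/-- Each copy has the same positive volume, and disjoint copies cannot fill more than the volume of
the cube. -/
theorem packCount_ne_top (hD : IsOpen D) (hne : D.Nonempty) (hε : 0 < ε) :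
    packCount D ε t ≠ ⊤ := by
  have h0 : ENNReal.ofReal (ε ^ n) * volume D ≠ 0 := by
    have := (hD.measure_pos volume hne).ne'
    simp only [ne_eq, mul_eq_zero, ENNReal.ofReal_eq_zero, not_or, not_le]
    exact ⟨by positivity, this⟩
  have h1 : packCount D ε t * (ENNReal.ofReal (ε ^ n) * volume D) ≤ ENNReal.ofReal t ^ n := by
    rw [mul_comm, packCount, ← packSup_const_mul, ← volume_cube]
    refine packSup_le fun T hT => ?_
    have hcT : Countable T := (hT.countable hD hne hε).to_subtype
    calc ∑' h : T, ENNReal.ofReal (ε ^ n) * volume D * 1 = ∑' h : T, volume (copy D ε (h : E n)) :=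
          tsum_congr fun h => by rw [volume_copy hε, mul_one]
      _ = volume (⋃ h : T, copy D ε (h : E n)) := by
          refine (measure_iUnion ?_ fun h => (isOpen_copy hD hε _).measurableSet).symm
          exact fun h h' hne' => hT.disjoint h.2 h'.2 fun e => hne' (Subtype.ext e)
      _ ≤ volume (cube n t) := measure_mono (iUnion_subset fun h => hT.subset _ h.2)
  intro h
  rw [h, ENNReal.top_mul h0] at h1
  exact (h1.trans_lt (ENNReal.pow_lt_top ENNReal.ofReal_lt_top)).ne rfl

/-- The normalized packing number of the unit cube. -/
def density (D : Set (E n)) (ε : ℝ) : ℝ≥0∞ := ENNReal.ofReal ε ^ n * packCount D ε 1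

theorem density_ne_top (hD : IsOpen D) (hne : D.Nonempty) (hε : 0 < ε) :
    density D ε ≠ ⊤ :=
  ENNReal.mul_ne_top (ENNReal.pow_ne_top ENNReal.ofReal_ne_top) (packCount_ne_top hD hne hε)

theorem packCount_eq (hne : D.Nonempty) (ht : 0 < t) :
    ENNReal.ofReal ε ^ n * packCount D ε t = ENNReal.ofReal t ^ n * density D (ε / t) := by
  have h1 : packCount D ε t = packCount D (ε / t) 1 := by
    rw [← packCount_scale (ε := ε / t) (t := 1) hne ht, mul_div_cancel₀ _ ht.ne', mul_one]
  rw [h1, density, ← mul_assoc, ← mul_pow, ← ENNReal.ofReal_mul ht.le, mul_div_cancel₀ _ ht.ne']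

/-- A packing at scale `ε` is compared with the densest packings of cubes of side `ε / δ`, which
after rescaling are packings of the unit cube at scale `δ`. For fixed `δ` the last factor tends to
`1` as `ε → 0`. -/
theorem density_mul_le (hD : IsOpen D) (hne : D.Nonempty) (hε : 0 < ε) (hR0 : 0 ≤ R)
    (hR : D ⊆ Metric.closedBall 0 R) {δ : ℝ} (hδ : 0 < δ) :
    density D ε * ENNReal.ofReal (1 - 2 * δ * R) ^ n ≤
      density D δ * ENNReal.ofReal (1 + 2 * ε * R + 2 * (ε / δ)) ^ n := by
  -- A copy inside the unit cube has its translation vector in the cube of side `1 + 2 * ε * R`;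
  -- points within `ε / δ` of it in each coordinate add `2 * (ε / δ)` to the side.
  set r := 1 + 2 * ε * R + 2 * (ε / δ) with hr
  have h1 := mul_packSup_le (U := cube n 1) (t := ε / δ) (f := fun _ => 1)
    (F := (cube n r).indicator fun _ => 1) hD hne hε hR0 hR
    (measurable_one.indicator (isOpen_cube r).measurableSet) (by
      intro h z hh hz
      obtain ⟨d, hd⟩ := hne
      have hzr : z ∈ cube n r := by
        intro i
        have h1 := hh ⟨d, hd, rfl⟩ i
        have h2 : |d i| ≤ R := (abs_coord_le d i).trans (by simpa using hR hd)
        have h3 : ε * |d i| ≤ ε * R := by gcongr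
        have h4 : |ε * d i| ≤ ε * R := by rwa [abs_mul, abs_of_pos hε]
        have h5 := abs_le.1 h4
        have h6 := abs_le.1 (hz i)
        simp only [PiLp.add_apply, PiLp.smul_apply, smul_eq_mul, mem_Ioo] at h1 ⊢
        constructor <;> linarith [h1.1, h1.2, h5.1, h5.2, h6.1, h6.2]
      simp [hzr])
  rw [lintegral_indicator_const (isOpen_cube r).measurableSet, volume_cube, one_mul] at h1
  have h2 : ENNReal.ofReal (ε / δ - 2 * ε * R) =
      ENNReal.ofReal (ε / δ) * ENNReal.ofReal (1 - 2 * δ * R) := by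
    rw [← ENNReal.ofReal_mul (by positivity)]
    congr 1
    field_simp
  have h3 : packCount D ε (ε / δ) = packCount D δ 1 := by
    rw [← packCount_scale (ε := δ) (t := 1) hne (div_pos hε hδ), div_mul_cancel₀ _ hδ.ne', mul_one]
  have h4 : ENNReal.ofReal δ * ENNReal.ofReal (ε / δ) = ENNReal.ofReal ε := by
    rw [← ENNReal.ofReal_mul hδ.le, mul_div_cancel₀ _ hδ.ne']
  calc density D ε * ENNReal.ofReal (1 - 2 * δ * R) ^ n
      = ENNReal.ofReal δ ^ n *
          (ENNReal.ofReal (ε / δ - 2 * ε * R) ^ n * packSup D ε (cube n 1) fun _ => 1) := by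
        rw [h2, density, packCount, ← h4]
        ring
    _ ≤ ENNReal.ofReal δ ^ n * (packCount D ε (ε / δ) * ENNReal.ofReal r ^ n) := by gcongr
    _ = _ := by rw [h3, density, mul_assoc]

/-- One copy fits into a cube of side `3 * ε * R`; averaging its periodic repetition over all shifts
gives a crude packing. This is what keeps the packing constant away from `0`. -/
theorem one_sub_pow_le_density (hD : IsOpen D) (hne : D.Nonempty) (hε : 0 < ε) (hR0 : 0 < R)
    (hR : D ⊆ Metric.closedBall 0 R) :
    ENNReal.ofReal (1 - 2 * ε * R) ^ n ≤ ENNReal.ofReal (3 * R) ^ n * density D ε := by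
  set S : Set (E n) := {x | copy D ε x ⊆ cube n 1}
  have hS : MeasurableSet S := (isClosed_admissible hD hε _).measurableSet
  have h1 := packCount_mul_lintegral_le (U := cube n 1) (t := 3 * ε * R) hD hne hε (by positivity)
    (f := S.indicator fun _ => 1) (measurable_one.indicator hS) (fun x hx => by
      by_contra h
      exact hx (indicator_of_notMem h _))
  rw [lintegral_indicator_const hS, one_mul] at h1
  have hcoord : ∀ (s : ℝ) (x : E n), x ∈ cube n s → copy D ε x ⊆ cube n (s + 2 * ε * R) := by
    rintro s x hx _ ⟨d, hd, rfl⟩ i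
    have h1 := hx i
    have h2 : |d i| ≤ R := (abs_coord_le d i).trans (by simpa using hR hd)
    have h3 : ε * |d i| ≤ ε * R := by gcongr
    have h4 : |ε * d i| ≤ ε * R := by rwa [abs_mul, abs_of_pos hε]
    have h5 := abs_le.1 h4
    simp only [PiLp.add_apply, PiLp.smul_apply, smul_eq_mul, mem_Ioo] at h1 ⊢
    constructor <;> linarith [h1.1, h1.2, h5.1, h5.2]
  have h2 : ENNReal.ofReal (1 - 2 * ε * R) ^ n ≤ volume S := by
    rw [← volume_cube]
    refine measure_mono fun x hx => ?_
    have := hcoord _ x hx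
    rwa [sub_add_cancel] at this
  have h3 : 1 ≤ packCount D ε (3 * ε * R) := by
    have := tsum_le_packSup (ε := ε) (U := cube n (3 * ε * R)) hne (fun _ => 1)
      (fun _ : Unit => (0 : E n)) (fun _ _ => ?_) (fun i j hij => (hij rfl).elim)
    · simpa [packCount] using this
    · have := hcoord (ε * R) 0 (fun i => by
        simp only [PiLp.zero_apply, mem_Ioo]
        have : 0 < ε * R := by positivity
        constructor <;> linarith)
      rwa [show ε * R + 2 * ε * R = 3 * ε * R by ring] at this
  have h4 : packSup D ε (cube n 1) (S.indicator fun _ => 1) ≤ packCount D ε 1 :=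
    packSup_mono fun x _ => indicator_le_self' (fun _ _ => zero_le_one) x
  calc ENNReal.ofReal (1 - 2 * ε * R) ^ n ≤ 1 * volume S := by rwa [one_mul]
    _ ≤ packCount D ε (3 * ε * R) * volume S := by gcongr
    _ ≤ _ := h1
    _ ≤ ENNReal.ofReal (3 * ε * R) ^ n * packCount D ε 1 := by gcongr
    _ = _ := by
      rw [density, show 3 * ε * R = (3 * R) * ε by ring, ENNReal.ofReal_mul (by positivity), mul_pow,
        mul_assoc]

theorem tendsto_ofReal_pow {f : ℝ → ℝ} {a : ℝ} (hf : Continuous f) (h : f 0 = a) :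
    Tendsto (fun ε => ENNReal.ofReal (f ε) ^ n) (𝓝[>] (0 : ℝ)) (𝓝 (ENNReal.ofReal a ^ n)) := by
  have : Continuous fun ε => ENNReal.ofReal (f ε) ^ n :=
    (ENNReal.continuous_pow n).comp (ENNReal.continuous_ofReal.comp hf)
  have h1 := this.tendsto 0
  rw [h] at h1
  exact h1.mono_left nhdsWithin_le_nhds

/-- Existence of the packing constant. -/
theorem exists_tendsto_density (hD : IsOpen D) (hne : D.Nonempty) (hDb : Bornology.IsBounded D) :
    ∃ κ : ℝ≥0∞, κ ≠ 0 ∧ κ ≠ ⊤ ∧ Tendsto (density D) (𝓝[>] (0 : ℝ)) (𝓝 κ) := by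
  obtain ⟨R, hR0, hR⟩ := hDb.subset_closedBall_lt 0 0
  set κ := limsup (density D) (𝓝[>] (0 : ℝ)) with hκ
  -- Pass to the limit `ε → 0` in `density_mul_le` with `δ` fixed. Letting `δ → 0` afterwards shows
  -- that the lower limit is at least the upper limit `κ`.
  have h1 : ∀ δ : ℝ, 0 < δ → κ * ENNReal.ofReal (1 - 2 * δ * R) ^ n ≤ density D δ := by
    intro δ hδ
    have hfin := density_ne_top hD hne hδ
    have t1 : Tendsto (fun ε => density D δ * ENNReal.ofReal (1 + 2 * ε * R + 2 * (ε / δ)) ^ n)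
        (𝓝[>] (0 : ℝ)) (𝓝 (density D δ * 1)) := by
      refine ENNReal.Tendsto.const_mul ?_ (Or.inr hfin)
      have := tendsto_ofReal_pow (n := n) (f := fun ε => 1 + 2 * ε * R + 2 * (ε / δ)) (a := 1)
        (by fun_prop) (by simp)
      simpa using this
    have hc : ENNReal.ofReal (1 - 2 * δ * R) ^ n ≠ ⊤ := ENNReal.pow_ne_top ENNReal.ofReal_ne_top
    rw [hκ, mul_comm, ← ENNReal.limsup_const_mul_of_ne_top hc]
    calc limsup (fun ε => ENNReal.ofReal (1 - 2 * δ * R) ^ n * density D ε) (𝓝[>] (0 : ℝ))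
        ≤ limsup (fun ε => density D δ * ENNReal.ofReal (1 + 2 * ε * R + 2 * (ε / δ)) ^ n)
            (𝓝[>] (0 : ℝ)) := by
          refine limsup_le_limsup ?_
          filter_upwards [self_mem_nhdsWithin] with ε hε
          rw [mul_comm]
          exact density_mul_le hD hne hε hR0.le hR hδ
      _ = density D δ := by rw [t1.limsup_eq, mul_one]
  have t2 : Tendsto (fun δ => κ * ENNReal.ofReal (1 - 2 * δ * R) ^ n) (𝓝[>] (0 : ℝ)) (𝓝 κ) := by
    have := tendsto_ofReal_pow (n := n) (f := fun δ => 1 - 2 * δ * R) (a := 1)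
      (by fun_prop) (by simp)
    have h2 := ENNReal.Tendsto.const_mul (a := κ) this (Or.inl (by simp))
    simpa using h2
  have hlim : Tendsto (density D) (𝓝[>] (0 : ℝ)) (𝓝 κ) := by
    refine tendsto_of_le_liminf_of_limsup_le ?_ le_rfl
    rw [← t2.liminf_eq]
    refine liminf_le_liminf ?_
    filter_upwards [self_mem_nhdsWithin] with δ hδ using h1 δ hδ
  refine ⟨κ, ?_, ?_, hlim⟩
  · intro h0
    rw [h0] at hlim
    have a1 := tendsto_ofReal_pow (n := n) (f := fun δ => 1 - 2 * δ * R) (a := 1)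
      (by fun_prop) (by simp)
    have a2 := ENNReal.Tendsto.const_mul (a := ENNReal.ofReal (3 * R) ^ n) hlim
      (Or.inr (ENNReal.pow_ne_top ENNReal.ofReal_ne_top))
    have a3 := le_of_tendsto_of_tendsto a1 a2 (by
      filter_upwards [self_mem_nhdsWithin] with ε hε
      exact one_sub_pow_le_density hD hne hε hR0 hR)
    simp at a3
  · intro htop
    -- This `δ` makes `1 - 2 * δ * R` equal to `1 / 2`, so an infinite `κ` would force an infinite
    -- density at a positive scale.
    have h2 := h1 (1 / (4 * R)) (by positivity)
    rw [htop, ENNReal.top_mul] at h2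
    · exact density_ne_top hD hne (by positivity) (top_le_iff.1 h2)
    · refine pow_ne_zero _ ?_
      simp only [ne_eq, ENNReal.ofReal_eq_zero, not_le]
      field_simp
      norm_num

end CoreBMO

end

/-! ### Asymptotics of weighted packings, and Minkowski's inequality for them. -/

noncomputable section

namespace CoreBMO

variable {n m : ℕ}
variable {D U : Set (E n)} {ε t R : ℝ}

theorem tendsto_div_nhdsWithin (ht : 0 < t) :
    Tendsto (fun ε : ℝ => ε / t) (𝓝[>] 0) (𝓝[>] 0) := by
  refine tendsto_nhdsWithin_iff.2 ⟨?_, ?_⟩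
  · have : Continuous fun ε : ℝ => ε / t := by fun_prop
    have h := this.tendsto 0
    rw [zero_div] at h
    exact h.mono_left nhdsWithin_le_nhds
  · filter_upwards [self_mem_nhdsWithin] with ε hε using div_pos hε ht

theorem lintegral_ne_top_of_hasCompactSupport {f : E n → ℝ≥0} (hf : Continuous f)
    (hfc : HasCompactSupport f) : ∫⁻ x, (f x : ℝ≥0∞) ≠ ⊤ := by
  have h1 : Continuous fun x => (f x : ℝ) := by fun_prop
  have h2 : Integrable (fun x => (f x : ℝ)) volume :=
    h1.integrable_of_hasCompactSupport (hfc.comp_left (g := fun a : ℝ≥0 => (a : ℝ)) rfl)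
  have h3 := h2.hasFiniteIntegral
  rw [hasFiniteIntegral_iff_enorm] at h3
  simpa using h3.ne

/-- Asymptotic upper bound for weighted packings. -/
theorem limsup_packSup_le (hD : IsOpen D) (hne : D.Nonempty) (hDb : Bornology.IsBounded D)
    {κ : ℝ≥0∞} (hκ : κ ≠ ⊤) (hlim : Tendsto (density D) (𝓝[>] (0 : ℝ)) (𝓝 κ))
    (U : Set (E n)) {f : E n → ℝ≥0} (hf : Continuous f) (hfc : HasCompactSupport f) :
    limsup (fun ε => ENNReal.ofReal ε ^ n * packSup D ε U fun x => f x) (𝓝[>] (0 : ℝ)) ≤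
      κ * ∫⁻ x, f x := by
  obtain ⟨R, hR0, hR⟩ := hDb.subset_closedBall_lt 0 0
  set K := Metric.cthickening 1 (tsupport f) with hK
  have hKc : IsCompact K := hfc.isCompact.cthickening
  have hKm : MeasurableSet K := hKc.measurableSet
  have hfin := lintegral_ne_top_of_hasCompactSupport hf hfc
  have main : ∀ w : ℝ≥0, 0 < w →
      limsup (fun ε => ENNReal.ofReal ε ^ n * packSup D ε U fun x => f x) (𝓝[>] (0 : ℝ)) ≤
        κ * ((∫⁻ x, (f x : ℝ≥0∞)) + w * volume K) := by
    intro w hw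
    set I := (∫⁻ x, (f x : ℝ≥0∞)) + w * volume K with hI
    have hIfin : I ≠ ⊤ :=
      ENNReal.add_ne_top.2 ⟨hfin, ENNReal.mul_ne_top ENNReal.coe_ne_top hKc.measure_lt_top.ne⟩
    have hu := hfc.uniformContinuous_of_continuous hf
    obtain ⟨δ, hδ, hδf⟩ := Metric.uniformContinuous_iff.1 hu w hw
    -- The factor `n` is the loss in `norm_le_of_coord` when passing from coordinates to the
    -- Euclidean norm. On cubes of this size `f` varies by less than `w`, and only inside `K`.
    obtain ⟨t, ht, htδ⟩ : ∃ t : ℝ, 0 < t ∧ n * t < min δ 1 := by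
      refine ⟨min δ 1 / (n + 1), by positivity, ?_⟩
      have : 0 < min δ 1 := by positivity
      rw [← mul_div_assoc, div_lt_iff₀ (by positivity)]
      linarith
    have hpow : ENNReal.ofReal t ^ n ≠ 0 := by
      refine pow_ne_zero _ ?_
      simpa using ht
    have hpow' : ENNReal.ofReal t ^ n ≠ ⊤ := ENNReal.pow_ne_top ENNReal.ofReal_ne_top
    have hbound : ∀ ε : ℝ, 0 < ε →
        ENNReal.ofReal (t - 2 * ε * R) ^ n * packSup D ε U (fun x => f x) ≤
          packCount D ε t * I := by
      intro ε hε
      have h1 := mul_packSup_le (U := U) (t := t) (f := fun x => f x)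
        (F := fun z => f z + K.indicator (fun _ => (w : ℝ≥0∞)) z) hD hne hε hR0.le hR
        ((hf.measurable.coe_nnreal_ennreal).add (measurable_const.indicator hKm)) (by
          intro h z _ hz
          have hd : dist z h < min δ 1 := by
            rw [dist_eq_norm]
            exact (norm_le_of_coord (x := z - h) hz).trans_lt htδ
          by_cases hh : h ∈ tsupport f
          · have hzK : z ∈ K := Metric.mem_cthickening_of_dist_le z h 1 _ hh
              (hd.le.trans (min_le_right _ _))
            rw [indicator_of_mem hzK]
            have h2 := hδf (hd.trans_le (min_le_left _ _))
            rw [NNReal.dist_eq] at h2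
            have h3 : (f h : ℝ) ≤ f z + w := by linarith [neg_abs_le ((f z : ℝ) - f h)]
            exact_mod_cast h3
          · simp [image_eq_zero_of_notMem_tsupport hh])
      rwa [lintegral_add_left hf.measurable.coe_nnreal_ennreal,
        lintegral_indicator_const hKm] at h1
    have t1 : Tendsto (fun ε => (ENNReal.ofReal t ^ n * density D (ε / t) * I) /
        ENNReal.ofReal (t - 2 * ε * R) ^ n) (𝓝[>] (0 : ℝ))
        (𝓝 ((ENNReal.ofReal t ^ n * κ * I) / ENNReal.ofReal t ^ n)) := by
      refine ENNReal.Tendsto.div ?_ (Or.inr hpow) ?_ (Or.inl hpow')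
      · refine ENNReal.Tendsto.mul_const ?_ (Or.inr hIfin)
        exact ENNReal.Tendsto.const_mul (hlim.comp (tendsto_div_nhdsWithin ht)) (Or.inr hpow')
      · exact tendsto_ofReal_pow (f := fun ε => t - 2 * ε * R) (by fun_prop) (by simp)
    have e1 : (ENNReal.ofReal t ^ n * κ * I) / ENNReal.ofReal t ^ n = κ * I := by
      rw [mul_assoc, mul_comm, ENNReal.mul_div_cancel_right hpow hpow']
    rw [← e1, ← t1.limsup_eq]
    refine limsup_le_limsup ?_
    have hsmall : ∀ᶠ ε in 𝓝[>] (0 : ℝ), ε < t / (2 * R) :=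
      nhdsWithin_le_nhds (gt_mem_nhds (by positivity))
    filter_upwards [self_mem_nhdsWithin, hsmall] with ε hε hεt
    have hε' : 0 < ε := hε
    have hpos : 0 < t - 2 * ε * R := by
      rw [lt_div_iff₀ (by positivity)] at hεt
      linarith
    rw [ENNReal.le_div_iff_mul_le (Or.inl (pow_ne_zero _ (by simpa using hpos)))
      (Or.inl (ENNReal.pow_ne_top ENNReal.ofReal_ne_top)), ← packCount_eq hne ht]
    calc _ = ENNReal.ofReal ε ^ n *
          (ENNReal.ofReal (t - 2 * ε * R) ^ n * packSup D ε U fun x => f x) := by ring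
      _ ≤ ENNReal.ofReal ε ^ n * (packCount D ε t * I) := by
          gcongr _ * ?_
          exact hbound ε hε'
      _ = _ := by ring
  -- The auxiliary side `t` has disappeared in the limit `ε → 0`; only the oscillation `w` remains
  -- to be sent to `0`.
  have t2 : Tendsto (fun w : ℝ≥0 => κ * ((∫⁻ x, (f x : ℝ≥0∞)) + w * volume K)) (𝓝[>] 0)
      (𝓝 (κ * ((∫⁻ x, (f x : ℝ≥0∞)) + (0 : ℝ≥0) * volume K))) := by
    refine ENNReal.Tendsto.const_mul (Tendsto.const_add _ ?_) (Or.inr hκ)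
    refine ENNReal.Tendsto.mul_const ?_ (Or.inr hKc.measure_lt_top.ne)
    exact (ENNReal.tendsto_coe.2 tendsto_id).mono_left nhdsWithin_le_nhds
  simp only [ENNReal.coe_zero, zero_mul, add_zero] at t2
  exact ge_of_tendsto t2 (by filter_upwards [self_mem_nhdsWithin] with w hw using main w hw)

theorem eventually_copy_subset (hDb : Bornology.IsBounded D) (hU : IsOpen U) {x : E n}
    (hx : x ∈ U) : ∀ᶠ ε in 𝓝[>] (0 : ℝ), copy D ε x ⊆ U := by
  obtain ⟨R, hR0, hR⟩ := hDb.subset_closedBall_lt 0 0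
  obtain ⟨r, hr, hrU⟩ := Metric.isOpen_iff.1 hU x hx
  have hsmall : ∀ᶠ ε in 𝓝[>] (0 : ℝ), ε < r / R :=
    nhdsWithin_le_nhds (gt_mem_nhds (by positivity))
  filter_upwards [self_mem_nhdsWithin, hsmall] with ε hε hεr
  refine (copy_subset_closedBall hε hR x).trans
    ((Metric.closedBall_subset_ball ?_).trans hrU)
  rwa [lt_div_iff₀ hR0] at hεr

/-- Asymptotic lower bound for weighted packings. -/
theorem le_liminf_packSup (hD : IsOpen D) (hne : D.Nonempty) (hDb : Bornology.IsBounded D)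
    {κ : ℝ≥0∞} (hκ : κ ≠ ⊤) (hlim : Tendsto (density D) (𝓝[>] (0 : ℝ)) (𝓝 κ))
    (hU : IsOpen U) {f : E n → ℝ≥0} (hf : Continuous f) (hfc : HasCompactSupport f) :
    κ * ∫⁻ x in U, f x ≤
      liminf (fun ε => ENNReal.ofReal ε ^ n * packSup D ε U fun x => f x) (𝓝[>] (0 : ℝ)) := by
  have hfin := lintegral_ne_top_of_hasCompactSupport hf hfc
  have hfin' : ∫⁻ x in U, (f x : ℝ≥0∞) ≠ ⊤ :=
    ((setLIntegral_le_lintegral _ _).trans_lt hfin.lt_top).ne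
  have hfm := hf.measurable.coe_nnreal_ennreal
  -- Since `0` need not belong to `D`, an admissible `x` can lie outside `U`. Intersecting with `U`
  -- makes the indicators converge to that of `U` at every point.
  let S : ℝ → Set (E n) := fun ε => {x | copy D ε x ⊆ U} ∩ U
  have t1 : Tendsto (fun ε => ∫⁻ x, (S ε).indicator (fun x => (f x : ℝ≥0∞)) x) (𝓝[>] (0 : ℝ))
      (𝓝 (∫⁻ x, U.indicator (fun x => (f x : ℝ≥0∞)) x)) := by
    refine tendsto_lintegral_filter_of_dominated_convergence (fun x => f x) ?_ ?_ hfin ?_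
    · filter_upwards [self_mem_nhdsWithin] with ε hε
      exact hfm.indicator ((isClosed_admissible hD hε U).measurableSet.inter hU.measurableSet)
    · exact Eventually.of_forall fun ε => Eventually.of_forall fun x => indicator_le_self _ _ x
    · refine Eventually.of_forall fun x => ?_
      by_cases hx : x ∈ U
      · refine tendsto_const_nhds.congr' ?_
        filter_upwards [eventually_copy_subset hDb hU hx] with ε hε
        have : x ∈ S ε := ⟨hε, hx⟩
        rw [indicator_of_mem hx, indicator_of_mem this]
      · refine tendsto_const_nhds.congr' (Eventually.of_forall fun ε => ?_)
        have : x ∉ S ε := fun h => hx h.2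
        simp only [indicator_of_notMem hx, indicator_of_notMem this]
  rw [lintegral_indicator hU.measurableSet] at t1
  have t2 := ENNReal.Tendsto.mul hlim (Or.inr hfin') t1 (Or.inr hκ)
  rw [← t2.liminf_eq]
  refine liminf_le_liminf ?_
  filter_upwards [self_mem_nhdsWithin] with ε hε
  have h1 := packCount_mul_lintegral_le (U := U) (t := 1) hD hne hε one_pos
    (f := (S ε).indicator fun x => (f x : ℝ≥0∞))
    (hfm.indicator ((isClosed_admissible hD hε U).measurableSet.inter hU.measurableSet))
    (fun x hx => by
      by_contra h
      exact hx (indicator_of_notMem (fun h' => h h'.1) _))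
  rw [ENNReal.ofReal_one, one_pow, one_mul] at h1
  rw [density, mul_assoc]
  gcongr
  exact h1.trans (packSup_mono fun x _ => indicator_le_self _ _ x)

/-- Minkowski's inequality for weighted packings. -/
theorem packSup_rpow_add_le {p : ℝ} (hp : 1 ≤ p) {a b c : E n → ℝ≥0∞}
    (h : ∀ x, copy D ε x ⊆ U → a x ≤ b x + c x) :
    packSup D ε U (fun x => a x ^ p) ^ (1 / p) ≤
      packSup D ε U (fun x => b x ^ p) ^ (1 / p) + packSup D ε U (fun x => c x ^ p) ^ (1 / p) := by
  have hp0 : 0 < p := by linarith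
  rw [one_div, ENNReal.rpow_inv_le_iff hp0]
  refine packSup_le fun T hT => ?_
  rw [← ENNReal.rpow_inv_le_iff hp0, ← one_div]
  -- With the discrete σ-algebra and counting measure, the sums over `T` become integrals without
  -- measurability conditions.
  let _ : MeasurableSpace T := ⊤
  have h1 := ENNReal.lintegral_Lp_add_le (μ := (Measure.count : Measure T))
    (f := fun x => b x) (g := fun x => c x) measurable_from_top.aemeasurable
    measurable_from_top.aemeasurable hp
  simp only [lintegral_count, Pi.add_apply] at h1
  calc (∑' x : T, a x ^ p) ^ (1 / p) ≤ (∑' x : T, (b x + c x) ^ p) ^ (1 / p) := by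
        gcongr with x
        exact h _ (hT.subset _ x.2)
    _ ≤ _ := h1
    _ ≤ _ := by
        gcongr
        · exact hT.sum_le fun x => b x ^ p
        · exact hT.sum_le fun x => c x ^ p

end CoreBMO

end

noncomputable section

namespace CoreBMO

variable {n m : ℕ} {p : ℝ}
variable {D U : Set (E n)} {ε t R : ℝ}

/-! ### Change of variables -/

theorem measurableEmbedding_sim (hε : 0 < ε) (h : E n) :
    MeasurableEmbedding fun y : E n => ε • y + h :=
  Continuous.measurableEmbedding (by fun_prop) fun x y hxy =>
    smul_right_injective _ hε.ne' (add_right_cancel hxy)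

theorem map_sim_restrict (hε : 0 < ε) (h : E n) (K : Set (E n)) :
    Measure.map (fun y : E n => ε • y + h) (volume.restrict K) =
      (ENNReal.ofReal (ε ^ n))⁻¹ • volume.restrict (copy K ε h) := by
  have he := measurableEmbedding_sim hε h
  have h0 : ENNReal.ofReal (ε ^ n) ≠ 0 := by
    have : 0 < ε ^ n := by positivity
    simpa using this
  have h1 : Measure.map (fun y : E n => ε • y + h) volume =
      (ENNReal.ofReal (ε ^ n))⁻¹ • volume := by
    ext s hs
    rw [he.map_apply, Measure.smul_apply, smul_eq_mul]
    have h2 : s = copy ((fun y : E n => ε • y + h) ⁻¹' s) ε h := by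
      refine (image_preimage_eq s fun x => ⟨ε⁻¹ • (x - h), ?_⟩).symm
      simp [smul_smul, hε.ne']
    nth_rewrite 2 [h2]
    rw [volume_copy hε, ← mul_assoc, ENNReal.inv_mul_cancel h0 ENNReal.ofReal_ne_top, one_mul]
  rw [← Measure.restrict_smul, ← h1, he.restrict_map, copy, he.injective.preimage_image]

theorem setLIntegral_comp_sim (hε : 0 < ε) (h : E n) (K : Set (E n)) (G : E n → ℝ≥0∞) :
    ∫⁻ y in K, G (ε • y + h) = (ENNReal.ofReal (ε ^ n))⁻¹ * ∫⁻ x in copy K ε h, G x := by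
  rw [← (measurableEmbedding_sim hε h).lintegral_map, map_sim_restrict hε, lintegral_smul_measure,
    smul_eq_mul]

theorem setIntegral_comp_sim {F : Type*} [NormedAddCommGroup F] [NormedSpace ℝ F] (hε : 0 < ε)
    (h : E n) (K : Set (E n)) (G : E n → F) :
    ∫ y in K, G (ε • y + h) = (ε ^ n)⁻¹ • ∫ x in copy K ε h, G x := by
  rw [← (measurableEmbedding_sim hε h).integral_map, map_sim_restrict hε, integral_smul_measure,
    ENNReal.toReal_inv, ENNReal.toReal_ofReal (by positivity)]

theorem memLp_comp_sim {F : Type*} [NormedAddCommGroup F] (hε : 0 < ε) (h : E n) (K : Set (E n))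
    {G : E n → F} {q : ℝ≥0∞} (hG : MemLp G q (volume.restrict (copy K ε h))) :
    MemLp (fun y => G (ε • y + h)) q (volume.restrict K) := by
  refine (measurableEmbedding_sim hε h).memLp_map_measure_iff.1 ?_
  rw [map_sim_restrict hε]
  refine hG.smul_measure ?_
  rw [ENNReal.inv_ne_top]
  have : 0 < ε ^ n := by positivity
  simpa using this

theorem LpLoc.comp_sim {u : E n → E m} (hu : LpLoc p u) (hε : 0 < ε) (h : E n) :
    LpLoc p fun y => u (ε • y + h) :=
  fun K hK => memLp_comp_sim hε h K (hu _ (hK.image (by fun_prop)))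

theorem LpLoc.add {u v : E n → E m} (hu : LpLoc p u) (hv : LpLoc p v) : LpLoc p (u + v) :=
  fun K hK => (hu K hK).add (hv K hK)

theorem LpLoc.sub {u v : E n → E m} (hu : LpLoc p u) (hv : LpLoc p v) : LpLoc p (u - v) :=
  fun K hK => (hu K hK).sub (hv K hK)

theorem LpLoc.memLp {u : E n → E m} (hu : LpLoc p u) (hDb : Bornology.IsBounded D) :
    MemLp u (ENNReal.ofReal p) (volume.restrict D) :=
  (hu _ hDb.isCompact_closure).mono_measure (Measure.restrict_mono_set _ subset_closure)

theorem lpLoc_of_memLp {u : E n → E m} (hu : MemLp u (ENNReal.ofReal p) volume) : LpLoc p u :=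
  fun K _ => hu.restrict K

/-! ### Core functionals for the trivial group -/

/-- Core functionals for the group of the maps `x ↦ ε x + h`. -/
abbrev Core {n : ℕ} (m : ℕ) (p : ℝ) (D : Set (E n)) :=
  CoreFunctional m p D (similarities (⊥ : Subgroup (Matrix.specialOrthogonalGroup (Fin n) ℝ)))

/-- The affine equivalence `x ↦ ε x + h`. -/
def simEquiv (hε : 0 < ε) (h : E n) : E n ≃ᵃ[ℝ] E n :=
  (LinearEquiv.smulOfNeZero ℝ (E n) ε hε.ne').toAffineEquiv.trans (AffineEquiv.constVAdd ℝ (E n) h)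

theorem simEquiv_apply (hε : 0 < ε) (h y : E n) : simEquiv hε h y = ε • y + h := by
  simp [simEquiv, add_comm]

theorem mem_scaledMotions_bot {F : E n ≃ᵃ[ℝ] E n} :
    F ∈ scaledMotions ⊥ ε ↔ ∃ h : E n, ∀ x, F x = ε • x + h := by
  constructor
  · rintro ⟨S, hS, h, hF⟩
    rw [Subgroup.mem_bot] at hS
    subst hS
    exact ⟨h, fun x => by simpa using hF x⟩
  · rintro ⟨h, hF⟩
    exact ⟨1, one_mem _, h, fun x => by simpa using hF x⟩

theorem simEquiv_mem (hε : 0 < ε) (h : E n) : simEquiv hε h ∈ scaledMotions ⊥ ε :=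
  mem_scaledMotions_bot.2 ⟨h, simEquiv_apply hε h⟩

theorem simEquiv_image (hε : 0 < ε) (h : E n) (D : Set (E n)) :
    simEquiv hε h '' D = copy D ε h := by
  simp only [copy, ← simEquiv_apply hε h]

theorem mem_images_iff (hε : 0 < ε) {D' : Set (E n)} :
    D' ∈ images (scaledMotions ⊥ ε) D U ↔ ∃ h, D' = copy D ε h ∧ D' ⊆ U := by
  constructor
  · rintro ⟨F, hF, rfl, hU⟩
    obtain ⟨h, hh⟩ := mem_scaledMotions_bot.1 hF
    exact ⟨h, by simp only [copy, ← hh], hU⟩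
  · rintro ⟨h, rfl, hU⟩
    exact ⟨_, simEquiv_mem hε h, (simEquiv_image hε h D).symm, hU⟩

theorem mem_images_self (D : Set (E n)) :
    D ∈ images (similarities (⊥ : Subgroup (Matrix.specialOrthogonalGroup (Fin n) ℝ)) :
      Set (E n ≃ᵃ[ℝ] E n)) D univ :=
  ⟨1, one_mem _, by simp, subset_univ _⟩

/-- The change-of-variables axiom pulls every copy back to the reference set, so that only `α(·, D)`
matters from here on. -/
theorem toFun_copy (α : Core m p D) (hε : 0 < ε) (h : E n) {u : E n → E m} (hu : LpLoc p u) :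
    α.toFun u (copy D ε h) = α.toFun (fun y => u (ε • y + h)) D := by
  have h1 := α.change_var D (mem_images_self D) u hu (simEquiv hε h)
    (mem_iUnion₂.2 ⟨ε, hε, simEquiv_mem hε h⟩)
  rw [simEquiv_image] at h1
  rw [← h1]
  congr 1
  ext1 y
  simp [simEquiv_apply]

/-- The functional `G_ε` as a supremum over sets of translations. -/
theorem bmo_eq (hne : D.Nonempty) (α : Core m p D) (hε : 0 < ε) {u : E n → E m} (hu : LpLoc p u)
    (U : Set (E n)) : bmo α ε u U = ENNReal.ofReal (ε ^ ((n : ℝ) - p)) *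
      packSup D ε U fun h => (α.toFun (fun y => u (ε • y + h)) D : ℝ≥0∞) := by
  unfold bmo
  congr 1
  refine le_antisymm ?_ (packSup_le fun T hT => ?_)
  · refine iSup_le fun 𝓕 => iSup_le fun h𝓕 => iSup_le fun hd => ?_
    have h1 : ∀ D' : 𝓕, ∃ h, (D' : Set (E n)) = copy D ε h ∧ (D' : Set (E n)) ⊆ U := fun D' =>
      (mem_images_iff hε).1 (h𝓕 D'.2)
    choose c hc hcU using h1
    calc ∑' D' : 𝓕, (α.toFun u D' : ℝ≥0∞)
        = ∑' D' : 𝓕, (α.toFun (fun y => u (ε • y + c D')) D : ℝ≥0∞) :=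
          tsum_congr fun D' => by rw [← toFun_copy α hε _ hu, ← hc]
      _ ≤ _ := tsum_le_packSup hne (fun h => (α.toFun (fun y => u (ε • y + h)) D : ℝ≥0∞)) c
          (fun D' _ => by rw [← hc]; exact hcU D')
          (fun D' D'' hne' => by
            rw [← hc, ← hc]
            exact hd D'.2 D''.2 fun e => hne' (Subtype.ext e))
  · have hinj : InjOn (copy D ε) T := by
      intro h hh h' hh' e
      by_contra hne'
      have h1 := hT.disjoint hh hh' hne'
      rw [Function.onFun, e, disjoint_self] at h1
      exact (hne.image _).ne_empty h1
    refine le_iSup₂_of_le (copy D ε '' T) ?_ (le_iSup_of_le ?_ ?_)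
    · rintro _ ⟨h, hh, rfl⟩
      exact (mem_images_iff hε).2 ⟨h, rfl, hT.subset h hh⟩
    · rintro _ ⟨h, hh, rfl⟩ _ ⟨h', hh', rfl⟩ hne'
      exact hT.disjoint hh hh' fun e => hne' (by rw [e])
    · rw [tsum_image (fun D' => (α.toFun u D' : ℝ≥0∞)) hinj]
      exact (tsum_congr fun h => by rw [toFun_copy α hε _ hu]).le

/-! ### The seminorm of a core functional -/

/-- The `p`-th root of a core functional on the reference set. -/
def root (α : Core m p D) (u : E n → E m) : ℝ≥0 := α.toFun u D ^ (1 / p)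

variable (α : Core m p D)

theorem p_pos (α : Core m p D) : 0 < p := by linarith [α.one_le_p]

theorem root_rpow (u : E n → E m) : root α u ^ p = α.toFun u D := by
  rw [root, ← NNReal.rpow_mul, one_div_mul_cancel (p_pos α).ne', NNReal.rpow_one]

theorem root_congr {u v : E n → E m} (hu : LpLoc p u) (hv : LpLoc p v)
    (h : u =ᵐ[volume.restrict D] v) : root α u = root α v := by
  rw [root, root, α.ext_indep D (mem_images_self D) u v hu hv h]

theorem root_smul {u : E n → E m} (hu : LpLoc p u) (t : ℝ) :
    root α (t • u) = ‖t‖₊ * root α u := by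
  rw [root, α.homogeneous D (mem_images_self D) u hu, NNReal.mul_rpow, ← NNReal.rpow_mul,
    mul_one_div_cancel (p_pos α).ne', NNReal.rpow_one, root]

theorem root_add_const {u : E n → E m} (hu : LpLoc p u) (h : E m) :
    root α (fun x => u x + h) = root α u := by
  rw [root, α.transl D (mem_images_self D) u hu, root]

theorem root_le_one_iff (u : E n → E m) : root α u ≤ 1 ↔ α.toFun u D ≤ 1 := by
  rw [← root_rpow α u]
  constructor
  · intro h
    exact NNReal.rpow_le_one h (p_pos α).le
  · intro h
    by_contra! h1
    exact absurd h (not_le.2 (NNReal.one_lt_rpow h1 (p_pos α)))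

/-- Minkowski functional argument: the set where `α(·, D) ≤ 1` is convex, and `(u + v) / (s + t)` is
a convex combination of `u / s` and `v / t`. -/
theorem root_add_le {u v : E n → E m} (hu : LpLoc p u) (hv : LpLoc p v) :
    root α (u + v) ≤ root α u + root α v := by
  have key : ∀ s t : ℝ≥0, 0 < s → 0 < t → root α u ≤ s → root α v ≤ t →
      root α (u + v) ≤ s + t := by
    intro s t hs ht hus hvt
    have h1 : ∀ (w : E n → E m) (r : ℝ≥0), LpLoc p w → 0 < r → root α w ≤ r →
        α.toFun ((r⁻¹ : ℝ) • w) D ≤ 1 := by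
      intro w r hw hr hwr
      rw [← root_le_one_iff, root_smul α hw]
      have : ‖(r⁻¹ : ℝ)‖₊ = r⁻¹ := by ext; simp
      rw [this, inv_mul_le_iff₀ hr, mul_one]
      exact hwr
    have h2 := α.convex D (mem_images_self D) _ _ (hu.smul (s⁻¹ : ℝ)) (hv.smul (t⁻¹ : ℝ))
      (s / (s + t)) (t / (s + t)) (by rw [← add_div, div_self (add_pos hs ht).ne'])
    have h3 : ((s / (s + t) : ℝ≥0) : ℝ) • ((s⁻¹ : ℝ) • u) + ((t / (s + t) : ℝ≥0) : ℝ) •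
        ((t⁻¹ : ℝ) • v) = ((s + t : ℝ≥0)⁻¹ : ℝ) • (u + v) := by
      have hs' : (s : ℝ) ≠ 0 := by exact_mod_cast hs.ne'
      have ht' : (t : ℝ) ≠ 0 := by exact_mod_cast ht.ne'
      have hst' : (s + t : ℝ) ≠ 0 := by exact_mod_cast (add_pos hs ht).ne'
      rw [smul_smul, smul_smul, smul_add]
      push_cast
      congr 2 <;> field_simp
    rw [h3] at h2
    have h4 : α.toFun (((s + t : ℝ≥0)⁻¹ : ℝ) • (u + v)) D ≤ 1 := by
      calc _ ≤ _ := h2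
        _ ≤ s / (s + t) * 1 + t / (s + t) * 1 := by
            gcongr
            · exact h1 u s hu hs hus
            · exact h1 v t hv ht hvt
        _ = 1 := by rw [mul_one, mul_one, ← add_div, div_self (add_pos hs ht).ne']
    rw [← root_le_one_iff, root_smul α (hu.add hv)] at h4
    have h5 : ‖((s + t : ℝ≥0)⁻¹ : ℝ)‖₊ = (s + t)⁻¹ := by
      ext; simp; positivity
    rwa [h5, inv_mul_le_iff₀ (add_pos hs ht), mul_one] at h4
  -- `key` divides by `s` and `t`; the slack `η / 2` keeps them positive even if a seminorm
  -- vanishes.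
  refine le_of_forall_pos_le_add fun η hη => ?_
  have h6 := key (root α u + η / 2) (root α v + η / 2) (by positivity) (by positivity)
    le_self_add le_self_add
  calc _ ≤ _ := h6
    _ = root α u + root α v + (η / 2 + η / 2) := by ring
    _ = _ := by rw [add_halves]

theorem root_neg {u : E n → E m} (hu : LpLoc p u) : root α (-u) = root α u := by
  have := root_smul α hu (-1)
  simpa using this

theorem root_le_add_sub {u v : E n → E m} (hu : LpLoc p u) (hv : LpLoc p v) :
    root α u ≤ root α v + root α (u - v) := by
  have := root_add_le α hv (hu.sub hv)
  rwa [add_sub_cancel] at this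

theorem root_sub_comm {u v : E n → E m} (hu : LpLoc p u) (hv : LpLoc p v) :
    root α (u - v) = root α (v - u) := by
  rw [← root_neg α (hu.sub hv), neg_sub]

/-! ### Matrices -/

theorem lpLoc_mat (A : Mat m n) : LpLoc p A := lpLoc_of_continuous A.continuous

/-- The seminorm of a core functional on matrices. -/
def matSeminorm (α : Core m p D) : Seminorm ℝ (Mat m n) :=
  Seminorm.of (fun A => (root α A : ℝ))
    (fun A B => by exact_mod_cast root_add_le α (lpLoc_mat A) (lpLoc_mat B))
    (fun t A => by
      have h := root_smul α (lpLoc_mat A) t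
      have h2 : ((t • A : Mat m n) : E n → E m) = t • (A : E n → E m) := rfl
      rw [h2, h]; simp)

theorem continuous_root_mat : Continuous fun A : Mat m n => root α A := by
  have h1 : Continuous (matSeminorm α) := by
    rw [← continuousOn_univ]
    exact ConvexOn.continuousOn isOpen_univ (matSeminorm α).convexOn
  exact Topology.IsInducing.continuous_iff (NNReal.isEmbedding_coe.isInducing) |>.2 h1

theorem exists_root_mat_le : ∃ C : ℝ≥0, ∀ A : Mat m n, root α A ≤ C * ‖A‖₊ := by
  have h1 : Continuous (matSeminorm α) := by
    rw [← continuousOn_univ]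
    exact ConvexOn.continuousOn isOpen_univ (matSeminorm α).convexOn
  obtain ⟨C, hC, h⟩ := Seminorm.bound_of_continuous_normedSpace _ h1
  exact ⟨⟨C, hC.le⟩, fun A => h A⟩

/-- By invariance under constants the position `h` is irrelevant: for a linear map all copies of `ε
D` weigh the same, and `G_ε` merely counts them. -/
theorem toFun_mat_sim (A : Mat m n) (ε : ℝ) (h : E n) :
    α.toFun (fun y => A (ε • y + h)) D = ‖ε‖₊ ^ p * α.toFun A D := by
  have h1 : (fun y => A (ε • y + h)) = fun y => (ε • (A : E n → E m)) y + A h := by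
    ext1 y; simp
  rw [h1, α.transl D (mem_images_self D) _ ((lpLoc_mat A).smul ε),
    α.homogeneous D (mem_images_self D) _ (lpLoc_mat A)]

theorem scale_identity (n : ℕ) (p : ℝ) (hε : 0 < ε) :
    ENNReal.ofReal (ε ^ ((n : ℝ) - p)) * ((‖ε‖₊ ^ p : ℝ≥0) : ℝ≥0∞) = ENNReal.ofReal ε ^ n := by
  have h1 : ((‖ε‖₊ ^ p : ℝ≥0) : ℝ≥0∞) = ENNReal.ofReal (ε ^ p) := by
    rw [← ENNReal.ofReal_coe_nnreal]
    congr 1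
    simp [abs_of_pos hε]
  rw [h1, ← ENNReal.ofReal_mul (by positivity), ← Real.rpow_add hε, sub_add_cancel,
    Real.rpow_natCast, ENNReal.ofReal_pow hε.le]

theorem bmo_mat (hne : D.Nonempty) (A : Mat m n) (hε : 0 < ε) :
    bmo α ε A (unitCube n) = density D ε * α.toFun A D := by
  rw [bmo_eq hne α hε (lpLoc_mat A)]
  have h1 : ∀ h : E n, (α.toFun (fun y => A (ε • y + h)) D : ℝ≥0∞) =
      ((‖ε‖₊ ^ p : ℝ≥0) * α.toFun A D : ℝ≥0∞) * 1 := fun h => by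
    rw [toFun_mat_sim α A ε, mul_one, ENNReal.coe_mul]
  simp only [h1]
  rw [packSup_const_mul, unitCube_eq, ← packCount, density, ← scale_identity n p hε]
  ring

variable {κ : ℝ≥0∞}

theorem tendsto_bmo_mat (hne : D.Nonempty)
    (hlim : Tendsto (density D) (𝓝[>] (0 : ℝ)) (𝓝 κ)) (A : Mat m n) :
    Tendsto (fun ε => bmo α ε A (unitCube n)) (𝓝[>] (0 : ℝ)) (𝓝 (κ * α.toFun A D)) := by
  refine (ENNReal.Tendsto.mul_const hlim (Or.inr ENNReal.coe_ne_top)).congr' ?_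
  filter_upwards [self_mem_nhdsWithin] with ε hε using (bmo_mat α hne A hε).symm

theorem psi_eq (hne : D.Nonempty)
    (hlim : Tendsto (density D) (𝓝[>] (0 : ℝ)) (𝓝 κ)) (A : Mat m n) :
    psi α A = κ * α.toFun A D :=
  (tendsto_bmo_mat α hne hlim A).limsup_eq

/-- As `κ ≠ 0`, the zeros of `ψ = κ α(·, D)` are exactly the kernel of the seminorm. -/
theorem mem_nullSpace_iff (hne : D.Nonempty) (hκ : κ ≠ 0)
    (hlim : Tendsto (density D) (𝓝[>] (0 : ℝ)) (𝓝 κ)) (A : Mat m n) :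
    A ∈ nullSpace α ↔ root α A = 0 := by
  have h1 : A ∈ nullSpace α ↔ psi α A = 0 := Iff.rfl
  rw [h1, psi_eq α hne hlim, mul_eq_zero, or_iff_right hκ, ENNReal.coe_eq_zero, ← root_rpow,
    NNReal.rpow_eq_zero (p_pos α).ne']

theorem root_projection (hnull : ∀ A : Mat m n, A ∈ nullSpace α ↔ root α A = 0)
    {P : Submodule ℝ (Mat m n)} (hP : IsCompl P (nullSpace α)) (A : Mat m n) :
    root α (P.projection (nullSpace α) hP A) = root α A := by
  have hmem : A - P.projection (nullSpace α) hP A ∈ nullSpace α := by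
    rw [← Submodule.projection_apply_eq_zero_iff hP, map_sub,
      Submodule.projection_apply_of_mem_left hP (Submodule.projection_apply_mem hP A), sub_self]
  have h0 := (hnull _).1 hmem
  have e : ((A - P.projection (nullSpace α) hP A : Mat m n) : E n → E m) =
    (A : E n → E m) - (P.projection (nullSpace α) hP A : Mat m n) := rfl
  rw [e] at h0
  have h1 := root_le_add_sub α (lpLoc_mat A) (lpLoc_mat (P.projection (nullSpace α) hP A))
  have h2 := root_le_add_sub α (lpLoc_mat (P.projection (nullSpace α) hP A)) (lpLoc_mat A)
  rw [h0, add_zero] at h1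
  rw [root_sub_comm α (lpLoc_mat _) (lpLoc_mat A), h0, add_zero] at h2
  exact le_antisymm h2 h1

/-- Both projections have kernel `N`. This transfers the bound in `IsStrong`, available for one
complement only, to an arbitrary complement. -/
theorem projection_projection (N : Submodule ℝ (Mat m n))
    {P P' : Submodule ℝ (Mat m n)} (hP : IsCompl P N)
    (hP' : IsCompl P' N) (A : Mat m n) :
    P'.projection N hP' (P.projection N hP A) = P'.projection N hP' A := by
  have hmem : A - P.projection N hP A ∈ N := by
    rw [← Submodule.projection_apply_eq_zero_iff hP, map_sub,
      Submodule.projection_apply_of_mem_left hP (Submodule.projection_apply_mem hP A), sub_self]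
  rw [← Submodule.projection_apply_eq_zero_iff hP', map_sub, sub_eq_zero] at hmem
  exact hmem.symm

/-- On `P` the seminorm is a norm because `P` meets its kernel trivially, and all norms on a
finite-dimensional space are equivalent; here by compactness of the unit sphere of `P`. -/
theorem exists_norm_projection_le (hnull : ∀ A : Mat m n, A ∈ nullSpace α ↔ root α A = 0)
    {P : Submodule ℝ (Mat m n)} (hP : IsCompl P (nullSpace α)) :
    ∃ C : ℝ≥0, ∀ A : Mat m n, ‖P.projection (nullSpace α) hP A‖₊ ≤ C * root α A := by
  suffices h : ∃ C : ℝ≥0, ∀ A ∈ P, ‖A‖₊ ≤ C * root α A by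
    obtain ⟨C, hC⟩ := h
    refine ⟨C, fun A => ?_⟩
    rw [← root_projection α hnull hP A]
    exact hC _ (Submodule.projection_apply_mem hP A)
  set S : Set (Mat m n) := (P : Set (Mat m n)) ∩ Metric.sphere 0 1
  have hS : IsCompact S := (isCompact_sphere 0 1).inter_left P.closed_of_finiteDimensional
  have hpos : ∀ A ∈ S, root α A ≠ 0 := by
    intro A hA h0
    have h1 : A ∈ P ⊓ nullSpace α := ⟨hA.1, (hnull A).2 h0⟩
    rw [hP.inf_eq_bot, Submodule.mem_bot] at h1
    have := hA.2
    simp [h1] at this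
  have hcont : ContinuousOn (fun A : Mat m n => (root α A)⁻¹) S :=
    (continuous_root_mat α).continuousOn.inv₀ hpos
  obtain ⟨C, hC⟩ := hS.bddAbove_image hcont
  refine ⟨C, fun A hA => ?_⟩
  rcases eq_or_ne A 0 with rfl | hA0
  · simp
  have hnorm : ‖A‖ ≠ 0 := norm_ne_zero_iff.2 hA0
  set B : Mat m n := ‖A‖⁻¹ • A with hB
  have hBS : B ∈ S := ⟨P.smul_mem _ hA, by simp [hB, norm_smul, hnorm]⟩
  have h1 : (root α B)⁻¹ ≤ C := hC ⟨B, hBS, rfl⟩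
  have h2 : root α B = ‖A‖₊⁻¹ * root α A := by
    have h := root_smul α (lpLoc_mat A) ‖A‖⁻¹
    have e : (B : E n → E m) = ‖A‖⁻¹ • (A : E n → E m) := rfl
    rw [e, h]
    congr 1
    ext; simp
  rw [inv_le_iff_one_le_mul₀ (pos_iff_ne_zero.2 (hpos B hBS)), h2] at h1
  have hn : ‖A‖₊ ≠ 0 := by simpa using hA0
  calc ‖A‖₊ = ‖A‖₊ * 1 := (mul_one _).symm
    _ ≤ ‖A‖₊ * (C * (‖A‖₊⁻¹ * root α A)) := by gcongr
    _ = C * root α A := by field_simp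

/-! ### Continuity on `L^p` -/

theorem lpLoc_lp (w : Lp (E m) (ENNReal.ofReal p) (volume : Measure (E n))) : LpLoc p w :=
  lpLoc_of_memLp (Lp.memLp w)

/-- The seminorm of a core functional on `L^p(ℝⁿ; ℝᵐ)`. -/
def lpSeminorm : Seminorm ℝ (Lp (E m) (ENNReal.ofReal p) (volume : Measure (E n))) :=
  Seminorm.of (fun w => (root α w : ℝ))
    (fun v w => by
      rw [root_congr α (lpLoc_lp (v + w)) ((lpLoc_lp v).add (lpLoc_lp w))
        (ae_restrict_of_ae (Lp.coeFn_add v w))]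
      exact_mod_cast root_add_le α (lpLoc_lp v) (lpLoc_lp w))
    (fun t w => by
      rw [root_congr α (lpLoc_lp (t • w)) ((lpLoc_lp w).smul t)
        (ae_restrict_of_ae (Lp.coeFn_smul t w)), root_smul α (lpLoc_lp w)]
      simp)

/-- Baire category: on a Banach space a lower semicontinuous finite seminorm is continuous. Taking
the `p`-th root preserves lower semicontinuity. -/
theorem continuous_lpSeminorm [hp : Fact (1 ≤ ENNReal.ofReal p)]
    (hlsc : IsLpLowerSemicontinuous α) : Continuous (lpSeminorm α) := by
  have hq : LowerSemicontinuous (lpSeminorm α) := by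
    have h1 := hlsc D (mem_images_self D)
    exact Continuous.comp_lowerSemicontinuous (g := fun x : ℝ≥0 => ((x ^ (1 / p) : ℝ≥0) : ℝ))
      (NNReal.continuous_coe.comp (NNReal.continuous_rpow_const (by
        have := p_pos α; positivity))) h1
      (fun x y hxy => by
        have := p_pos α
        exact_mod_cast NNReal.rpow_le_rpow hxy (by positivity))
  exact Seminorm.continuous_of_lowerSemicontinuous _ hq

/-- Since `α(·, D)` sees only the values on `D`, the continuity bound on `L^p(ℝⁿ)` may be applied to
`u` cut off outside `D`. -/
theorem exists_root_le_eLpNorm (hD : IsOpen D) (hDb : Bornology.IsBounded D)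
    (hlsc : IsLpLowerSemicontinuous α) :
    ∃ C : ℝ≥0, ∀ u : E n → E m, LpLoc p u →
      (root α u : ℝ≥0∞) ≤ C * eLpNorm u (ENNReal.ofReal p) (volume.restrict D) := by
  have : Fact (1 ≤ ENNReal.ofReal p) := ⟨by simpa using α.one_le_p⟩
  obtain ⟨C, hC, h⟩ := Seminorm.bound_of_continuous_normedSpace _
    (continuous_lpSeminorm α hlsc)
  refine ⟨C.toNNReal, fun u hu => ?_⟩
  have hmem : MemLp (D.indicator u) (ENNReal.ofReal p) volume :=
    (memLp_indicator_iff_restrict hD.measurableSet).2 (hu.memLp hDb)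
  have h1 : root α u = root α (hmem.toLp _) := by
    refine root_congr α hu (lpLoc_lp _) ?_
    have h2 : D.indicator u =ᵐ[volume.restrict D] u := indicator_ae_eq_restrict hD.measurableSet
    exact h2.symm.trans (ae_restrict_of_ae hmem.coeFn_toLp.symm)
  have h3 : (root α (hmem.toLp _) : ℝ) ≤ C * ‖hmem.toLp _‖ := h _
  rw [h1, ← eLpNorm_indicator_eq_eLpNorm_restrict hD.measurableSet,
    ← ENNReal.ofReal_toReal hmem.eLpNorm_ne_top, ← Lp.norm_toLp _ hmem,
    ← ENNReal.ofReal_coe_nnreal]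
  change _ ≤ ENNReal.ofReal C * _
  rw [← ENNReal.ofReal_mul hC.le]
  exact ENNReal.ofReal_le_ofReal h3

end CoreBMO

end

noncomputable section

namespace CoreBMO

variable {n m : ℕ} {p : ℝ}
variable {D U : Set (E n)} {ε t R : ℝ}

/-! ### The distributions `D_𝔏 u` -/

theorem integrable_bilin {F G H : Type*} [NormedAddCommGroup F] [NormedSpace ℝ F]
    [NormedAddCommGroup G] [NormedSpace ℝ G] [NormedAddCommGroup H] [NormedSpace ℝ H]
    (B : F →L[ℝ] G →L[ℝ] H) {a : E n → F} (ha : Continuous a) (hac : HasCompactSupport a)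
    {v : E n → G} (hv : IntegrableOn v (tsupport a)) : Integrable fun x => B (a x) (v x) := by
  have hm : MeasurableSet (tsupport a) := (isClosed_tsupport a).measurableSet
  obtain ⟨C, hC⟩ := hac.exists_bound_of_continuous ha
  have e : (fun x => B (a x) (v x)) = fun x => B (a x) ((tsupport a).indicator v x) := by
    ext1 x
    by_cases hx : x ∈ tsupport a
    · rw [indicator_of_mem hx]
    · simp [image_eq_zero_of_notMem_tsupport hx]
  rw [e]
  have hi : Integrable ((tsupport a).indicator v) := (integrable_indicator_iff hm).2 hv
  refine (hi.norm.const_mul (‖B‖ * C)).mono'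
    (B.aestronglyMeasurable_comp₂ ha.aestronglyMeasurable hi.aestronglyMeasurable)
    (Eventually.of_forall fun x => ?_)
  calc _ ≤ ‖B‖ * ‖a x‖ * ‖(tsupport a).indicator v x‖ := B.le_opNorm₂ _ _
    _ ≤ _ := by gcongr; exact hC x

theorem LpLoc.integrableOn {u : E n → E m} (hp : 1 ≤ p) (hu : LpLoc p u) {K : Set (E n)}
    (hK : IsCompact K) : IntegrableOn u K := by
  have : IsFiniteMeasure (volume.restrict K) :=
    ⟨by rw [Measure.restrict_apply_univ]; exact hK.measure_lt_top⟩
  exact (hu K hK).integrable (by simpa using hp)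

theorem IsTest.continuous {φ : E n → ℝ} (hφ : IsTest U φ) : Continuous φ := hφ.smooth.continuous

theorem IsTest.continuous_fderiv {φ : E n → ℝ} (hφ : IsTest U φ) : Continuous (fderiv ℝ φ) :=
  hφ.smooth.continuous_fderiv (by simp)

theorem IsTest.hasCompactSupport_fderiv {φ : E n → ℝ} (hφ : IsTest U φ) :
    HasCompactSupport (fderiv ℝ φ) := hφ.compact.fderiv ℝ

theorem IsTest.fderiv_eq_zero {φ : E n → ℝ} (hφ : IsTest U φ) {x : E n} (hx : x ∉ U) :
    fderiv ℝ φ x = 0 :=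
  image_eq_zero_of_notMem_tsupport fun h => hx (hφ.support (tsupport_fderiv_subset ℝ h))

theorem IsTest.eq_zero {φ : E n → ℝ} (hφ : IsTest U φ) {x : E n} (hx : x ∉ U) : φ x = 0 :=
  image_eq_zero_of_notMem_tsupport fun h => hx (hφ.support h)

theorem IsTest.mono {φ : E n → ℝ} (hφ : IsTest U φ) {V : Set (E n)} (hUV : U ⊆ V) : IsTest V φ :=
  ⟨hφ.smooth, hφ.compact, hφ.support.trans hUV⟩

/-- The matrix `∫ u ⊗ ∇φ`. -/
def tensorInt (u : E n → E m) (φ : E n → ℝ) : Mat m n := ∫ x, (fderiv ℝ φ x).smulRight (u x)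

theorem integrable_tensor (hp : 1 ≤ p) {u : E n → E m} (hu : LpLoc p u) {φ : E n → ℝ}
    (hφ : IsTest U φ) : Integrable fun x => (fderiv ℝ φ x).smulRight (u x) :=
  integrable_bilin (ContinuousLinearMap.smulRightL ℝ (E n) (E m)) hφ.continuous_fderiv
    hφ.hasCompactSupport_fderiv (hu.integrableOn hp hφ.hasCompactSupport_fderiv)

theorem distD_eq (hp : 1 ≤ p) (L : Mat m n →ₗ[ℝ] Mat m n) {u : E n → E m} (hu : LpLoc p u)
    {φ : E n → ℝ} (hφ : IsTest U φ) : distD L U u φ = -L (tensorInt u φ) := by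
  unfold distD tensorInt
  rw [setIntegral_eq_integral_of_forall_compl_eq_zero fun x hx => by
    rw [hφ.fderiv_eq_zero hx]; simp]
  congr 1
  exact (LinearMap.toContinuousLinearMap L).integral_comp_comm (integrable_tensor hp hu hφ)

theorem IsLpD.integrable {L : Mat m n →ₗ[ℝ] Mat m n} {u : E n → E m} {g : E n → Mat m n}
    (hp : 1 ≤ p) (hg : IsLpD p L U u g) {φ : E n → ℝ} (hφ : IsTest U φ) :
    Integrable fun x => φ x • g x := by
  have hK : IsCompact (tsupport φ) := hφ.compact
  have : IsFiniteMeasure (volume.restrict (tsupport φ)) :=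
    ⟨by rw [Measure.restrict_apply_univ]; exact hK.measure_lt_top⟩
  have h1 : IntegrableOn g (tsupport φ) :=
    (hg.memLp.mono_measure (Measure.restrict_mono_set _ hφ.support)).integrable (by simpa using hp)
  exact integrable_bilin (ContinuousLinearMap.lsmul ℝ ℝ) hφ.continuous hφ.compact h1

theorem IsTest.setIntegral_smul {φ : E n → ℝ} (hφ : IsTest U φ) (g : E n → Mat m n) :
    ∫ x in U, φ x • g x = ∫ x, φ x • g x :=
  setIntegral_eq_integral_of_forall_compl_eq_zero fun x hx => by
    rw [hφ.eq_zero hx]; exact zero_smul ℝ (g x)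

theorem isLpD_iff (hp : 1 ≤ p) (L : Mat m n →ₗ[ℝ] Mat m n) {u : E n → E m} (hu : LpLoc p u)
    {g : E n → Mat m n} : IsLpD p L U u g ↔ MemLp g (ENNReal.ofReal p) (volume.restrict U) ∧
      ∀ φ, IsTest U φ → -L (tensorInt u φ) = ∫ x, φ x • g x := by
  constructor
  · intro h
    refine ⟨h.memLp, fun φ hφ => ?_⟩
    rw [← distD_eq hp L hu hφ, h.represents φ hφ, hφ.setIntegral_smul]
  · rintro ⟨h1, h2⟩
    refine ⟨h1, fun φ hφ => ?_⟩
    rw [distD_eq hp L hu hφ, h2 φ hφ, hφ.setIntegral_smul]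

theorem IsLpD.comp_linear (hp : 1 ≤ p) {L L' M : Mat m n →ₗ[ℝ] Mat m n} (hM : ∀ A, M (L A) = L' A)
    {u : E n → E m} (hu : LpLoc p u) {g : E n → Mat m n} (hg : IsLpD p L U u g) :
    IsLpD p L' U u fun x => M (g x) := by
  have h := (isLpD_iff hp L hu).1 hg
  refine (isLpD_iff hp L' hu).2 ⟨?_, fun φ hφ => ?_⟩
  · exact (LinearMap.toContinuousLinearMap M).comp_memLp' h.1
  · have h1 := (LinearMap.toContinuousLinearMap M).integral_comp_comm (hg.integrable hp hφ)
    simp only [LinearMap.coe_toContinuousLinearMap', map_smul] at h1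
    rw [h1, ← h.2 φ hφ, map_neg, hM]

theorem tensorInt_sub (hp : 1 ≤ p) {u v : E n → E m} (hu : LpLoc p u) (hv : LpLoc p v)
    {φ : E n → ℝ} (hφ : IsTest U φ) : tensorInt (u - v) φ = tensorInt u φ - tensorInt v φ := by
  unfold tensorInt
  rw [← integral_sub (integrable_tensor hp hu hφ) (integrable_tensor hp hv hφ)]
  congr 1 with x y
  simp [smul_sub]

/-- Integration by parts in each direction `v`: the derivative of `A` in that direction is the
constant `A v`. -/
theorem tensorInt_mat (A : Mat m n) {φ : E n → ℝ} (hφ : IsTest U φ) :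
    tensorInt A φ = -(∫ x, φ x) • A := by
  have hA : LpLoc 1 A := lpLoc_of_continuous A.continuous
  ext1 v
  unfold tensorInt
  rw [ContinuousLinearMap.integral_apply (integrable_tensor le_rfl hA hφ)]
  have hint : Integrable φ := hφ.continuous.integrable_of_hasCompactSupport hφ.compact
  have h0 : Integrable fun x => (fderiv ℝ φ x v) • A x := by
    have := (integrable_tensor le_rfl hA hφ).apply_continuousLinearMap v
    simpa using this
  have h1 := integral_smul_fderiv_eq_neg_fderiv_smul_of_integrable (μ := volume) (f := φ)
    (g := fun x => A x) (v := v) h0 (by simpa using hint.smul_const (A v))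
    (integrable_bilin (ContinuousLinearMap.lsmul ℝ ℝ) hφ.continuous hφ.compact
      (hA.integrableOn le_rfl hφ.compact))
    (fun x _ => (hφ.smooth.differentiable (by simp)).differentiableAt)
    (fun x _ => A.differentiableAt)
  simp only [ContinuousLinearMap.fderiv, integral_smul_const] at h1
  simp only [ContinuousLinearMap.smulRight_apply, neg_smul, smul_apply, h1, neg_neg]

theorem IsLpD.sub_mat (hp : 1 ≤ p) (hDb : Bornology.IsBounded D) {L : Mat m n →ₗ[ℝ] Mat m n}
    {u : E n → E m} (hu : LpLoc p u) {g : E n → Mat m n} (hg : IsLpD p L D u g) (A : Mat m n) :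
    IsLpD p L D (u - A) fun x => g x - L A := by
  have hA : LpLoc p A := lpLoc_of_continuous A.continuous
  have h := (isLpD_iff hp L hu).1 hg
  have : IsFiniteMeasure (volume.restrict D) :=
    ⟨by rw [Measure.restrict_apply_univ]; exact hDb.measure_lt_top⟩
  refine (isLpD_iff hp L (hu.sub hA)).2 ⟨h.1.sub (memLp_const _), fun φ hφ => ?_⟩
  have hint : Integrable φ := hφ.continuous.integrable_of_hasCompactSupport hφ.compact
  simp only [smul_sub]
  rw [integral_sub (hg.integrable hp hφ) (hint.smul_const _), integral_smul_const, ← h.2 φ hφ,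
    tensorInt_sub hp hu hA hφ, tensorInt_mat A hφ, map_sub, map_smul]
  module

theorem IsTest.comp_sim_symm {φ : E n → ℝ} (hφ : IsTest D φ) (hε : 0 < ε) (h : E n) :
    IsTest (copy D ε h) fun x => φ (ε⁻¹ • (x - h)) := by
  have hc : Continuous fun x : E n => ε⁻¹ • (x - h) := by fun_prop
  have hsub : tsupport (fun x => φ (ε⁻¹ • (x - h))) ⊆ copy (tsupport φ) ε h := by
    rw [copy_eq_preimage hε]
    exact tsupport_comp_subset_preimage φ hc
  refine ⟨hφ.smooth.comp (by fun_prop), ?_, hsub.trans (image_mono hφ.support)⟩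
  exact (hφ.compact.isCompact.image (f := fun y : E n => ε • y + h) (by fun_prop)).of_isClosed_subset
    (isClosed_tsupport _) hsub

/-- Test functions on `D` are transported to the copy by the inverse similarity. The chain rule
supplies the factor `ε`, and the Jacobian is the same on both sides. -/
theorem IsLpD.comp_sim (hp : 1 ≤ p) {L : Mat m n →ₗ[ℝ] Mat m n}
    {u : E n → E m} (hu : LpLoc p u) {g : E n → Mat m n} (hg : IsLpD p L U u g) (hε : 0 < ε)
    {h : E n} (hU : copy D ε h ⊆ U) :
    IsLpD p L D (fun y => u (ε • y + h)) fun y => ε • g (ε • y + h) := by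
  have hg' := (isLpD_iff hp L hu).1 hg
  refine (isLpD_iff hp L (hu.comp_sim hε h)).2 ⟨?_, fun φ hφ => ?_⟩
  · exact (memLp_comp_sim hε h D
      (hg'.1.mono_measure (Measure.restrict_mono_set _ hU))).const_smul ε
  set ψ : E n → ℝ := fun x => φ (ε⁻¹ • (x - h)) with hψ
  have hψt : IsTest U ψ := (hφ.comp_sim_symm hε h).mono hU
  have e1 : ∀ y, φ y = ψ (ε • y + h) := fun y => by simp [hψ, smul_smul, hε.ne']
  have e2 : ∀ y, fderiv ℝ φ y = ε • fderiv ℝ ψ (ε • y + h) := by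
    intro y
    have h1 : HasFDerivAt (fun y : E n => ε • y + h) (ε • ContinuousLinearMap.id ℝ (E n)) y :=
      ((hasFDerivAt_id y).const_smul ε).add_const h
    have h2 : HasFDerivAt ψ (fderiv ℝ ψ (ε • y + h)) (ε • y + h) :=
      ((hψt.smooth.differentiable (by simp)) _).hasFDerivAt
    have h3 := h2.comp y h1
    have h4 : ψ ∘ (fun y : E n => ε • y + h) = φ := by
      ext1 y; exact (e1 y).symm
    rw [h4] at h3
    rw [h3.fderiv]
    ext v
    simp
  have cov : ∀ {F : Type} [NormedAddCommGroup F] [NormedSpace ℝ F] (G : E n → F),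
      ∫ y, G (ε • y + h) = (ε ^ n)⁻¹ • ∫ x, G x := by
    intro F _ _ G
    have := setIntegral_comp_sim hε h univ G
    have hu : copy univ ε h = univ := by
      rw [copy_eq_preimage hε, preimage_univ]
    rwa [hu, setIntegral_univ, setIntegral_univ] at this
  have t1 : tensorInt (fun y => u (ε • y + h)) φ = (ε ^ n)⁻¹ • ε • tensorInt u ψ := by
    unfold tensorInt
    rw [← integral_smul, ← cov]
    congr 1 with y v
    rw [e2]
    simp [smul_smul]
  have t2 : ∫ y, φ y • ε • g (ε • y + h) = (ε ^ n)⁻¹ • ε • ∫ x, ψ x • g x := by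
    rw [← integral_smul, ← cov]
    congr 1 with y v
    rw [e1, smul_comm]
  rw [t1, t2, ← hg'.2 ψ hψt, map_smul, map_smul, smul_neg, smul_neg]

/-- The estimate that characterizes strong core functionals, on scaled copies. -/
theorem exists_strong_bound {α : Core m p D} (hα : IsStrong α)
    (hDb : Bornology.IsBounded D) {P : Submodule ℝ (Mat m n)} (hP : IsCompl P (nullSpace α)) :
    ∃ C : ℝ≥0, ∀ (U : Set (E n)) (u : E n → E m) (g : E n → Mat m n), LpLoc p u →
      IsLpD p (P.projection (nullSpace α) hP) U u g → ∀ (ε : ℝ) (_ : 0 < ε) (h : E n),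
      copy D ε h ⊆ U → ∀ A : Mat m n, ENNReal.ofReal (ε ^ ((n : ℝ) - p)) *
        (α.toFun ((fun y => u (ε • y + h)) - ⇑(ε • A : Mat m n)) D : ℝ≥0∞) ≤
          C * ∫⁻ x in copy D ε h, ‖g x - A‖ₑ ^ p := by
  obtain ⟨P₀, hP₀, c, -, hc⟩ := hα
  have hp := α.one_le_p
  have hp0 := p_pos α
  set π₀ := P₀.projection (nullSpace α) hP₀
  set L := LinearMap.toContinuousLinearMap π₀
  refine ⟨c * ‖L‖₊ ^ p, fun U u g hu hg ε hε h hU A => ?_⟩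
  -- The definition of strength concerns `π₀`, the hypothesis `hg` another projection `π`; they are
  -- linked by `π₀ ∘ π = π₀`.
  have h1 : IsLpD p π₀ U u fun x => π₀ (g x) :=
    hg.comp_linear hp (projection_projection _ hP hP₀) hu
  have hu' := hu.comp_sim hε h
  have h2 := (h1.comp_sim hp hu hε hU).sub_mat hp hDb hu' (ε • A)
  have hsub : LpLoc p ((fun y => u (ε • y + h)) - ⇑(ε • A : Mat m n)) :=
    hu'.sub (lpLoc_of_continuous (ε • A).continuous)
  have h3 := hc _ _ hsub (hsub.memLp hDb) h2
  have h4 : ∀ y, ‖ε • π₀ (g (ε • y + h)) - π₀ (ε • A)‖ₑ ^ p ≤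
      ((‖ε‖₊ ^ p : ℝ≥0) : ℝ≥0∞) * (((‖L‖₊ ^ p : ℝ≥0) : ℝ≥0∞) * ‖g (ε • y + h) - A‖ₑ ^ p) := by
    intro y
    have e : ε • π₀ (g (ε • y + h)) - π₀ (ε • A) = ε • L (g (ε • y + h) - A) := by
      simp [L, map_sub, smul_sub]
    have e2 : ‖L (g (ε • y + h) - A)‖ₑ ≤ ‖L‖ₑ * ‖g (ε • y + h) - A‖ₑ := L.le_opENorm _
    rw [e, enorm_smul, ENNReal.mul_rpow_of_nonneg _ _ hp0.le]
    refine mul_le_mul' (le_of_eq ?_) ?_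
    · rw [ENNReal.coe_rpow_of_nonneg _ hp0.le]
      rfl
    · rw [ENNReal.coe_rpow_of_nonneg _ hp0.le, ← ENNReal.mul_rpow_of_nonneg _ _ hp0.le]
      exact ENNReal.rpow_le_rpow e2 hp0.le
  have h5 : (α.toFun ((fun y => u (ε • y + h)) - ⇑(ε • A : Mat m n)) D : ℝ≥0∞) ≤
      c * (((‖ε‖₊ ^ p : ℝ≥0) : ℝ≥0∞) * (((‖L‖₊ ^ p : ℝ≥0) : ℝ≥0∞) *
        ((ENNReal.ofReal (ε ^ n))⁻¹ * ∫⁻ x in copy D ε h, ‖g x - A‖ₑ ^ p))) := by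
    refine h3.trans ?_
    gcongr
    rw [← setLIntegral_comp_sim hε h D fun x => ‖g x - A‖ₑ ^ p,
      ← lintegral_const_mul' _ _ ENNReal.coe_ne_top, ← lintegral_const_mul' _ _ ENNReal.coe_ne_top]
    exact lintegral_mono h4
  have hε0 : ENNReal.ofReal (ε ^ n) ≠ 0 := by
    have : 0 < ε ^ n := by positivity
    simpa using this
  -- The powers of `ε` cancel: `n - p` from the normalization of `G_ε`, `p` from the scaled gradient
  -- and `-n` from the Jacobian.
  calc _ ≤ ENNReal.ofReal (ε ^ ((n : ℝ) - p)) * (c * (((‖ε‖₊ ^ p : ℝ≥0) : ℝ≥0∞) *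
        (((‖L‖₊ ^ p : ℝ≥0) : ℝ≥0∞) *
        ((ENNReal.ofReal (ε ^ n))⁻¹ * ∫⁻ x in copy D ε h, ‖g x - A‖ₑ ^ p)))) := by gcongr
    _ = (ENNReal.ofReal (ε ^ ((n : ℝ) - p)) * ((‖ε‖₊ ^ p : ℝ≥0) : ℝ≥0∞)) *
        (ENNReal.ofReal (ε ^ n))⁻¹ * ((c * ((‖L‖₊ ^ p : ℝ≥0) : ℝ≥0∞)) *
          ∫⁻ x in copy D ε h, ‖g x - A‖ₑ ^ p) := by ring
    _ = _ := by
        rw [scale_identity n p hε, ← ENNReal.ofReal_pow hε.le,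
          ENNReal.mul_inv_cancel hε0 ENNReal.ofReal_ne_top, one_mul, ENNReal.coe_mul]

end CoreBMO

end

noncomputable section

namespace CoreBMO

variable {n m : ℕ} {p : ℝ}
variable {D U : Set (E n)} {ε t R : ℝ}

/-! ### The limit for functions with `D_π u ∈ L^p` -/

theorem coe_root_rpow (α : Core m p D) (u : E n → E m) :
    (root α u : ℝ≥0∞) ^ p = α.toFun u D := by
  rw [← ENNReal.coe_rpow_of_nonneg _ (p_pos α).le, root_rpow]

/-- Sums of the oscillation integrals of a function that is close to a continuous one. -/
theorem eventually_packSup_oscillation_le (hD : IsOpen D) (hne : D.Nonempty)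
    (hDb : Bornology.IsBounded D) (hp : 1 ≤ p) {g k : E n → Mat m n} (hk : Continuous k)
    (hkc : HasCompactSupport k) {η : ℝ≥0} (hη : 0 < η)
    (hgk : ∫⁻ x, ‖U.indicator g x - k x‖ₑ ^ p ≤ (η : ℝ≥0∞) ^ p) :
    ∀ᶠ ε in 𝓝[>] (0 : ℝ), packSup D ε U (fun h => ∫⁻ x in copy D ε h, ‖g x - k h‖ₑ ^ p) ≤
      (2 : ℝ≥0∞) ^ p * (η : ℝ≥0∞) ^ p := by
  have hp0 : 0 < p := by linarith
  obtain ⟨R, hR0, hR⟩ := hDb.subset_closedBall_lt 0 0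
  set K := Metric.cthickening 1 (tsupport k) with hK
  have hKc : IsCompact K := hkc.isCompact.cthickening
  have hKm : MeasurableSet K := hKc.measurableSet
  -- The oscillation `w` of `k` is chosen so that its contribution over `K` is at most `η ^ p`; the
  -- `+ 1` avoids division by zero when `K` is null.
  obtain ⟨w, hw, hwK⟩ : ∃ w : ℝ≥0, 0 < w ∧ (w : ℝ≥0∞) ^ p * volume K ≤ (η : ℝ≥0∞) ^ p := by
    set V := (volume K).toNNReal
    have hV : volume K = V := (ENNReal.coe_toNNReal hKc.measure_lt_top.ne).symm
    refine ⟨η / (V + 1) ^ (1 / p), by positivity, ?_⟩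
    rw [hV, ← ENNReal.coe_rpow_of_nonneg _ hp0.le, ← ENNReal.coe_rpow_of_nonneg _ hp0.le,
      ← ENNReal.coe_mul, ENNReal.coe_le_coe, NNReal.div_rpow, ← NNReal.rpow_mul,
      one_div_mul_cancel hp0.ne', NNReal.rpow_one, div_mul_eq_mul_div, mul_div_assoc]
    refine mul_le_of_le_one_right' ?_
    exact div_le_one_of_le₀ le_self_add (by positivity)
  have hu := hkc.uniformContinuous_of_continuous hk
  obtain ⟨δ, hδ, hδk⟩ := Metric.uniformContinuous_iff.1 hu w hw
  have hsmall : ∀ᶠ ε in 𝓝[>] (0 : ℝ), ε < min δ 1 / R :=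
    nhdsWithin_le_nhds (gt_mem_nhds (by positivity))
  filter_upwards [self_mem_nhdsWithin, hsmall] with ε hε hεR
  have hε' : 0 < ε := hε
  rw [lt_div_iff₀ hR0] at hεR
  -- A majorant that does not depend on `h`, so that the integrals over disjoint copies add up to at
  -- most one integral over the whole space.
  set Φ : E n → ℝ≥0∞ := fun x => (2 : ℝ≥0∞) ^ (p - 1) *
    (‖U.indicator g x - k x‖ₑ ^ p + K.indicator (fun _ => (w : ℝ≥0∞) ^ p) x) with hΦ
  have hpt : ∀ h, copy D ε h ⊆ U → ∀ x ∈ copy D ε h, ‖g x - k h‖ₑ ^ p ≤ Φ x := by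
    intro h hU x hx
    have hd : dist x h < min δ 1 := (copy_subset_closedBall hε' hR h hx).trans_lt hεR
    have h1 : ‖g x - k h‖ₑ ≤ ‖U.indicator g x - k x‖ₑ + K.indicator (fun _ => (w : ℝ≥0∞)) x := by
      have e : g x - k h = (U.indicator g x - k x) + (k x - k h) := by
        rw [indicator_of_mem (hU hx)]; abel
      rw [e]
      refine (enorm_add_le (U.indicator g x - k x) (k x - k h)).trans ?_
      gcongr
      by_cases hxK : x ∈ K
      · rw [indicator_of_mem hxK]
        have h2 := (hδk (hd.trans_le (min_le_left _ _))).le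
        rw [dist_eq_norm] at h2
        rw [enorm_eq_nnnorm]
        exact_mod_cast h2
      · rw [indicator_of_notMem hxK]
        have hxs : x ∉ tsupport k := fun h' => hxK (Metric.self_subset_cthickening _ h')
        have hhs : h ∉ tsupport k := fun h' => hxK (Metric.mem_cthickening_of_dist_le x h 1 _ h'
          (hd.le.trans (min_le_right _ _)))
        simp [image_eq_zero_of_notMem_tsupport hxs, image_eq_zero_of_notMem_tsupport hhs]
    calc ‖g x - k h‖ₑ ^ p
        ≤ (‖U.indicator g x - k x‖ₑ + K.indicator (fun _ => (w : ℝ≥0∞)) x) ^ p := by gcongr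
      _ ≤ (2 : ℝ≥0∞) ^ (p - 1) * (‖U.indicator g x - k x‖ₑ ^ p +
          (K.indicator (fun _ => (w : ℝ≥0∞)) x) ^ p) :=
          ENNReal.rpow_add_le_mul_rpow_add_rpow _ _ hp
      _ = Φ x := by
          simp only [hΦ]
          by_cases hxK : x ∈ K
          · simp [hxK]
          · simp [hxK, hp0]
  refine packSup_le fun T hT => ?_
  have hcT : Countable T := (hT.countable hD hne hε').to_subtype
  calc ∑' h : T, ∫⁻ x in copy D ε h, ‖g x - k h‖ₑ ^ p
      ≤ ∑' h : T, ∫⁻ x in copy D ε (h : E n), Φ x := by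
        refine ENNReal.tsum_le_tsum fun h => ?_
        exact setLIntegral_mono' (isOpen_copy hD hε' _).measurableSet
          (hpt h (hT.subset _ h.2))
    _ = ∫⁻ x in ⋃ h : T, copy D ε (h : E n), Φ x := by
        refine (lintegral_iUnion (fun h => (isOpen_copy hD hε' _).measurableSet) ?_ _).symm
        exact fun h h' hne' => hT.disjoint h.2 h'.2 fun e => hne' (Subtype.ext e)
    _ ≤ ∫⁻ x, Φ x := setLIntegral_le_lintegral _ _
    _ = (2 : ℝ≥0∞) ^ (p - 1) * ((∫⁻ x, ‖U.indicator g x - k x‖ₑ ^ p) +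
          (w : ℝ≥0∞) ^ p * volume K) := by
        simp only [hΦ]
        rw [lintegral_const_mul' _ _ (ENNReal.rpow_ne_top_of_nonneg (by linarith) (by simp)),
          lintegral_add_right _ (measurable_const.indicator hKm), lintegral_indicator_const hKm]
    _ ≤ (2 : ℝ≥0∞) ^ (p - 1) * ((η : ℝ≥0∞) ^ p + (η : ℝ≥0∞) ^ p) := by gcongr
    _ = _ := by
        rw [← two_mul, ← mul_assoc]
        congr 1
        nth_rewrite 2 [← ENNReal.rpow_one 2]
        rw [← ENNReal.rpow_add _ _ (by simp) (by simp), sub_add_cancel]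

theorem continuous_toFun_mat (α : Core m p D) : Continuous fun A : Mat m n => α.toFun A D := by
  have : (fun A : Mat m n => α.toFun A D) = fun A : Mat m n => root α A ^ p := by
    ext1 A; rw [root_rpow]
  rw [this]
  exact (NNReal.continuous_rpow_const (p_pos α).le).comp (continuous_root_mat α)

theorem toFun_zero_mat (α : Core m p D) : α.toFun (0 : Mat m n) D = 0 := by
  have h := α.homogeneous D (mem_images_self D) _ (lpLoc_mat (0 : Mat m n)) 0
  rw [nnnorm_zero, NNReal.zero_rpow (p_pos α).ne', zero_mul] at h
  rw [← h]
  congr 1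
  ext1 x
  simp

theorem toFun_smul_mat (α : Core m p D) (ε : ℝ) (A : Mat m n) :
    α.toFun ⇑(ε • A) D = ‖ε‖₊ ^ p * α.toFun A D :=
  α.homogeneous D (mem_images_self D) _ (lpLoc_mat A) ε

/-- Minkowski's inequality for the integrals of a core functional along matrix fields. -/
theorem exists_lintegral_toFun_le (α : Core m p D) : ∃ C : ℝ≥0, ∀ a b : E n → Mat m n,
    AEStronglyMeasurable a volume → AEStronglyMeasurable b volume →
    (∫⁻ x, (α.toFun (a x) D : ℝ≥0∞)) ^ (1 / p) ≤
      (∫⁻ x, (α.toFun (b x) D : ℝ≥0∞)) ^ (1 / p) +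
        C * (∫⁻ x, ‖a x - b x‖ₑ ^ p) ^ (1 / p) := by
  obtain ⟨C, hC⟩ := exists_root_mat_le α
  have hp0 := p_pos α
  refine ⟨C, fun a b ha hb => ?_⟩
  have hmb : AEMeasurable (fun x => (root α (b x) : ℝ≥0∞)) volume :=
    ((continuous_root_mat α).comp_aestronglyMeasurable hb).aemeasurable.coe_nnreal_ennreal
  have hmab : AEMeasurable (fun x => (C : ℝ≥0∞) * ‖a x - b x‖ₑ) volume :=
    (ha.sub hb).enorm.const_mul _
  have h1 := ENNReal.lintegral_Lp_add_le hmb hmab α.one_le_p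
  have h2 : ∀ x, (root α (a x) : ℝ≥0∞) ≤ root α (b x) + C * ‖a x - b x‖ₑ := by
    intro x
    have h3 := root_le_add_sub α (lpLoc_mat (a x)) (lpLoc_mat (b x))
    have h4 := hC (a x - b x)
    rw [enorm_eq_nnnorm]
    exact_mod_cast h3.trans (add_le_add le_rfl h4)
  simp only [← coe_root_rpow]
  calc (∫⁻ x, (root α (a x) : ℝ≥0∞) ^ p) ^ (1 / p)
      ≤ (∫⁻ x, ((root α (b x) : ℝ≥0∞) + C * ‖a x - b x‖ₑ) ^ p) ^ (1 / p) := by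
        gcongr with x
        exact h2 x
    _ ≤ _ := h1
    _ = _ := by
        congr 1
        simp only [ENNReal.mul_rpow_of_nonneg _ _ hp0.le]
        rw [lintegral_const_mul' _ _ (ENNReal.rpow_ne_top_of_nonneg hp0.le ENNReal.coe_ne_top),
          ENNReal.mul_rpow_of_nonneg _ _ (by positivity), ← ENNReal.rpow_mul,
          mul_one_div_cancel hp0.ne', ENNReal.rpow_one]

/-- Comparison of `G_ε(u, U)` with the packing sums of a matrix field. -/
theorem bmo_rpow_compare (hne : D.Nonempty) (α : Core m p D) {u : E n → E m} (hu : LpLoc p u)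
    (k : E n → Mat m n) (hε : 0 < ε) {Y : ℝ≥0∞}
    (hY : ENNReal.ofReal (ε ^ ((n : ℝ) - p)) * packSup D ε U (fun h =>
      (α.toFun ((fun y => u (ε • y + h)) - ⇑(ε • k h)) D : ℝ≥0∞)) ≤ Y) :
    bmo α ε u U ^ (1 / p) ≤ (ENNReal.ofReal ε ^ n * packSup D ε U fun h => α.toFun (k h) D) ^ (1 / p)
      + Y ^ (1 / p) ∧
    (ENNReal.ofReal ε ^ n * packSup D ε U fun h => α.toFun (k h) D) ^ (1 / p) ≤
      bmo α ε u U ^ (1 / p) + Y ^ (1 / p) := by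
  have hp0 := p_pos α
  have hp' : 0 ≤ 1 / p := by positivity
  set c := ENNReal.ofReal (ε ^ ((n : ℝ) - p)) with hc
  have hu' : ∀ h, LpLoc p fun y => u (ε • y + h) := fun h => hu.comp_sim hε h
  -- By homogeneity the weight `α(k h, D)` with factor `ε ^ n` is the weight of the linear map `ε •
  -- k h` with the factor `ε ^ (n - p)` of `G_ε`.
  have e1 : ENNReal.ofReal ε ^ n * packSup D ε U (fun h => (α.toFun (k h) D : ℝ≥0∞)) =
      c * packSup D ε U (fun h => (root α ⇑(ε • k h) : ℝ≥0∞) ^ p) := by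
    simp only [coe_root_rpow, toFun_smul_mat, ENNReal.coe_mul]
    rw [packSup_const_mul, ← mul_assoc, scale_identity n p hε]
  rw [e1, bmo_eq hne α hε hu]
  simp only [← coe_root_rpow] at hY ⊢
  simp only [ENNReal.mul_rpow_of_nonneg _ _ hp'] at hY ⊢
  have hY' := ENNReal.rpow_le_rpow hY hp'
  rw [ENNReal.mul_rpow_of_nonneg _ _ hp'] at hY'
  constructor
  · refine le_trans ?_ (add_le_add le_rfl hY')
    rw [← mul_add]
    gcongr
    refine packSup_rpow_add_le α.one_le_p fun h _ => ?_
    exact_mod_cast root_le_add_sub α (hu' h) (lpLoc_mat (ε • k h))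
  · refine le_trans ?_ (add_le_add le_rfl hY')
    rw [← mul_add]
    gcongr
    refine packSup_rpow_add_le α.one_le_p fun h _ => ?_
    rw [root_sub_comm α (hu' h) (lpLoc_mat (ε • k h))]
    exact_mod_cast root_le_add_sub α (lpLoc_mat (ε • k h)) (hu' h)

/-- Minkowski's inequality lives on `p`-th roots, so the asymptotic bounds are converted into
additive errors there; this also serves `eventually_le_rpow_of_le_liminf`. -/
theorem eventually_rpow_le_of_limsup_le {X : ℝ → ℝ≥0∞} {l : Filter ℝ} {a : ℝ≥0∞} (hp : 0 < p)
    (ha : a ≠ ⊤) (h : limsup X l ≤ a) {η : ℝ≥0∞} (hη : η ≠ 0) :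
    ∀ᶠ ε in l, X ε ^ (1 / p) ≤ a ^ (1 / p) + η := by
  have ha' : a ^ (1 / p) ≠ ⊤ := ENNReal.rpow_ne_top_of_nonneg (by positivity) ha
  have h1 : a < (a ^ (1 / p) + η) ^ p := by
    rw [← ENNReal.rpow_inv_lt_iff hp, ← one_div]
    exact ENNReal.lt_add_right ha' hη
  filter_upwards [eventually_lt_of_limsup_lt (h.trans_lt h1)] with ε hε
  rw [one_div, ENNReal.rpow_inv_le_iff hp, ← one_div]
  exact hε.le

theorem eventually_le_rpow_of_le_liminf {X : ℝ → ℝ≥0∞} {l : Filter ℝ} {a : ℝ≥0∞} (hp : 0 < p)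
    (ha : a ≠ ⊤) (h : a ≤ liminf X l) {η : ℝ≥0∞} (hη : η ≠ 0) :
    ∀ᶠ ε in l, a ^ (1 / p) ≤ X ε ^ (1 / p) + η := by
  have ha' : a ^ (1 / p) ≠ ⊤ := ENNReal.rpow_ne_top_of_nonneg (by positivity) ha
  rcases eq_or_ne (a ^ (1 / p)) 0 with h0 | h0
  · rw [h0]
    exact Eventually.of_forall fun _ => zero_le
  have h1 : (a ^ (1 / p) - η) ^ p < a := by
    rw [← ENNReal.lt_rpow_inv_iff hp, ← one_div]
    exact ENNReal.sub_lt_self ha' h0 hη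
  filter_upwards [eventually_lt_of_lt_liminf (h1.trans_le h)] with ε hε
  rw [← tsub_le_iff_right, one_div, ENNReal.le_rpow_inv_iff hp, ← one_div]
  exact hε.le

theorem tendsto_of_rpow_close {X : ℝ → ℝ≥0∞} {l : Filter ℝ} {a Q : ℝ≥0∞} (hp : 0 < p)
    (ha : a ≠ ⊤) (hQtop : Q ≠ ⊤) (hQ0 : Q ≠ 0) (h : ∀ η : ℝ≥0, 0 < η → ∀ᶠ ε in l,
      X ε ^ (1 / p) ≤ a ^ (1 / p) + Q * η ∧ a ^ (1 / p) ≤ X ε ^ (1 / p) + Q * η) :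
    Tendsto X l (𝓝 a) := by
  have hJtop : a ^ (1 / p) ≠ ⊤ := ENNReal.rpow_ne_top_of_nonneg (by positivity) ha
  have hT : Tendsto (fun ε => X ε ^ (1 / p)) l (𝓝 (a ^ (1 / p))) := by
    rw [ENNReal.tendsto_nhds hJtop]
    intro δ hδ
    obtain ⟨η, hη, hηδ⟩ : ∃ η : ℝ≥0, 0 < η ∧ Q * η ≤ δ := by
      rcases eq_or_ne δ ⊤ with rfl | hδtop
      · exact ⟨1, one_pos, le_top⟩
      · have h1 : δ / Q ≠ ⊤ := (ENNReal.div_lt_top hδtop hQ0).ne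
        refine ⟨(δ / Q).toNNReal, ?_, ?_⟩
        · exact ENNReal.toNNReal_pos (ENNReal.div_pos hδ.ne' hQtop).ne' h1
        · rw [ENNReal.coe_toNNReal h1, ENNReal.mul_div_cancel hQ0 hQtop]
    filter_upwards [h η hη] with ε hε
    refine ⟨tsub_le_iff_right.2 (hε.2.trans (by gcongr)), hε.1.trans (by gcongr)⟩
  have hT2 := ((ENNReal.continuous_rpow_const (y := p)).tendsto _).comp hT
  have e : ∀ b : ℝ≥0∞, (b ^ (1 / p)) ^ p = b := fun b => by
    rw [← ENNReal.rpow_mul, one_div_mul_cancel hp.ne', ENNReal.rpow_one]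
  rw [e] at hT2
  exact hT2.congr fun ε => e _

variable {κ : ℝ≥0∞}

theorem lintegral_toFun_lt_top (α : Core m p D) {g : E n → Mat m n}
    (hg : MemLp g (ENNReal.ofReal p) (volume.restrict U)) :
    ∫⁻ x in U, (α.toFun (g x) D : ℝ≥0∞) < ⊤ := by
  have hp0 := p_pos α
  obtain ⟨C, hC⟩ := exists_root_mat_le α
  have h1 : ∫⁻ x in U, ‖g x‖ₑ ^ p < ⊤ := by
    have := lintegral_rpow_enorm_lt_top_of_eLpNorm_lt_top (by simpa using hp0) (by simp)
      hg.eLpNorm_lt_top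
    rwa [ENNReal.toReal_ofReal hp0.le] at this
  calc ∫⁻ x in U, (α.toFun (g x) D : ℝ≥0∞) ≤ ∫⁻ x in U, (C : ℝ≥0∞) ^ p * ‖g x‖ₑ ^ p := by
        refine lintegral_mono fun x => ?_
        rw [← coe_root_rpow, ← ENNReal.mul_rpow_of_nonneg _ _ hp0.le, enorm_eq_nnnorm]
        gcongr
        exact_mod_cast hC (g x)
    _ = (C : ℝ≥0∞) ^ p * ∫⁻ x in U, ‖g x‖ₑ ^ p :=
        lintegral_const_mul' _ _ (ENNReal.rpow_ne_top_of_nonneg hp0.le ENNReal.coe_ne_top)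
    _ < ⊤ := ENNReal.mul_lt_top (ENNReal.rpow_lt_top_of_nonneg hp0.le ENNReal.coe_ne_top) h1

/-- After taking `p`-th roots, three errors occur: freezing the gradient on each copy (strong
bound), replacing `g` by `k` in the integral (Minkowski), and the packing asymptotics for the weight
`α(k ·, D)`. Each is at most a constant times `η`. -/
theorem tendsto_bmo_of_isLpD (hU : IsOpen U) (hD : IsOpen D) (hne : D.Nonempty)
    (hDb : Bornology.IsBounded D) {α : Core m p D} (hα : IsStrong α) (hκ : κ ≠ ⊤)
    (hlim : Tendsto (density D) (𝓝[>] (0 : ℝ)) (𝓝 κ)) {P : Submodule ℝ (Mat m n)}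
    (hP : IsCompl P (nullSpace α)) {u : E n → E m} (hu : LpLoc p u) {g : E n → Mat m n}
    (hg : IsLpD p (P.projection (nullSpace α) hP) U u g) :
    Tendsto (fun ε => bmo α ε u U) (𝓝[>] (0 : ℝ)) (𝓝 (κ * ∫⁻ x in U, (α.toFun (g x) D : ℝ≥0∞))) := by
  have hp := α.one_le_p
  have hp0 := p_pos α
  have hp' : 0 ≤ 1 / p := by positivity
  set I := ∫⁻ x in U, (α.toFun (g x) D : ℝ≥0∞) with hI
  have hItop : I ≠ ⊤ := (lintegral_toFun_lt_top α hg.memLp).ne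
  set J := (κ * I) ^ (1 / p) with hJ
  have hJtop : J ≠ ⊤ := ENNReal.rpow_ne_top_of_nonneg hp' (ENNReal.mul_ne_top hκ hItop)
  have hGm : MemLp (U.indicator g) (ENNReal.ofReal p) volume :=
    (memLp_indicator_iff_restrict (f := g) hU.measurableSet).2 hg.memLp
  set G : E n → Mat m n := U.indicator g with hG
  have hIG : ∫⁻ x, (α.toFun (G x) D : ℝ≥0∞) = I := by
    rw [hI, ← lintegral_indicator hU.measurableSet]
    congr 1 with x
    by_cases hx : x ∈ U
    · simp [hG, hx]
    · simp only [hG, indicator_of_notMem hx, ENNReal.coe_eq_zero]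
      exact toFun_zero_mat α
  obtain ⟨C₁, hC₁⟩ := exists_strong_bound hα hDb hP
  obtain ⟨C₂, hC₂⟩ := exists_lintegral_toFun_le α
  -- The summands account for the strong bound, for the replacement of `g` by `k` and for the
  -- packing asymptotics; the last also makes `Q` nonzero.
  set Q : ℝ≥0∞ := (C₁ * 2 ^ p) ^ (1 / p) + κ ^ (1 / p) * C₂ + 1 with hQ
  have hQtop : Q ≠ ⊤ := by
    refine ENNReal.add_ne_top.2 ⟨ENNReal.add_ne_top.2 ⟨?_, ?_⟩, by simp⟩
    · exact ENNReal.rpow_ne_top_of_nonneg hp' (ENNReal.mul_ne_top ENNReal.coe_ne_top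
        (ENNReal.rpow_ne_top_of_nonneg hp0.le (by simp)))
    · exact ENNReal.mul_ne_top (ENNReal.rpow_ne_top_of_nonneg hp' hκ) ENNReal.coe_ne_top
  have main : ∀ η : ℝ≥0, 0 < η → ∀ᶠ ε in 𝓝[>] (0 : ℝ),
      bmo α ε u U ^ (1 / p) ≤ J + Q * η ∧ J ≤ bmo α ε u U ^ (1 / p) + Q * η := by
    intro η hη
    have hη' : (η : ℝ≥0∞) ≠ 0 := by exact_mod_cast hη.ne'
    obtain ⟨k, hkc, hkη, hk, -⟩ := hGm.exists_hasCompactSupport_eLpNorm_sub_le (by simp) hη'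
    have hGk : (∫⁻ x, ‖G x - k x‖ₑ ^ p) ^ (1 / p) ≤ η := by
      rw [eLpNorm_eq_lintegral_rpow_enorm_toReal (by simpa using hp0) (by simp),
        ENNReal.toReal_ofReal hp0.le] at hkη
      exact hkη
    have hGk' : ∫⁻ x, ‖G x - k x‖ₑ ^ p ≤ (η : ℝ≥0∞) ^ p := by
      rwa [one_div, ENNReal.rpow_inv_le_iff hp0] at hGk
    have hkG : (∫⁻ x, ‖k x - G x‖ₑ ^ p) ^ (1 / p) ≤ η := by
      simpa only [enorm_sub_rev] using hGk
    have hfc : Continuous fun x => α.toFun (k x) D := (continuous_toFun_mat α).comp hk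
    have hfs : HasCompactSupport fun x => α.toFun (k x) D :=
      hkc.comp_left (g := fun A : Mat m n => α.toFun A D) (toFun_zero_mat α)
    -- The upper packing bound yields the integral over the whole space, the lower one only that
    -- over `U`. Both are close to `I`, as `G` vanishes outside `U` and `k` is close to `G`.
    set F := ∫⁻ x, (α.toFun (k x) D : ℝ≥0∞) with hF
    have hFtop : F ≠ ⊤ := lintegral_ne_top_of_hasCompactSupport hfc hfs
    set F' := ∫⁻ x in U, (α.toFun (k x) D : ℝ≥0∞) with hF'
    have hF'top : F' ≠ ⊤ := ((setLIntegral_le_lintegral _ _).trans_lt hFtop.lt_top).ne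
    have hUk : AEStronglyMeasurable (U.indicator k) volume :=
      hk.aestronglyMeasurable.indicator hU.measurableSet
    have hFJ : (κ * F) ^ (1 / p) ≤ J + κ ^ (1 / p) * C₂ * η := by
      have h1 := hC₂ k G hk.aestronglyMeasurable hGm.aestronglyMeasurable
      rw [hIG] at h1
      rw [hJ, ENNReal.mul_rpow_of_nonneg _ _ hp', ENNReal.mul_rpow_of_nonneg _ _ hp', mul_assoc,
        ← mul_add]
      gcongr
      exact h1.trans (by gcongr)
    have hJF : J ≤ (κ * F') ^ (1 / p) + κ ^ (1 / p) * C₂ * η := by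
      have h1 := hC₂ G (U.indicator k) hGm.aestronglyMeasurable hUk
      have h2 : ∫⁻ x, (α.toFun ⇑(U.indicator k x : Mat m n) D : ℝ≥0∞) = F' := by
        rw [hF', ← lintegral_indicator hU.measurableSet]
        congr 1 with x
        by_cases hx : x ∈ U
        · simp [hx]
        · simp only [indicator_of_notMem hx, ENNReal.coe_eq_zero]
          exact toFun_zero_mat α
      have h3 : ∫⁻ x, ‖G x - U.indicator k x‖ₑ ^ p ≤ ∫⁻ x, ‖G x - k x‖ₑ ^ p := by
        refine lintegral_mono fun x => ?_
        by_cases hx : x ∈ U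
        · simp [hx]
        · simp only [hG, indicator_of_notMem hx, sub_self]
          rw [show ‖(0 : Mat m n)‖ₑ = 0 by rw [enorm_eq_nnnorm, nnnorm_zero]; rfl, ENNReal.zero_rpow_of_pos hp0]
          exact zero_le
      rw [hIG, h2] at h1
      rw [hJ, ENNReal.mul_rpow_of_nonneg _ _ hp', ENNReal.mul_rpow_of_nonneg _ _ hp', mul_assoc,
        ← mul_add]
      gcongr
      refine h1.trans ?_
      gcongr
      exact (ENNReal.rpow_le_rpow h3 hp').trans hGk
    have X1 := eventually_rpow_le_of_limsup_le hp0 (ENNReal.mul_ne_top hκ hFtop)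
      (limsup_packSup_le hD hne hDb hκ hlim U hfc hfs) hη'
    have X2 := eventually_le_rpow_of_le_liminf hp0 (ENNReal.mul_ne_top hκ hF'top)
      (le_liminf_packSup hD hne hDb hκ hlim hU hfc hfs) hη'
    filter_upwards [self_mem_nhdsWithin, X1, X2,
      eventually_packSup_oscillation_le hD hne hDb hp hk hkc hη hGk'] with ε hε x1 x2 x3
    have hε' : 0 < ε := hε
    have hY : ENNReal.ofReal (ε ^ ((n : ℝ) - p)) * packSup D ε U (fun h =>
        (α.toFun ((fun y => u (ε • y + h)) - ⇑(ε • k h)) D : ℝ≥0∞)) ≤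
        C₁ * (2 ^ p * (η : ℝ≥0∞) ^ p) := by
      rw [← packSup_const_mul]
      refine (packSup_mono fun h hh => hC₁ U u g hu hg ε hε' h hh (k h)).trans ?_
      rw [packSup_const_mul]
      gcongr
    obtain ⟨y1, y2⟩ := bmo_rpow_compare hne α hu k hε' hY
    have hYη : ((C₁ : ℝ≥0∞) * (2 ^ p * (η : ℝ≥0∞) ^ p)) ^ (1 / p) =
        (C₁ * 2 ^ p) ^ (1 / p) * η := by
      rw [← mul_assoc, ENNReal.mul_rpow_of_nonneg _ _ hp', ← ENNReal.rpow_mul,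
        mul_one_div_cancel hp0.ne', ENNReal.rpow_one]
    rw [hYη] at y1 y2
    have eQ : Q * η = (C₁ * 2 ^ p) ^ (1 / p) * η + κ ^ (1 / p) * C₂ * η + η := by
      rw [hQ]; ring
    rw [eQ]
    constructor
    · calc _ ≤ _ := y1
        _ ≤ ((κ * F) ^ (1 / p) + η) + (C₁ * 2 ^ p) ^ (1 / p) * η := by gcongr
        _ ≤ ((J + κ ^ (1 / p) * C₂ * η) + η) + (C₁ * 2 ^ p) ^ (1 / p) * η := by gcongr
        _ = _ := by ring
    · calc J ≤ _ := hJF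
        _ ≤ _ + η + κ ^ (1 / p) * C₂ * η := by gcongr
        _ ≤ ((bmo α ε u U ^ (1 / p) + (C₁ * 2 ^ p) ^ (1 / p) * η) + η) +
            κ ^ (1 / p) * C₂ * η := by gcongr
        _ = _ := by ring
  exact tendsto_of_rpow_close hp0 (ENNReal.mul_ne_top hκ hItop) hQtop (by simp [hQ]) main

end CoreBMO

end

noncomputable section

namespace CoreBMO

/-! ### The dual of `L^q` -/

/-- A bounded linear functional on `L^q(μ)`, as a function on functions. -/
structure LqFunctional {X : Type*} [MeasurableSpace X] (q : ℝ) (μ : Measure X) where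
  toFun : (X → ℝ) → ℝ
  bound : ℝ
  bound_nonneg : 0 ≤ bound
  add : ∀ f g, MemLp f (ENNReal.ofReal q) μ → MemLp g (ENNReal.ofReal q) μ →
    toFun (f + g) = toFun f + toFun g
  smul : ∀ (c : ℝ) f, MemLp f (ENNReal.ofReal q) μ → toFun (c • f) = c * toFun f
  le : ∀ f, MemLp f (ENNReal.ofReal q) μ →
    |toFun f| ≤ bound * (eLpNorm f (ENNReal.ofReal q) μ).toReal

variable {X : Type*} [MeasurableSpace X] {q p : ℝ} {μ : Measure X}

namespace LqFunctional

variable (Λ : LqFunctional q μ)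

theorem sub {f g : X → ℝ} (hf : MemLp f (ENNReal.ofReal q) μ) (hg : MemLp g (ENNReal.ofReal q) μ) :
    Λ.toFun (f - g) = Λ.toFun f - Λ.toFun g := by
  have h1 := Λ.add f ((-1 : ℝ) • g) hf (hg.const_smul _)
  rw [Λ.smul _ _ hg] at h1
  rw [show f - g = f + (-1 : ℝ) • g by simp [sub_eq_add_neg], h1]
  ring

theorem ae_zero {f : X → ℝ} (hf : f =ᵐ[μ] 0) : Λ.toFun f = 0 := by
  have hm : MemLp f (ENNReal.ofReal q) μ := (memLp_congr_ae hf).2 MemLp.zero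
  have h1 := Λ.le f hm
  rw [eLpNorm_congr_ae hf] at h1
  simpa using h1

theorem sum {ι : Type*} (s : Finset ι) (f : ι → X → ℝ)
    (hf : ∀ i, MemLp (f i) (ENNReal.ofReal q) μ) :
    Λ.toFun (∑ i ∈ s, f i) = ∑ i ∈ s, Λ.toFun (f i) := by
  classical
  induction s using Finset.induction_on with
  | empty => simpa using Λ.ae_zero (f := 0) (ae_eq_refl _)
  | insert a s ha ih =>
    rw [Finset.sum_insert ha, Finset.sum_insert ha, Λ.add _ _ (hf a) (memLp_finsetSum' s fun i _ => hf i),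
      ih]

/-- Dominated convergence in `L^q`. Countably generated filters are allowed because countable
additivity in `signedMeasure` is a limit along the finite subsets of `ℕ`. -/
theorem tendsto (hq : 0 < q) {ι : Type*} {l : Filter ι} [l.IsCountablyGenerated] {F : ι → X → ℝ}
    {f W : X → ℝ} (hW : MemLp W (ENNReal.ofReal q) μ)
    (hF : ∀ i, MemLp (F i) (ENNReal.ofReal q) μ) (hf : MemLp f (ENNReal.ofReal q) μ)
    (hFW : ∀ i x, |F i x| ≤ W x) (hfW : ∀ x, |f x| ≤ W x)
    (hlim : ∀ x, Tendsto (fun i => F i x) l (𝓝 (f x))) :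
    Tendsto (fun i => Λ.toFun (F i)) l (𝓝 (Λ.toFun f)) := by
  have hq0 : ENNReal.ofReal q ≠ 0 := by simpa using hq
  have h1 : Tendsto (fun i => ∫⁻ x, ‖F i x - f x‖ₑ ^ q ∂μ) l (𝓝 (∫⁻ _, 0 ∂μ)) := by
    refine tendsto_lintegral_filter_of_dominated_convergence' (fun x => ‖2 * W x‖ₑ ^ q) ?_ ?_ ?_ ?_
    · exact Eventually.of_forall fun i =>
        (((hF i).aestronglyMeasurable.sub hf.aestronglyMeasurable).enorm).pow_const q
    · refine Eventually.of_forall fun i => Eventually.of_forall fun x => ?_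
      refine ENNReal.rpow_le_rpow ?_ hq.le
      rw [enorm_le_iff_norm_le, Real.norm_eq_abs, Real.norm_eq_abs]
      have h2 := hFW i x
      have h3 := hfW x
      have h4 : 0 ≤ W x := (abs_nonneg _).trans h3
      rw [abs_of_nonneg (by positivity : 0 ≤ 2 * W x)]
      linarith [abs_sub (F i x) (f x)]
    · have := lintegral_rpow_enorm_lt_top_of_eLpNorm_lt_top hq0 (by simp)
        (hW.const_mul 2).eLpNorm_lt_top
      rw [ENNReal.toReal_ofReal hq.le] at this
      exact this.ne
    · refine Eventually.of_forall fun x => ?_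
      have h2 : Tendsto (fun i => F i x - f x) l (𝓝 0) := by
        simpa using (hlim x).sub_const (f x)
      have h3 := (ENNReal.continuous_rpow_const (y := q)).tendsto _ |>.comp h2.enorm
      simpa [hq, Function.comp_def] using h3
  have h2 : Tendsto (fun i => (eLpNorm (F i - f) (ENNReal.ofReal q) μ).toReal) l (𝓝 0) := by
    have h3 := (ENNReal.continuous_rpow_const (y := 1 / q)).tendsto _ |>.comp h1
    have h4 : Tendsto (fun i => eLpNorm (F i - f) (ENNReal.ofReal q) μ) l (𝓝 0) := by
      have e : ∀ i, eLpNorm (F i - f) (ENNReal.ofReal q) μ =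
          (∫⁻ x, ‖F i x - f x‖ₑ ^ q ∂μ) ^ (1 / q) := fun i => by
        rw [eLpNorm_eq_lintegral_rpow_enorm_toReal hq0 (by simp), ENNReal.toReal_ofReal hq.le]
        rfl
      simp only [e]
      simpa [hq, Function.comp_def] using h3
    simpa [Function.comp_def] using (ENNReal.tendsto_toReal ENNReal.zero_ne_top).comp h4
  rw [tendsto_iff_norm_sub_tendsto_zero]
  have h3 := h2.const_mul Λ.bound
  rw [mul_zero] at h3
  refine squeeze_zero (fun _ => norm_nonneg _) (fun i => ?_) h3
  rw [← Λ.sub (hF i) hf]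
  exact Λ.le _ ((hF i).sub hf)

variable {w : X → ℝ}

theorem memLp_of_le (hw : MemLp w (ENNReal.ofReal q) μ) {f : X → ℝ} (hf : AEStronglyMeasurable f μ)
    {M : ℝ} (h : ∀ x, |f x| ≤ M * w x) : MemLp f (ENNReal.ofReal q) μ :=
  (hw.const_mul M).mono' hf (Eventually.of_forall h)

/-- The signed measure `B ↦ Λ(1_B w)`. -/
def signedMeasure (hq : 0 < q) (hw : MemLp w (ENNReal.ofReal q) μ) (hw0 : ∀ x, 0 ≤ w x) :
    SignedMeasure X where
  measureOf' s := by
    classical exact if MeasurableSet s then Λ.toFun (s.indicator w) else 0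
  empty' := by
    rw [if_pos MeasurableSet.empty, indicator_empty]
    exact Λ.ae_zero (ae_eq_refl _)
  not_measurable' := fun s hs => if_neg hs
  m_iUnion' := by
    classical
    intro f hf hd
    simp only [hf, MeasurableSet.iUnion hf, if_true]
    have hmem : ∀ i, MemLp ((f i).indicator w) (ENNReal.ofReal q) μ := fun i => hw.indicator (hf i)
    have hle : ∀ (s : Set X) x, |s.indicator w x| ≤ w x := by
      intro s x
      by_cases hx : x ∈ s
      · simp [hx, abs_of_nonneg (hw0 x)]
      · simp [hx, hw0 x]
    have hsum : ∀ s : Finset ℕ, ∑ i ∈ s, (f i).indicator w = (⋃ i ∈ s, f i).indicator w := by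
      intro s
      ext1 x
      rw [Finset.indicator_biUnion_apply s f (fun i _ j _ hij => hd hij), Finset.sum_apply]
    have h1 := Λ.tendsto (l := (atTop : Filter (Finset ℕ))) hq (W := w)
      (F := fun s => ∑ i ∈ s, (f i).indicator w) (f := (⋃ i, f i).indicator w) hw
      (fun s => memLp_finsetSum' s fun i _ => hmem i) (hw.indicator (MeasurableSet.iUnion hf))
      (fun s x => by rw [hsum]; exact hle _ x) (fun x => hle _ x) (fun x => by
        simp only [hsum]
        by_cases hx : x ∈ ⋃ i, f i
        · obtain ⟨i, hi⟩ := mem_iUnion.1 hx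
          refine tendsto_const_nhds.congr' ?_
          filter_upwards [eventually_ge_atTop {i}] with s hs
          have hxs : x ∈ ⋃ i ∈ s, f i := mem_biUnion (hs (Finset.mem_singleton_self i)) hi
          rw [indicator_of_mem hx, indicator_of_mem hxs]
        · refine tendsto_const_nhds.congr' (Eventually.of_forall fun s => ?_)
          have hxs : x ∉ ⋃ i ∈ s, f i := fun h => by
            obtain ⟨i, -, hi⟩ := mem_iUnion₂.1 h
            exact hx (mem_iUnion.2 ⟨i, hi⟩)
          simp only [indicator_of_notMem hx, indicator_of_notMem hxs])
    simp only [Λ.sum _ _ hmem] at h1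
    exact h1

theorem signedMeasure_apply (hq : 0 < q) (hw : MemLp w (ENNReal.ofReal q) μ) (hw0 : ∀ x, 0 ≤ w x)
    {s : Set X} (hs : MeasurableSet s) :
    Λ.signedMeasure hq hw hw0 s = Λ.toFun (s.indicator w) := by
  classical exact if_pos hs

/-- The Radon–Nikodym representation of a bounded functional on `L^q`, on functions dominated by
the weight. -/
theorem exists_density [SigmaFinite μ] (hq : 0 < q) (hw : MemLp w (ENNReal.ofReal q) μ)
    (hwm : Measurable w) (hw0 : ∀ x, 0 < w x) :
    ∃ g : X → ℝ, Measurable g ∧ ∀ (h : X → ℝ) (M : ℝ), Measurable h → (∀ x, |h x| ≤ M * w x) →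
      Integrable (fun x => h x * g x) μ ∧ Λ.toFun h = ∫ x, h x * g x ∂μ := by
  set ν := Λ.signedMeasure hq hw fun x => (hw0 x).le with hν
  have hac : ν ≪ᵥ μ.toENNRealVectorMeasure := by
    refine VectorMeasure.AbsolutelyContinuous.mk fun s hs h0 => ?_
    rw [Measure.toENNRealVectorMeasure_apply_measurable hs] at h0
    rw [hν, Λ.signedMeasure_apply hq hw _ hs]
    exact Λ.ae_zero (indicator_meas_zero h0)
  set r := ν.rnDeriv μ with hr
  have hrm : Measurable r := SignedMeasure.measurable_rnDeriv _ _
  have hri : Integrable r μ := SignedMeasure.integrable_rnDeriv _ _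
  have hset : ∀ s, MeasurableSet s → Λ.toFun (s.indicator w) = ∫ x in s, r x ∂μ := by
    intro s hs
    rw [← Λ.signedMeasure_apply hq hw (fun x => (hw0 x).le) hs, ← withDensityᵥ_apply hri hs, ← hν,
      hr, SignedMeasure.withDensityᵥ_rnDeriv_eq _ _ hac]
  have hsimple : ∀ f : SimpleFunc X ℝ,
      Λ.toFun (fun x => f x * w x) = ∫ x, f x * r x ∂μ := by
    intro f
    have hmem : ∀ f : SimpleFunc X ℝ, MemLp (fun x => f x * w x) (ENNReal.ofReal q) μ := by
      intro f
      obtain ⟨C, hC⟩ := f.exists_forall_norm_le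
      refine memLp_of_le hw (f.measurable.mul hwm).aestronglyMeasurable (M := C) fun x => ?_
      rw [abs_mul, abs_of_pos (hw0 x)]
      have := hC x
      rw [Real.norm_eq_abs] at this
      have := (hw0 x).le
      gcongr
    have hint : ∀ f : SimpleFunc X ℝ, Integrable (fun x => f x * r x) μ := by
      intro f
      obtain ⟨C, hC⟩ := f.exists_forall_norm_le
      exact hri.bdd_mul f.measurable.aestronglyMeasurable (Eventually.of_forall hC)
    induction f using SimpleFunc.induction with
    | const c hs =>
      rename_i s
      have e1 : (fun x => (SimpleFunc.piecewise s hs (SimpleFunc.const X c)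
          (SimpleFunc.const X 0)) x * w x) = c • s.indicator w := by
        ext1 x
        by_cases hx : x ∈ s <;> simp [hx]
      have e2 : (fun x => (SimpleFunc.piecewise s hs (SimpleFunc.const X c)
          (SimpleFunc.const X 0)) x * r x) = fun x => c * s.indicator r x := by
        ext1 x
        by_cases hx : x ∈ s <;> simp [hx]
      rw [e1, e2, Λ.smul _ _ (hw.indicator hs), hset s hs, integral_const_mul,
        integral_indicator hs]
    | @add f g _ hf hg =>
      have e1 : (fun x => (f + g) x * w x) = (fun x => f x * w x) + fun x => g x * w x := by
        ext1 x; simp [add_mul]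
      have e2 : (fun x => (f + g) x * r x) = (fun x => f x * r x) + fun x => g x * r x := by
        ext1 x; simp [add_mul]
      rw [e1, e2, Λ.add _ _ (hmem f) (hmem g), hf, hg]
      exact (integral_add (hint f) (hint g)).symm
  -- `r` represents `Λ` on functions written as `f * w`, hence the division by `w`. For the
  -- dominated function `h` the quotient `h / w` is bounded, and simple functions approximate it.
  refine ⟨fun x => r x / w x, hrm.div hwm, fun h M hh hM => ?_⟩
  set f : X → ℝ := fun x => h x / w x with hf
  have hfm : Measurable f := hh.div hwm
  have hfM : ∀ x, ‖f x‖ ≤ M := by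
    intro x
    rw [hf, Real.norm_eq_abs, abs_div, abs_of_pos (hw0 x), div_le_iff₀ (hw0 x)]
    exact hM x
  have e1 : (fun x => f x * w x) = h := by
    ext1 x; simp [hf, (hw0 x).ne']
  have e2 : (fun x => h x * (r x / w x)) = fun x => f x * r x := by
    ext1 x; simp only [hf]; ring
  rw [e2]
  refine ⟨hri.bdd_mul hfm.aestronglyMeasurable (Eventually.of_forall hfM), ?_⟩
  rcases isEmpty_or_nonempty X with hX | ⟨⟨x₀⟩⟩
  · rw [Λ.ae_zero (f := h) (by have := Measure.eq_zero_of_isEmpty μ; subst this; simp [EventuallyEq])]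
    simp [integral_of_isEmpty]
  have hM0 : 0 ≤ M := (norm_nonneg _).trans (hfM x₀)
  let F : ℕ → SimpleFunc X ℝ := fun k => hfm.stronglyMeasurable.approxBounded M k
  have hFM : ∀ k x, ‖F k x‖ ≤ M := fun k x => hfm.stronglyMeasurable.norm_approxBounded_le hM0 k x
  have hFlim : ∀ x, Tendsto (fun k => F k x) atTop (𝓝 (f x)) := fun x =>
    hfm.stronglyMeasurable.tendsto_approxBounded_of_norm_le (hfM x)
  have hdom : ∀ a x, ‖a‖ ≤ M → |a * w x| ≤ M * w x := by
    intro a x ha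
    rw [abs_mul, abs_of_pos (hw0 x)]
    have := (hw0 x).le
    rw [Real.norm_eq_abs] at ha
    gcongr
  have t1 : Tendsto (fun k => Λ.toFun fun x => F k x * w x) atTop (𝓝 (Λ.toFun h)) := by
    rw [← e1]
    refine Λ.tendsto hq (hw.const_mul M) (fun k => ?_) ?_ (fun k x => hdom _ x (hFM k x))
      (fun x => hdom _ x (hfM x)) (fun x => (hFlim x).mul_const _)
    · exact memLp_of_le hw ((F k).measurable.mul hwm).aestronglyMeasurable
        (fun x => hdom _ x (hFM k x))
    · exact memLp_of_le hw (hfm.mul hwm).aestronglyMeasurable (fun x => hdom _ x (hfM x))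
  have t2 : Tendsto (fun k => ∫ x, F k x * r x ∂μ) atTop (𝓝 (∫ x, f x * r x ∂μ)) := by
    refine tendsto_integral_of_dominated_convergence (fun x => M * ‖r x‖)
      (fun k => ((F k).measurable.mul hrm).aestronglyMeasurable) (hri.norm.const_mul M)
      (fun k => Eventually.of_forall fun x => ?_)
      (Eventually.of_forall fun x => (hFlim x).mul_const _)
    rw [norm_mul]
    gcongr
    exact hFM k x
  simp only [hsimple] at t1
  exact tendsto_nhds_unique t1 t2

end LqFunctional

end CoreBMO

end

/-! ### Integrability of the density, and functionals on test functions. -/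

noncomputable section

namespace CoreBMO

namespace LqFunctional

variable {X : Type*} [MeasurableSpace X] {q p : ℝ} {μ : Measure X}

/-- The density of a bounded functional on `L^q` belongs to the dual space `L^p`. -/
theorem memLp_density (Λ : LqFunctional q μ) (hpq : p.HolderConjugate q) {w : X → ℝ}
    (hw : MemLp w (ENNReal.ofReal q) μ) (hwm : Measurable w) (hw0 : ∀ x, 0 < w x) {g : X → ℝ}
    (hg : Measurable g)
    (hΛ : ∀ (h : X → ℝ) (M : ℝ), Measurable h → (∀ x, |h x| ≤ M * w x) →
      Integrable (fun x => h x * g x) μ ∧ Λ.toFun h = ∫ x, h x * g x ∂μ) :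
    MemLp g (ENNReal.ofReal p) μ := by
  have hp0 := hpq.pos
  have hq0 := hpq.symm.pos
  have hp1 : 0 < p - 1 := hpq.sub_one_pos
  have hpq1 : (p - 1) * q = p := hpq.sub_one_mul_conj
  have hq0' : ENNReal.ofReal q ≠ 0 := by simpa using hq0
  -- The extremal function in Hölder's inequality is `sign g * |g| ^ (p - 1)`. Truncation at `k * w`
  -- makes it dominated by a multiple of the weight.
  set a : ℕ → X → ℝ := fun k x => min (|g x| ^ (p - 1)) (k * w x) with ha
  have ha0 : ∀ k x, 0 ≤ a k x := fun k x =>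
    le_min (by positivity) (mul_nonneg k.cast_nonneg (hw0 x).le)
  have ham : ∀ k, Measurable (a k) := fun k =>
    (hg.norm.pow_const (p - 1)).min (hwm.const_mul _)
  have hbound : ∀ k, ∫⁻ x, ENNReal.ofReal (a k x ^ q) ∂μ ≤ ENNReal.ofReal Λ.bound ^ p := by
    intro k
    set h : X → ℝ := fun x => SignType.sign (g x) * a k x with hh
    have hhm : Measurable h := by
      have hs : Measurable fun r : ℝ => ((SignType.sign r : SignType) : ℝ) := by
        have e : (fun r : ℝ => ((SignType.sign r : SignType) : ℝ)) = fun r =>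
            if 0 < r then 1 else if r < 0 then -1 else 0 := by
          ext1 r
          rw [sign_apply]
          split_ifs <;> simp
        rw [e]
        exact Measurable.ite measurableSet_Ioi measurable_const
          (Measurable.ite measurableSet_Iio measurable_const measurable_const)
      exact (hs.comp hg).mul (ham k)
    have hab : ∀ x, |h x| = a k x := by
      intro x
      rcases lt_trichotomy (g x) 0 with h0 | h0 | h0
      · simp [hh, h0, abs_of_nonneg (ha0 k x)]
      · have : a k x = 0 := le_antisymm ((min_le_left _ _).trans
          (by simp [h0, Real.zero_rpow hp1.ne'])) (ha0 k x)
        simp [hh, this]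
      · simp [hh, h0, abs_of_nonneg (ha0 k x)]
    have hhg : ∀ x, h x * g x = a k x * |g x| := by
      intro x
      rcases lt_trichotomy (g x) 0 with h0 | h0 | h0
      · simp [hh, h0, abs_of_neg h0]
      · simp [h0]
      · simp [hh, h0, abs_of_pos h0]
    have hle : ∀ x, |h x| ≤ k * w x := fun x => by rw [hab]; exact min_le_right _ _
    obtain ⟨h1, h2⟩ := hΛ h k hhm hle
    have hhL : MemLp h (ENNReal.ofReal q) μ := memLp_of_le hw hhm.aestronglyMeasurable hle
    have h3 := Λ.le h hhL
    have h4 : eLpNorm h (ENNReal.ofReal q) μ =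
        (∫⁻ x, ENNReal.ofReal (a k x ^ q) ∂μ) ^ (1 / q) := by
      rw [eLpNorm_eq_lintegral_rpow_enorm_toReal hq0' (by simp), ENNReal.toReal_ofReal hq0.le]
      congr 1
      refine lintegral_congr fun x => ?_
      rw [Real.enorm_eq_ofReal_abs, hab, ENNReal.ofReal_rpow_of_nonneg (ha0 k x) hq0.le]
    set I := ∫⁻ x, ENNReal.ofReal (a k x ^ q) ∂μ with hI
    have hIt : I ^ (1 / q) < ⊤ := by rw [← h4]; exact hhL.eLpNorm_lt_top
    have hIt' : I ≠ ⊤ := by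
      intro h0
      rw [h0, ENNReal.top_rpow_of_pos (by positivity)] at hIt
      exact lt_irrefl _ hIt
    -- From `(p - 1) * (q - 1) = 1` one gets `a ^ q ≤ a * |g| = h * g`, so `I ≤ Λ(h)`. As `I` is
    -- finite by the truncation, `I ^ (1 / q)` can be cancelled, leaving a bound independent of `k`.
    have h5 : I ≤ ENNReal.ofReal Λ.bound * I ^ (1 / q) := by
      calc I ≤ ∫⁻ x, ENNReal.ofReal (h x * g x) ∂μ := by
            refine lintegral_mono fun x => ENNReal.ofReal_le_ofReal ?_
            rw [hhg]
            have e : a k x ^ q = a k x * a k x ^ (q - 1) := by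
              rw [← Real.rpow_one_add' (ha0 k x) (by linarith)]
              congr 1; ring
            rw [e]
            refine mul_le_mul_of_nonneg_left ?_ (ha0 k x)
            calc a k x ^ (q - 1) ≤ (|g x| ^ (p - 1)) ^ (q - 1) :=
                  Real.rpow_le_rpow (ha0 k x) (min_le_left _ _) hpq.symm.sub_one_pos.le
              _ = |g x| := by
                rw [← Real.rpow_mul (abs_nonneg _)]
                have : (p - 1) * (q - 1) = 1 := by linarith
                rw [this, Real.rpow_one]
        _ = ENNReal.ofReal (Λ.toFun h) := by
            rw [h2, ofReal_integral_eq_lintegral_ofReal h1]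
            exact Eventually.of_forall fun x => by
              change 0 ≤ h x * g x
              rw [hhg]; exact mul_nonneg (ha0 k x) (abs_nonneg _)
        _ ≤ ENNReal.ofReal (Λ.bound * (eLpNorm h (ENNReal.ofReal q) μ).toReal) :=
            ENNReal.ofReal_le_ofReal ((le_abs_self _).trans h3)
        _ = _ := by
            rw [ENNReal.ofReal_mul Λ.bound_nonneg, ENNReal.ofReal_toReal (by rw [h4]; exact hIt.ne),
              h4]
    rcases eq_or_ne I 0 with h0 | h0
    · rw [h0]; exact zero_le
    have h6 : I ^ (1 / p) ≤ ENNReal.ofReal Λ.bound := by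
      have e : I = I ^ (1 / p) * I ^ (1 / q) := by
        rw [← ENNReal.rpow_add _ _ h0 hIt', hpq.one_div_add_one_div]
        simp
      refine (ENNReal.mul_le_mul_iff_left
        (ENNReal.rpow_pos (pos_iff_ne_zero.2 h0) hIt').ne' hIt.ne).1 ?_
      rwa [← e]
    calc I = (I ^ (1 / p)) ^ p := by
          rw [← ENNReal.rpow_mul, one_div_mul_cancel hp0.ne', ENNReal.rpow_one]
      _ ≤ _ := ENNReal.rpow_le_rpow h6 hp0.le
  have hlim : ∀ x, Tendsto (fun k => ENNReal.ofReal (a k x ^ q)) atTop (𝓝 (‖g x‖ₑ ^ p)) := by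
    intro x
    refine tendsto_const_nhds.congr' ?_
    obtain ⟨K, hK⟩ := exists_nat_ge (|g x| ^ (p - 1) / w x)
    filter_upwards [eventually_ge_atTop K] with k hk
    have h1 : a k x = |g x| ^ (p - 1) := by
      refine min_eq_left ?_
      rw [← div_le_iff₀ (hw0 x)]
      exact hK.trans (by exact_mod_cast hk)
    rw [h1, ← Real.rpow_mul (abs_nonneg _), hpq1, Real.enorm_eq_ofReal_abs,
      ENNReal.ofReal_rpow_of_nonneg (abs_nonneg _) hp0.le]
  have hfin : ∫⁻ x, ‖g x‖ₑ ^ p ∂μ ≤ ENNReal.ofReal Λ.bound ^ p := by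
    calc ∫⁻ x, ‖g x‖ₑ ^ p ∂μ
        = ∫⁻ x, liminf (fun k => ENNReal.ofReal (a k x ^ q)) atTop ∂μ :=
          lintegral_congr fun x => (hlim x).liminf_eq.symm
      _ ≤ liminf (fun k => ∫⁻ x, ENNReal.ofReal (a k x ^ q) ∂μ) atTop :=
          lintegral_liminf_le fun k => ((ham k).pow_const q).ennreal_ofReal
      _ ≤ liminf (fun _ : ℕ => ENNReal.ofReal Λ.bound ^ p) atTop :=
          liminf_le_liminf (Eventually.of_forall hbound)
      _ = _ := liminf_const _
  refine ⟨hg.aestronglyMeasurable, ?_⟩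
  rw [eLpNorm_lt_top_iff_lintegral_rpow_enorm_lt_top (by simpa using hp0) (by simp),
    ENNReal.toReal_ofReal hp0.le]
  exact hfin.trans_lt (ENNReal.rpow_lt_top_of_nonneg hp0.le ENNReal.ofReal_ne_top)

end LqFunctional

variable {n m : ℕ} {p q : ℝ} {U : Set (E n)}

theorem IsTest.zero : IsTest U (0 : E n → ℝ) :=
  ⟨contDiff_const, HasCompactSupport.zero, by simp⟩

theorem IsTest.add {φ ψ : E n → ℝ} (hφ : IsTest U φ) (hψ : IsTest U ψ) : IsTest U (φ + ψ) :=
  ⟨hφ.smooth.add hψ.smooth, hφ.compact.add hψ.compact,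
    (tsupport_add φ ψ).trans (union_subset hφ.support hψ.support)⟩

theorem IsTest.smul {φ : E n → ℝ} (hφ : IsTest U φ) (c : ℝ) : IsTest U (c • φ) :=
  ⟨hφ.smooth.const_smul c, hφ.compact.smul_left (f := fun _ => c),
    (tsupport_smul_subset_right (fun _ => c) φ).trans hφ.support⟩

theorem IsTest.memLp {φ : E n → ℝ} (hφ : IsTest U φ) (r : ℝ≥0∞) (μ : Measure (E n))
    [IsFiniteMeasureOnCompacts μ] : MemLp φ r μ :=
  hφ.continuous.memLp_of_hasCompactSupport hφ.compact

/-- Since `U` may have infinite measure, indicators need not lie in `L^q`; multiplied by this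
Gaussian they do. -/
theorem exists_pos_memLp (hq : 0 < q) (U : Set (E n)) : ∃ w : E n → ℝ, Continuous w ∧
    (∀ x, 0 < w x) ∧ MemLp w (ENNReal.ofReal q) (volume.restrict U) := by
  refine ⟨fun x => Real.exp (-‖x‖ ^ 2), by fun_prop, fun x => Real.exp_pos _, ?_⟩
  refine MemLp.restrict U ?_
  have hc : Continuous fun x : E n => Real.exp (-‖x‖ ^ 2) := by fun_prop
  rw [← integrable_norm_rpow_iff hc.aestronglyMeasurable (by simpa using hq) (by simp),
    ENNReal.toReal_ofReal hq.le]
  have h := GaussianFourier.integrable_cexp_neg_mul_sq_norm_add (V := E n) (b := (q : ℂ))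
    (by simpa using hq) 0 0
  have h2 := h.norm
  refine h2.congr (Eventually.of_forall fun x => ?_)
  simp only [Complex.norm_exp]
  rw [Real.norm_eq_abs, abs_of_pos (Real.exp_pos _), ← Real.exp_mul]
  congr 1
  simp [← Complex.ofReal_pow]
  ring

/-- A functional on test functions that is bounded in the norm of `L^q` is represented by a
function in the dual space `L^p`. -/
theorem exists_memLp_of_test_bound (hpq : p.HolderConjugate q) (T : (E n → ℝ) → ℝ)
    (hadd : ∀ φ ψ, IsTest U φ → IsTest U ψ → T (φ + ψ) = T φ + T ψ)
    (hsmul : ∀ (c : ℝ) φ, IsTest U φ → T (c • φ) = c * T φ) {C : ℝ} (hC : 0 ≤ C)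
    (hle : ∀ φ, IsTest U φ →
      |T φ| ≤ C * (eLpNorm φ (ENNReal.ofReal q) (volume.restrict U)).toReal) :
    ∃ g : E n → ℝ, MemLp g (ENNReal.ofReal p) (volume.restrict U) ∧
      ∀ φ, IsTest U φ → T φ = ∫ x in U, φ x * g x := by
  have hq0 := hpq.symm.pos
  have hq1 : 1 ≤ ENNReal.ofReal q := by simpa using hpq.symm.lt.le
  set μ := volume.restrict U with hμ
  set Q := ENNReal.ofReal q with hQ
  -- The extension takes place on functions instead of classes: Hahn–Banach needs only a sublinear
  -- bound, and the `L^q` seminorm provides it.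
  let S : Submodule ℝ (E n → ℝ) :=
    { carrier := {f | MemLp f Q μ}
      add_mem' := fun h1 h2 => h1.add h2
      zero_mem' := MemLp.zero
      smul_mem' := fun c _ h => h.const_smul c }
  let dom : Submodule ℝ S :=
    { carrier := {f | IsTest U f}
      add_mem' := fun h1 h2 => h1.add h2
      zero_mem' := IsTest.zero
      smul_mem' := fun c _ h => h.smul c }
  let f : S →ₗ.[ℝ] ℝ :=
    { domain := dom
      toFun :=
        { toFun := fun φ => T φ
          map_add' := fun φ ψ => hadd _ _ φ.2 ψ.2
          map_smul' := fun c φ => hsmul _ _ φ.2 } }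
  obtain ⟨ℓ, hℓ1, hℓ2⟩ := exists_extension_of_le_sublinear f
    (fun φ : S => C * (eLpNorm (φ : E n → ℝ) Q μ).toReal)
    (fun c hc φ => by
      have : ((c • φ : S) : E n → ℝ) = c • (φ : E n → ℝ) := rfl
      simp only [this]
      rw [eLpNorm_const_smul, ENNReal.toReal_mul]
      simp [abs_of_pos hc]
      ring)
    (fun φ ψ => by
      have : ((φ + ψ : S) : E n → ℝ) = (φ : E n → ℝ) + (ψ : E n → ℝ) := rfl
      simp only [this]
      rw [← mul_add, ← ENNReal.toReal_add φ.2.eLpNorm_ne_top ψ.2.eLpNorm_ne_top]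
      refine mul_le_mul_of_nonneg_left (ENNReal.toReal_mono ?_ ?_) hC
      · exact ENNReal.add_ne_top.2 ⟨φ.2.eLpNorm_ne_top, ψ.2.eLpNorm_ne_top⟩
      · exact eLpNorm_add_le φ.2.aestronglyMeasurable ψ.2.aestronglyMeasurable hq1)
    (fun φ => (le_abs_self _).trans (hle _ φ.2))
  classical
  let Λ : LqFunctional q μ :=
    { toFun := fun h => if hh : MemLp h Q μ then ℓ ⟨h, hh⟩ else 0
      bound := C
      bound_nonneg := hC
      add := fun h k hh hk => by
        rw [dif_pos hh, dif_pos hk, dif_pos (hh.add hk), ← map_add]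
        rfl
      smul := fun c h hh => by
        rw [dif_pos hh, dif_pos (hh.const_smul c), ← smul_eq_mul, ← map_smul]
        rfl
      le := fun h hh => by
        rw [dif_pos hh, abs_le]
        have h1 := hℓ2 ⟨h, hh⟩
        have h2 := hℓ2 (-⟨h, hh⟩)
        have e : ((-⟨h, hh⟩ : S) : E n → ℝ) = -h := rfl
        rw [map_neg, e, eLpNorm_neg] at h2
        exact ⟨by linarith, h1⟩ }
  obtain ⟨w, hwc, hw0, hw⟩ := exists_pos_memLp hq0 U
  obtain ⟨g, hgm, hg⟩ := Λ.exists_density hq0 hw hwc.measurable hw0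
  refine ⟨g, Λ.memLp_density hpq hw hwc.measurable hw0 hgm hg, fun φ hφ => ?_⟩
  -- A test function is dominated by a multiple of the weight, because `w` is continuous and
  -- positive on its compact support.
  have hc : Continuous fun x => φ x / w x := hφ.continuous.div hwc fun x => (hw0 x).ne'
  have hcs : HasCompactSupport fun x => φ x / w x := by
    have e : (fun x => φ x / w x) = fun x => φ x * (w x)⁻¹ := by
      ext1 x; exact div_eq_mul_inv _ _
    rw [e]
    exact hφ.compact.mul_right
  obtain ⟨M, hM⟩ := hcs.exists_bound_of_continuous hc
  have h1 := (hg φ M hφ.continuous.measurable fun x => by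
    have := hM x
    rwa [Real.norm_eq_abs, abs_div, abs_of_pos (hw0 x), div_le_iff₀ (hw0 x)] at this).2
  rw [← h1]
  have h2 : MemLp φ Q μ := hφ.memLp _ _
  change T φ = if hh : MemLp φ Q μ then ℓ ⟨φ, hh⟩ else 0
  rw [dif_pos h2]
  exact (hℓ1 ⟨⟨φ, h2⟩, hφ⟩).symm

/-- The version of `exists_memLp_of_test_bound` with values in a finite-dimensional space. -/
theorem exists_memLp_of_test_norm_bound {F : Type*} [NormedAddCommGroup F] [NormedSpace ℝ F]
    [FiniteDimensional ℝ F] (hpq : p.HolderConjugate q) (T : (E n → ℝ) → F)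
    (hadd : ∀ φ ψ, IsTest U φ → IsTest U ψ → T (φ + ψ) = T φ + T ψ)
    (hsmul : ∀ (c : ℝ) φ, IsTest U φ → T (c • φ) = c • T φ) {C : ℝ} (hC : 0 ≤ C)
    (hle : ∀ φ, IsTest U φ →
      ‖T φ‖ ≤ C * (eLpNorm φ (ENNReal.ofReal q) (volume.restrict U)).toReal) :
    ∃ g : E n → F, MemLp g (ENNReal.ofReal p) (volume.restrict U) ∧
      ∀ φ, IsTest U φ → T φ = ∫ x in U, φ x • g x := by
  set b := Module.finBasis ℝ F
  have h1 : ∀ i, ∃ g : E n → ℝ, MemLp g (ENNReal.ofReal p) (volume.restrict U) ∧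
      ∀ φ, IsTest U φ → b.coord i (T φ) = ∫ x in U, φ x * g x := by
    intro i
    set L := LinearMap.toContinuousLinearMap (b.coord i)
    refine exists_memLp_of_test_bound hpq (fun φ => b.coord i (T φ))
      (fun φ ψ hφ hψ => by rw [hadd φ ψ hφ hψ, map_add])
      (fun c φ hφ => by rw [hsmul c φ hφ, map_smul, smul_eq_mul]) (C := ‖L‖ * C) (by positivity)
      fun φ hφ => ?_
    calc |b.coord i (T φ)| ≤ ‖L‖ * ‖T φ‖ := L.le_opNorm _
      _ ≤ _ := by rw [mul_assoc]; gcongr; exact hle φ hφ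
  choose g hg hT using h1
  refine ⟨fun x => ∑ i, g i x • b i, memLp_finsetSum _ fun i _ => ?_, fun φ hφ => ?_⟩
  · exact (ContinuousLinearMap.toSpanSingleton ℝ (b i)).comp_memLp' (hg i)
  · have hint : ∀ i, Integrable (fun x => φ x * g i x) (volume.restrict U) := fun i => by
      have : ENNReal.HolderConjugate (ENNReal.ofReal q) (ENNReal.ofReal p) :=
        hpq.symm.ennrealOfReal
      exact MemLp.integrable_mul (hφ.memLp (ENNReal.ofReal q) _) (hg i)
    simp only [Finset.smul_sum, smul_smul]
    rw [integral_finsetSum _ fun i _ => (hint i).smul_const (b i)]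
    simp only [integral_smul_const, ← hT _ φ hφ]
    exact (b.sum_repr (T φ)).symm

end CoreBMO

end

noncomputable section

namespace CoreBMO

/-! ### Convolutions as integrals in `L^p` -/

section Translation

variable {n : ℕ} {F : Type*} [NormedAddCommGroup F] {r : ℝ≥0∞}

/-- The translate `y ↦ w (z + y)` as an element of `L^r`. -/
def translate {w : E n → F} (hw : MemLp w r volume) (z : E n) : Lp F r (volume : Measure (E n)) :=
  DomAddAct.mk z +ᵥ hw.toLp w

theorem coeFn_translate {w : E n → F} (hw : MemLp w r volume) (z : E n) :
    translate hw z =ᵐ[volume] fun y => w (z + y) := by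
  unfold translate
  rw [DomAddAct.mk_vadd_toLp]
  exact MemLp.coeFn_toLp _

variable [Fact (1 ≤ r)] [Fact (r ≠ ⊤)]

theorem continuous_translate {w : E n → F} (hw : MemLp w r volume) :
    Continuous (translate hw) := by
  have h1 : Continuous fun z : E n => DomAddAct.mk z := DomAddAct.mkHomeomorph.continuous
  exact h1.vadd continuous_const

variable [NormedSpace ℝ F]

theorem integrable_smul_translate {w : E n → F} (hw : MemLp w r volume) {φ : E n → ℝ}
    (hφ : Continuous φ) (hφc : HasCompactSupport φ) (c : ℝ) :
    Integrable fun x => φ x • translate hw (c • x) :=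
  (hφ.smul ((continuous_translate hw).comp (continuous_const_smul c))).integrable_of_hasCompactSupport
    hφc.smul_right

/-- A Bochner integral in `L^r` has no pointwise meaning a priori. Both sides are integrated over an
arbitrary set of finite measure, where Fubini's theorem identifies them. -/
theorem integral_translate [CompleteSpace F] {w : E n → F} (hw : MemLp w r volume) (hwm : StronglyMeasurable w)
    {φ : E n → ℝ} (hφ : Continuous φ) (hφc : HasCompactSupport φ) (c : ℝ) :
    (∫ x, φ x • translate hw (c • x) : Lp F r (volume : Measure (E n))) =ᵐ[volume]
      fun y => ∫ x, φ x • w (c • x + y) := by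
  have hr1 : 1 ≤ r := Fact.out
  have hint := integrable_smul_translate hw hφ hφc c
  have hprod : ∀ s : Set (E n), MeasurableSet s → volume s < ⊤ →
      Integrable (fun z : E n × E n => φ z.1 • w (c • z.1 + z.2))
        (volume.prod (volume.restrict s)) := by
    intro s hs hs'
    have hfin : IsFiniteMeasure (volume.restrict s) := ⟨by rwa [Measure.restrict_apply_univ]⟩
    have hsm : StronglyMeasurable fun z : E n × E n => φ z.1 • w (c • z.1 + z.2) :=
      (hφ.comp continuous_fst).stronglyMeasurable.smul
        (hwm.comp_measurable (by fun_prop : Measurable fun z : E n × E n => c • z.1 + z.2))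
    have htr : ∀ x, MemLp (fun y => w (c • x + y)) r volume := fun x =>
      hw.comp_measurePreserving (measurePreserving_add_left volume (c • x))
    refine (integrable_prod_iff hsm.aestronglyMeasurable).2 ⟨Eventually.of_forall fun x =>
      (((htr x).restrict s).integrable hr1).smul (φ x), ?_⟩
    -- On a set of finite measure the `L^1` norm is bounded by the `L^r` norm, which does not change
    -- under translation; the bound is thus uniform in `x`.
    obtain ⟨C, hC⟩ : ∃ C : ℝ, ∀ x, ∫ y in s, ‖w (c • x + y)‖ ≤ C := by
      refine ⟨(eLpNorm w r volume *
        (volume.restrict s) univ ^ (1 / (1 : ℝ≥0∞).toReal - 1 / r.toReal)).toReal, fun x => ?_⟩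
      rw [integral_norm_eq_lintegral_enorm ((htr x).restrict s).aestronglyMeasurable]
      have hx : (0 : ℝ) ≤ 1 / (1 : ℝ≥0∞).toReal - 1 / r.toReal := by
        have hrt : r ≠ ⊤ := Fact.out
        have : 1 ≤ r.toReal := by
          have := ENNReal.toReal_mono hrt hr1
          simpa using this
        have : 1 / r.toReal ≤ 1 := by
          rw [div_le_one (by linarith)]; exact this
        simpa using this
      refine ENNReal.toReal_mono (ENNReal.mul_ne_top hw.eLpNorm_ne_top
        (ENNReal.rpow_ne_top_of_nonneg hx (measure_ne_top _ _))) ?_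
      rw [← eLpNorm_one_eq_lintegral_enorm]
      refine (eLpNorm_le_eLpNorm_mul_rpow_measure_univ hr1
        ((htr x).restrict s).aestronglyMeasurable).trans ?_
      gcongr
      calc eLpNorm (fun y => w (c • x + y)) r (volume.restrict s)
          ≤ eLpNorm (fun y => w (c • x + y)) r volume := eLpNorm_restrict_le _ _ _ _
        _ = eLpNorm w r volume := eLpNorm_comp_measurePreserving hw.aestronglyMeasurable
            (measurePreserving_add_left volume (c • x))
    have hφi : Integrable φ := hφ.integrable_of_hasCompactSupport hφc
    refine (hφi.norm.mul_const C).mono' hsm.norm.integral_prod_right'.aestronglyMeasurable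
      (Eventually.of_forall fun x => ?_)
    simp only [norm_smul]
    rw [integral_const_mul, Real.norm_eq_abs, abs_of_nonneg (by positivity)]
    gcongr
    exact hC x
  refine ae_eq_of_forall_setIntegral_eq_of_sigmaFinite (fun s hs hs' => ?_) (fun s hs hs' => ?_)
    fun s hs hs' => ?_
  · have hfin : IsFiniteMeasure (volume.restrict s) := ⟨by rwa [Measure.restrict_apply_univ]⟩
    exact ((Lp.memLp _).restrict s).integrable hr1
  · exact (hprod s hs hs').integral_prod_right
  · have hfin : IsFiniteMeasure (volume.restrict s) := ⟨by rwa [Measure.restrict_apply_univ]⟩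
    have hsw := integral_integral_swap (f := fun x y => φ x • w (c • x + y)) (hprod s hs hs')
    rw [← hsw]
    have hconj : ENNReal.HolderConjugate (ENNReal.conjExponent r) r :=
      (ENNReal.HolderConjugate.conjExponent hr1).symm
    have : Fact (1 ≤ ENNReal.conjExponent r) := ⟨hconj.one_le⟩
    let χ := indicatorConstLp (ENNReal.conjExponent r) hs hs'.ne (1 : ℝ)
    -- Integration over `s` as a continuous linear map on `L^r`, so that it commutes with the
    -- Bochner integral.
    let T : Lp F r (volume : Measure (E n)) →L[ℝ] F :=
      (ContinuousLinearMap.lsmul ℝ ℝ).lpPairing volume (ENNReal.conjExponent r) r χ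
    have hT : ∀ f : Lp F r (volume : Measure (E n)), T f = ∫ y in s, f y := by
      intro f
      rw [ContinuousLinearMap.lpPairing_eq_integral, ← integral_indicator hs]
      refine integral_congr_ae ?_
      filter_upwards [indicatorConstLp_coeFn (p := ENNReal.conjExponent r) (hs := hs)
        (hμs := hs'.ne) (c := (1 : ℝ))] with y hy
      simp only [χ, hy, ContinuousLinearMap.lsmul_apply]
      by_cases hys : y ∈ s <;> simp [hys]
    rw [← hT, ← T.integral_comp_comm hint]
    refine integral_congr_ae (Eventually.of_forall fun x => ?_)
    simp only [map_smul]
    rw [integral_smul, hT]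
    congr 1
    exact integral_congr_ae (ae_restrict_of_ae (coeFn_translate hw (c • x)))

end Translation

/-- Jensen's inequality for seminorms. -/
theorem seminorm_integral_le {X : Type*} [MeasurableSpace X] {μ : Measure X} {B : Type*}
    [NormedAddCommGroup B] [NormedSpace ℝ B] [CompleteSpace B] (N : Seminorm ℝ B)
    (hN : Continuous N) {f : X → B} (hf : Integrable f μ) :
    ENNReal.ofReal (N (∫ x, f x ∂μ)) ≤ ∫⁻ x, ENNReal.ofReal (N (f x)) ∂μ := by
  obtain ⟨C, hC, hNC⟩ := Seminorm.bound_of_continuous_normedSpace N hN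
  set v := ∫ x, f x ∂μ with hv
  -- Hahn–Banach, starting from the line through `v`: a functional below `N` that attains `N` at `v`
  -- reduces the claim to the scalar triangle inequality.
  have hlin : ∃ ℓ : B →ₗ[ℝ] ℝ, ℓ v = N v ∧ ∀ x, ℓ x ≤ N x := by
    by_cases hv0 : v = 0
    · exact ⟨0, by simp [hv0], fun x => apply_nonneg N x⟩
    obtain ⟨ℓ, h1, h2⟩ := exists_extension_of_le_sublinear
      (LinearPMap.mkSpanSingleton v (N v) hv0) N
      (fun c hc x => by rw [map_smul_eq_mul, Real.norm_eq_abs, abs_of_pos hc])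
      (fun x y => map_add_le_add N x y) (by
        rintro ⟨x, hx⟩
        obtain ⟨c, rfl⟩ := Submodule.mem_span_singleton.1 hx
        refine (LinearPMap.mkSpanSingleton'_apply (σ := RingHom.id ℝ) v (N v) _ c hx).trans_le ?_
        simp only [map_smul_eq_mul, smul_eq_mul, RingHom.id_apply]
        exact mul_le_mul_of_nonneg_right (le_abs_self c) (apply_nonneg N v))
    refine ⟨ℓ, ?_, h2⟩
    have h3 := h1 ⟨v, Submodule.mem_span_singleton_self v⟩
    exact h3.trans (LinearPMap.mkSpanSingleton_apply ℝ ℝ hv0 (N v))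
  obtain ⟨ℓ, h1, h2⟩ := hlin
  have h3 : ∀ x, ‖ℓ x‖ ≤ N x := by
    intro x
    rw [Real.norm_eq_abs, abs_le]
    have h4 := h2 (-x)
    rw [map_neg, map_neg_eq_map] at h4
    exact ⟨by linarith, h2 x⟩
  let L : B →L[ℝ] ℝ := ℓ.mkContinuous C fun x => (h3 x).trans (hNC x)
  calc ENNReal.ofReal (N v) = ENNReal.ofReal (∫ x, L (f x) ∂μ) := by
        rw [L.integral_comp_comm hf, ← h1]; rfl
    _ ≤ ‖∫ x, L (f x) ∂μ‖ₑ := by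
        rw [Real.enorm_eq_ofReal_abs]
        exact ENNReal.ofReal_le_ofReal (le_abs_self _)
    _ ≤ ∫⁻ x, ‖L (f x)‖ₑ ∂μ := enorm_integral_le_lintegral_enorm _
    _ ≤ _ := by
        refine lintegral_mono fun x => ?_
        rw [← ofReal_norm]
        exact ENNReal.ofReal_le_ofReal (h3 _)

end CoreBMO

end

noncomputable section

namespace CoreBMO

variable {n m : ℕ} {p q : ℝ} {D U : Set (E n)} {ε : ℝ} (α : Core m p D)

/-! ### Finite lower limits -/

/-- Jensen's inequality for the seminorm of a core functional and its measurability in the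
translation. -/
theorem root_integral_le (hlsc : IsLpLowerSemicontinuous α) {w : E n → E m}
    (hw : MemLp w (ENNReal.ofReal p) volume) (hwm : StronglyMeasurable w) {φ : E n → ℝ}
    (hφ : Continuous φ) (hφc : HasCompactSupport φ) (hε : 0 < ε) :
    LpLoc p (fun y => ∫ x, φ x • w (ε • y + x)) ∧
      (root α (fun y => ∫ x, φ x • w (ε • y + x)) : ℝ≥0∞) ≤
        ∫⁻ x, ‖φ x‖ₑ * root α (fun y => w (ε • y + x)) ∧
      Continuous fun x => root α (fun y => w (ε • y + x)) := by
  have hF1 : Fact (1 ≤ ENNReal.ofReal p) := ⟨by simpa using α.one_le_p⟩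
  have hF2 : Fact (ENNReal.ofReal p ≠ ⊤) := ⟨ENNReal.ofReal_ne_top⟩
  -- Rescaling first turns `x ↦ w(ε · + x)` into translates of the single function `w'` by `ε⁻¹ •
  -- x`, to which the results on translations apply.
  set w' : E n → E m := fun y => w (ε • y + 0) with hw'
  have hw'L : MemLp w' (ENNReal.ofReal p) volume := by
    have := memLp_comp_sim hε 0 univ (hw.restrict _)
    rwa [Measure.restrict_univ] at this
  have hw'm : StronglyMeasurable w' := hwm.comp_measurable (by fun_prop)
  have e : ∀ x y, w' (ε⁻¹ • x + y) = w (ε • y + x) := by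
    intro x y
    simp [hw', smul_smul, hε.ne', add_comm]
  set τ : E n → Lp (E m) (ENNReal.ofReal p) (volume : Measure (E n)) :=
    fun x => translate hw'L (ε⁻¹ • x) with hτ
  have hτae : ∀ x, τ x =ᵐ[volume] fun y => w (ε • y + x) := fun x => by
    have := coeFn_translate hw'L (ε⁻¹ • x)
    simpa only [e] using this
  have hroot : ∀ x, lpSeminorm α (τ x) = root α (fun y => w (ε • y + x)) := fun x => by
    change (root α (τ x) : ℝ) = _
    rw [root_congr α (lpLoc_lp _) ((lpLoc_of_memLp hw).comp_sim hε x) (ae_restrict_of_ae (hτae x))]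
  have hV := integral_translate hw'L hw'm hφ hφc ε⁻¹
  simp only [e] at hV
  have hVloc : LpLoc p fun y => ∫ x, φ x • w (ε • y + x) :=
    lpLoc_of_memLp ((memLp_congr_ae hV).1 (Lp.memLp _))
  have hcont := continuous_lpSeminorm α hlsc
  refine ⟨hVloc, ?_, ?_⟩
  · have h1 := seminorm_integral_le (lpSeminorm α) hcont
      (integrable_smul_translate hw'L hφ hφc ε⁻¹)
    have h2 : lpSeminorm α (∫ x, φ x • translate hw'L (ε⁻¹ • x)) =
        root α (fun y => ∫ x, φ x • w (ε • y + x)) := by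
      change (root α _ : ℝ) = _
      rw [root_congr α (lpLoc_lp _) hVloc (ae_restrict_of_ae hV)]
    rw [h2, ENNReal.ofReal_coe_nnreal] at h1
    refine h1.trans (le_of_eq (lintegral_congr fun x => ?_))
    rw [map_smul_eq_mul, ENNReal.ofReal_mul (norm_nonneg _), ofReal_norm, hroot,
      ENNReal.ofReal_coe_nnreal]
  · have h1 : Continuous fun x => lpSeminorm α (τ x) :=
      hcont.comp ((continuous_translate hw'L).comp (continuous_const_smul ε⁻¹))
    simp only [hroot] at h1
    exact NNReal.isEmbedding_coe.isInducing.continuous_iff.2 h1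

/-- The derivative of a test function is Lipschitz, so the mean value inequality bounds the
remainder on the ball of radius `‖h‖`. -/
theorem IsTest.taylor_bound {φ : E n → ℝ} (hφ : IsTest U φ) :
    ∃ L : ℝ≥0, ∀ x h : E n, |φ (x - h) - φ x + fderiv ℝ φ x h| ≤ L * ‖h‖ ^ 2 := by
  have h1 : ContDiff ℝ 1 (fderiv ℝ φ) := hφ.smooth.fderiv_right (m := 1)
    (WithTop.coe_le_coe.2 (le_top : (1 + 1 : ℕ∞) ≤ ⊤))
  obtain ⟨L, hL⟩ := ContDiff.lipschitzWith_of_hasCompactSupport hφ.hasCompactSupport_fderiv h1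
    (by simp)
  refine ⟨L, fun x h => ?_⟩
  have h2 := (convex_closedBall x ‖h‖).norm_image_sub_le_of_norm_fderiv_le' (𝕜 := ℝ) (f := φ)
    (φ := fderiv ℝ φ x) (C := L * ‖h‖) (x := x) (y := x - h)
    (fun y _ => (hφ.smooth.differentiable (by simp)).differentiableAt)
    (fun y hy => by
      refine (hL.norm_sub_le y x).trans ?_
      rw [Metric.mem_closedBall, dist_eq_norm] at hy
      gcongr)
    (Metric.mem_closedBall_self (norm_nonneg _)) (by simp [Metric.mem_closedBall])
  rw [sub_sub_cancel_left, map_neg, sub_neg_eq_add, norm_neg, Real.norm_eq_abs] at h2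
  refine h2.trans (le_of_eq ?_)
  ring

/-- The difference quotients of a mollification converge to the derivative. -/
theorem norm_diffQuotient_le {w : E n → E m} (hw : LocallyIntegrable w) {φ : E n → ℝ}
    (hφ : IsTest U φ) (R : ℝ) :
    ∃ C : ℝ, 0 ≤ C ∧ ∀ ε : ℝ, 0 < ε → ε ≤ 1 → ∀ y : E n, ‖y‖ ≤ R →
      ‖ε⁻¹ • (∫ x, φ x • w (ε • y + x)) - ε⁻¹ • (∫ x, φ x • w x) + tensorInt w φ y‖ ≤ ε * C := by
  obtain ⟨L, hL⟩ := hφ.taylor_bound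
  set K := Metric.cthickening R (tsupport φ) with hK
  have hKc : IsCompact K := hφ.compact.isCompact.cthickening
  have hwK : IntegrableOn w K := hw.integrableOn_isCompact hKc
  -- The Taylor remainder at the step `ε • y` is at most `L * (ε * R) ^ 2`, and one factor `ε` is
  -- lost to the quotient. The condition `ε ≤ 1` keeps the shifted support inside `K`.
  refine ⟨L * R ^ 2 * ∫ x in K, ‖w x‖, by positivity, fun ε hε hε1 y hy => ?_⟩
  have hcont : Continuous φ := hφ.continuous
  have i0 : ∀ h : E n, Integrable fun x => φ (x - h) • w x := by
    intro h
    have hc : Continuous fun x => φ (x - h) := by fun_prop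
    have hcs : HasCompactSupport fun x => φ (x - h) :=
      hφ.compact.comp_homeomorph (Homeomorph.subRight h)
    exact integrable_bilin (ContinuousLinearMap.lsmul ℝ ℝ) hc hcs
      (hw.integrableOn_isCompact hcs)
  have i1 : Integrable fun x => φ x • w x := by simpa using i0 0
  have i2 : Integrable fun x => (fderiv ℝ φ x).smulRight (w x) :=
    integrable_bilin (ContinuousLinearMap.smulRightL ℝ (E n) (E m)) hφ.continuous_fderiv
      hφ.hasCompactSupport_fderiv (hw.integrableOn_isCompact hφ.hasCompactSupport_fderiv)
  -- The shift is moved onto the smooth factor, as `w` itself cannot be differentiated.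
  have e1 : ∫ x, φ x • w (ε • y + x) = ∫ x, φ (x - ε • y) • w x := by
    rw [← integral_add_left_eq_self (fun x => φ (x - ε • y) • w x) (ε • y)]
    simp
  have e2 : tensorInt w φ y = ∫ x, fderiv ℝ φ x y • w x := by
    unfold tensorInt
    rw [ContinuousLinearMap.integral_apply i2]
    simp
  have i3 : Integrable fun x => fderiv ℝ φ x y • w x := by
    simpa using i2.apply_continuousLinearMap y
  have e3 : ε⁻¹ • (∫ x, φ x • w (ε • y + x)) - ε⁻¹ • (∫ x, φ x • w x) + tensorInt w φ y =
      ∫ x, (ε⁻¹ * (φ (x - ε • y) - φ x + fderiv ℝ φ x (ε • y))) • w x := by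
    have j1 : Integrable fun x => ε⁻¹ • φ (x - ε • y) • w x := (i0 (ε • y)).smul ε⁻¹
    have j2 : Integrable fun x => ε⁻¹ • φ x • w x := i1.smul ε⁻¹
    have j3 : Integrable fun x => ε⁻¹ • φ (x - ε • y) • w x - ε⁻¹ • φ x • w x := j1.sub j2
    rw [e1, e2, ← integral_smul, ← integral_smul, ← integral_sub j1 j2,
      ← integral_add j3 i3]
    refine integral_congr_ae (Eventually.of_forall fun x => ?_)
    beta_reduce
    rw [map_smul, smul_eq_mul]
    have : ε⁻¹ * (φ (x - ε • y) - φ x + ε * fderiv ℝ φ x y) =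
        ε⁻¹ * φ (x - ε • y) - ε⁻¹ * φ x + fderiv ℝ φ x y := by
      field_simp
    rw [this]
    module
  have hzero : ∀ x ∉ K, (ε⁻¹ * (φ (x - ε • y) - φ x + fderiv ℝ φ x (ε • y))) • w x = 0 := by
    intro x hx
    have hx1 : x ∉ tsupport φ := fun h => hx (Metric.self_subset_cthickening _ h)
    have hx2 : x - ε • y ∉ tsupport φ := fun h => hx (by
      refine Metric.mem_cthickening_of_dist_le x _ R _ h ?_
      rw [dist_eq_norm, sub_sub_cancel, norm_smul, Real.norm_eq_abs, abs_of_pos hε]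
      calc ε * ‖y‖ ≤ 1 * R := by gcongr
        _ = R := one_mul R)
    have hx3 : fderiv ℝ φ x = 0 :=
      image_eq_zero_of_notMem_tsupport fun h => hx1 (tsupport_fderiv_subset ℝ h)
    simp [image_eq_zero_of_notMem_tsupport hx1, image_eq_zero_of_notMem_tsupport hx2, hx3]
  rw [e3, ← setIntegral_eq_integral_of_forall_compl_eq_zero hzero]
  calc ‖∫ x in K, (ε⁻¹ * (φ (x - ε • y) - φ x + fderiv ℝ φ x (ε • y))) • w x‖
      ≤ ∫ x in K, ε * (L * R ^ 2) * ‖w x‖ := by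
        refine norm_integral_le_of_norm_le (hwK.norm.const_mul _) (Eventually.of_forall fun x => ?_)
        rw [norm_smul]
        refine mul_le_mul_of_nonneg_right ?_ (norm_nonneg _)
        rw [norm_mul, Real.norm_eq_abs, Real.norm_eq_abs, abs_of_pos (inv_pos.2 hε)]
        calc _ ≤ ε⁻¹ * (L * ‖ε • y‖ ^ 2) := by gcongr; exact hL x (ε • y)
          _ = ε * (L * ‖y‖ ^ 2) := by
            rw [norm_smul, Real.norm_eq_abs, abs_of_pos hε]; field_simp
          _ ≤ _ := by gcongr
    _ = _ := by rw [integral_const_mul]; ring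

variable {Ω : Set (E n)}

theorem LpLoc.exists_memLp (hu : LpLoc p u) {K : Set (E n)} (hK : IsCompact K) :
    ∃ w : E n → E m, StronglyMeasurable w ∧ MemLp w (ENNReal.ofReal p) volume ∧
      w =ᵐ[volume.restrict K] u := by
  have h1 : MemLp (K.indicator u) (ENNReal.ofReal p) volume :=
    (memLp_indicator_iff_restrict hK.measurableSet).2 (hu K hK)
  refine ⟨h1.1.mk, h1.1.stronglyMeasurable_mk, (memLp_congr_ae h1.1.ae_eq_mk).1 h1, ?_⟩
  have h2 : K.indicator u =ᵐ[volume.restrict K] u := indicator_ae_eq_restrict hK.measurableSet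
  have h3 : h1.1.mk =ᵐ[volume.restrict K] K.indicator u := ae_restrict_of_ae h1.1.ae_eq_mk.symm
  exact h3.trans h2

theorem ae_eq_comp_sim {u w : E n → E m} {K : Set (E n)} (h : w =ᵐ[volume.restrict K] u)
    (hε : 0 < ε) {x : E n} (hx : copy D ε x ⊆ K) :
    (fun y => w (ε • y + x)) =ᵐ[volume.restrict D] fun y => u (ε • y + x) := by
  have h1 : ∀ᵐ z ∂(Measure.map (fun y : E n => ε • y + x) (volume.restrict D)), w z = u z := by
    rw [map_sim_restrict hε]
    exact Measure.ae_smul_measure (ae_restrict_of_ae_restrict_of_subset hx h) _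
  exact (measurableEmbedding_sim hε x).ae_map_iff.1 h1

/-- If the lower limit of `G_ε(u, Ω)` is finite, then `φ ↦ ∫ u ⊗ ∇φ` is bounded in the norm of
`L^q`, up to the kernel of the seminorm. -/
theorem exists_root_tensorInt_le (hpq : p.HolderConjugate q) (hΩ : IsOpen Ω) (hD : IsOpen D)
    (hne : D.Nonempty) (hDb : Bornology.IsBounded D) (hlsc : IsLpLowerSemicontinuous α)
    {u : E n → E m} (hu : LpLoc p u) (hlow : bmoLower α u Ω < ⊤) :
    ∃ C : ℝ≥0, ∀ φ, IsTest Ω φ → (root α (tensorInt u φ) : ℝ≥0∞) ≤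
      C * eLpNorm φ (ENNReal.ofReal q) (volume.restrict Ω) := by
  have hp := hpq.lt.le
  have hp0 := hpq.pos
  have hq0 := hpq.symm.pos
  obtain ⟨κ, hκ0, hκt, hκ⟩ := exists_tendsto_density hD hne hDb
  obtain ⟨R, hR0, hR⟩ := hDb.subset_closedBall_lt 0 0
  obtain ⟨C₁, hC₁⟩ := exists_root_le_eLpNorm α hD hDb hlsc
  obtain ⟨M, hM1, hMt⟩ := exists_between hlow
  have hfreq : ∃ᶠ ε in 𝓝[>] (0 : ℝ), bmo α ε u Ω < M := frequently_lt_of_liminf_lt (by isBoundedDefault) hM1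
  have hκ2 : κ / 2 < κ := ENNReal.half_lt_self hκ0 hκt
  have hκ20 : κ / 2 ≠ 0 := (ENNReal.half_pos hκ0).ne'
  have hκ2t : κ / 2 ≠ ⊤ := (hκ2.trans_le le_top).ne
  set B : ℝ≥0∞ := ((κ / 2)⁻¹ * M) ^ (1 / p) with hB
  have hBt : B ≠ ⊤ := ENNReal.rpow_ne_top_of_nonneg (by positivity)
    (ENNReal.mul_ne_top (ENNReal.inv_ne_top.2 hκ20) hMt.ne)
  refine ⟨B.toNNReal, fun φ hφ => ?_⟩
  rw [ENNReal.coe_toNNReal hBt]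
  set K := tsupport φ with hK
  have hKc : IsCompact K := hφ.compact
  obtain ⟨δ, hδ0, hδ⟩ := hKc.exists_cthickening_subset_open hΩ hφ.support
  -- A global `L^p` representative of `u` near the support of `φ`. For `ε * R ≤ δ` the copies at
  -- points of `K` lie where `w` and `u` agree.
  obtain ⟨w, hwm, hwL, hwu⟩ := hu.exists_memLp (hKc.cthickening (r := δ))
  have hwloc : LpLoc p w := lpLoc_of_memLp hwL
  have hT : tensorInt u φ = tensorInt w φ := by
    unfold tensorInt
    refine integral_congr_ae ?_
    have h1 := (ae_restrict_iff' (Metric.isClosed_cthickening.measurableSet)).1 hwu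
    filter_upwards [h1] with x hx
    by_cases hxK : x ∈ K
    · rw [hx (Metric.self_subset_cthickening _ hxK)]
    · have : fderiv ℝ φ x = 0 :=
        image_eq_zero_of_notMem_tsupport fun h => hxK (tsupport_fderiv_subset ℝ h)
      simp [this]
  obtain ⟨C₂, hC₂0, hC₂⟩ := norm_diffQuotient_le
    (hwL.locallyIntegrable (by simpa using hp)) hφ R
  set N := eLpNorm φ (ENNReal.ofReal q) (volume.restrict Ω) with hN
  -- The factor `B` does not depend on `φ`; `C₂` and `δ` do, but they enter only the error term and
  -- the range of `ε`.
  have hstep : ∃ᶠ ε in 𝓝[>] (0 : ℝ), (root α (tensorInt u φ) : ℝ≥0∞) ≤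
      B * N + C₁ * (volume D ^ (1 / p) * ENNReal.ofReal (ε * C₂)) := by
    have hev : ∀ᶠ ε in 𝓝[>] (0 : ℝ), 0 < ε ∧ ε ≤ 1 ∧ ε * R ≤ δ ∧ κ / 2 < density D ε := by
      have h1 : ∀ᶠ ε in 𝓝[>] (0 : ℝ), ε < 1 := nhdsWithin_le_nhds (Iio_mem_nhds one_pos)
      have h2 : ∀ᶠ ε in 𝓝[>] (0 : ℝ), ε < δ / R :=
        nhdsWithin_le_nhds (Iio_mem_nhds (by positivity))
      filter_upwards [self_mem_nhdsWithin, h1, h2, hκ.eventually_const_lt hκ2] with ε a b c d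
      exact ⟨a, b.le, ((lt_div_iff₀ hR0).1 c).le, d⟩
    refine (hfreq.and_eventually hev).mono ?_
    rintro ε ⟨hbM, hε, hε1, hεR, hdens⟩
    obtain ⟨hv1, hv2, hcont⟩ := root_integral_le α hlsc hwL hwm hφ.continuous hφ.compact hε
    set v : E n → E m := fun y => ∫ x, φ x • w (ε • y + x) with hv
    have hcopy : ∀ x ∈ K, copy D ε x ⊆ Metric.cthickening δ K := fun x hx =>
      (copy_subset_closedBall hε hR x).trans ((Metric.closedBall_subset_closedBall hεR).trans
        (Metric.closedBall_subset_cthickening hx δ))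
    set f : E n → ℝ≥0∞ := K.indicator fun x => (root α (fun y => w (ε • y + x)) : ℝ≥0∞) ^ p with hf
    have hKm : MeasurableSet K := hKc.measurableSet
    have hfm : Measurable f :=
      (hcont.measurable.coe_nnreal_ennreal.pow_const p).indicator hKm
    -- The averaging lemma with `t = 1` gives `density D ε * ∫ f ≤ ε ^ p * M`, and the density
    -- eventually exceeds `κ / 2`.
    have hfint : ∫⁻ x, f x ≤ (κ / 2)⁻¹ * (ENNReal.ofReal (ε ^ p) * M) := by
      have h1 := packCount_mul_lintegral_le (U := Ω) hD hne hε one_pos hfm fun x hx =>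
        (hcopy x (mem_of_indicator_ne_zero hx)).trans hδ
      rw [ENNReal.ofReal_one, one_pow, one_mul] at h1
      have h2 : packSup D ε Ω f ≤
          packSup D ε Ω fun h => (α.toFun (fun y => u (ε • y + h)) D : ℝ≥0∞) := by
        refine packSup_mono fun x _ => ?_
        by_cases hx : x ∈ K
        · rw [hf, indicator_of_mem hx, root_congr α (hwloc.comp_sim hε x) (hu.comp_sim hε x)
            (ae_eq_comp_sim hwu hε (hcopy x hx)), coe_root_rpow]
        · rw [hf, indicator_of_notMem hx]
          exact zero_le
      have h3 : ENNReal.ofReal (ε ^ ((n : ℝ) - p)) * (packCount D ε 1 * ∫⁻ x, f x) ≤ M := by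
        refine le_trans ?_ hbM.le
        rw [bmo_eq hne α hε hu]
        gcongr
        exact h1.trans h2
      have hεp : ENNReal.ofReal (ε ^ ((n : ℝ) - p)) * ENNReal.ofReal (ε ^ p) =
          ENNReal.ofReal ε ^ n := by
        rw [← ENNReal.ofReal_mul (by positivity), ← Real.rpow_add hε, sub_add_cancel,
          Real.rpow_natCast, ENNReal.ofReal_pow hε.le]
      have h4 : density D ε * ∫⁻ x, f x ≤ ENNReal.ofReal (ε ^ p) * M := by
        calc density D ε * ∫⁻ x, f x = ENNReal.ofReal (ε ^ p) *
              (ENNReal.ofReal (ε ^ ((n : ℝ) - p)) * (packCount D ε 1 * ∫⁻ x, f x)) := by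
              rw [density, ← hεp]; ring
          _ ≤ _ := by gcongr
      calc ∫⁻ x, f x = (κ / 2)⁻¹ * (κ / 2 * ∫⁻ x, f x) := by
            rw [← mul_assoc, ENNReal.inv_mul_cancel hκ20 hκ2t, one_mul]
        _ ≤ (κ / 2)⁻¹ * (density D ε * ∫⁻ x, f x) := by gcongr
        _ ≤ _ := by gcongr
    have hεinv : ‖ε⁻¹‖ₑ * ENNReal.ofReal ε = 1 := by
      rw [Real.enorm_eq_ofReal_abs, abs_of_pos (inv_pos.2 hε),
        ← ENNReal.ofReal_mul (by positivity), inv_mul_cancel₀ hε.ne', ENNReal.ofReal_one]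
    -- Jensen and Hölder bound `root α v` by `N` times `(∫ f) ^ (1 / p)`, which is of order `ε` and
    -- compensates `ε⁻¹`.
    have hroot : (root α (ε⁻¹ • v) : ℝ≥0∞) ≤ B * N := by
      rw [root_smul α hv1, ENNReal.coe_mul]
      change ‖ε⁻¹‖ₑ * _ ≤ _
      have h1 : (root α v : ℝ≥0∞) ≤ N * (∫⁻ x, f x) ^ (1 / p) := by
        have h2 : ∀ x, ‖φ x‖ₑ * (root α (fun y => w (ε • y + x)) : ℝ≥0∞) =
            ‖φ x‖ₑ * f x ^ (1 / p) := by
          intro x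
          by_cases hx : x ∈ K
          · rw [hf, indicator_of_mem hx, ← ENNReal.rpow_mul, mul_one_div_cancel hp0.ne',
              ENNReal.rpow_one]
          · rw [image_eq_zero_of_notMem_tsupport hx]; simp
        refine hv2.trans ?_
        simp only [h2]
        have h3 := ENNReal.lintegral_mul_le_Lp_mul_Lq volume hpq.symm
          (f := fun x => ‖φ x‖ₑ) (g := fun x => f x ^ (1 / p))
          hφ.continuous.enorm.aemeasurable (hfm.pow_const _).aemeasurable
        refine h3.trans (le_of_eq ?_)
        congr 1
        · rw [hN, eLpNorm_eq_lintegral_rpow_enorm_toReal (by simpa using hq0) (by simp),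
            ENNReal.toReal_ofReal hq0.le, ← lintegral_indicator hΩ.measurableSet]
          congr 1
          refine lintegral_congr fun x => ?_
          by_cases hx : x ∈ Ω
          · rw [indicator_of_mem hx]
          · rw [indicator_of_notMem hx, hφ.eq_zero hx]; simp [hq0]
        · congr 1
          refine lintegral_congr fun x => ?_
          rw [← ENNReal.rpow_mul, one_div_mul_cancel hp0.ne', ENNReal.rpow_one]
      calc ‖ε⁻¹‖ₑ * (root α v : ℝ≥0∞)
          ≤ ‖ε⁻¹‖ₑ * (N * ((κ / 2)⁻¹ * (ENNReal.ofReal (ε ^ p) * M)) ^ (1 / p)) := by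
            refine mul_le_mul_right (h1.trans ?_) _
            gcongr
        _ = ‖ε⁻¹‖ₑ * (N * (ENNReal.ofReal (ε ^ p) ^ (1 / p) * B)) := by
            rw [hB, ← ENNReal.mul_rpow_of_nonneg _ _ (by positivity)]
            congr 3
            ring
        _ = (‖ε⁻¹‖ₑ * ENNReal.ofReal ε) * (B * N) := by
            rw [ENNReal.ofReal_rpow_of_nonneg (by positivity) (by positivity), ← Real.rpow_mul hε.le,
              mul_one_div_cancel hp0.ne', Real.rpow_one]
            ring
        _ = _ := by rw [hεinv, one_mul]
    set A := tensorInt w φ with hA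
    -- Subtracting this constant leaves the seminorm unchanged and turns `ε⁻¹ • v` into a difference
    -- quotient that is within `ε * C₂` of `-A` on `D`.
    set c : E m := ε⁻¹ • ∫ x, φ x • w x with hc
    have hz : LpLoc p (ε⁻¹ • v) := hv1.smul _
    have hz' : LpLoc p fun y => (ε⁻¹ • v) y + -c := hz.add (lpLoc_of_continuous continuous_const)
    have hAn : LpLoc p (-(A : E n → E m)) := lpLoc_of_continuous A.continuous.neg
    have h5 := root_le_add_sub α hAn hz'
    rw [root_neg α (lpLoc_mat A), root_add_const α hz, root_sub_comm α hAn hz'] at h5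
    have h6 := hC₁ _ (hz'.sub hAn)
    have h7 : eLpNorm ((fun y => (ε⁻¹ • v) y + -c) - -(A : E n → E m)) (ENNReal.ofReal p)
        (volume.restrict D) ≤ volume D ^ (1 / p) * ENNReal.ofReal (ε * C₂) := by
      have h8 := eLpNorm_le_of_ae_bound (p := ENNReal.ofReal p) (μ := volume.restrict D)
        (f := (fun y => (ε⁻¹ • v) y + -c) - -(A : E n → E m)) (C := ε * C₂)
        (ae_restrict_of_forall_mem hD.measurableSet fun y hy => by
          have := hC₂ ε hε hε1 y (by simpa using hR hy)
          simpa [hv, hc, sub_eq_add_neg] using this)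
      rw [Measure.restrict_apply_univ, ENNReal.toReal_ofReal hp0.le, ← one_div p] at h8
      exact h8
    rw [hT]
    calc (root α A : ℝ≥0∞) ≤ (root α (ε⁻¹ • v) : ℝ≥0∞) +
          root α ((fun y => (ε⁻¹ • v) y + -c) - -(A : E n → E m)) := by exact_mod_cast h5
      _ ≤ _ := add_le_add hroot (h6.trans (by gcongr))
  have hlim : Tendsto (fun ε : ℝ => B * N + C₁ * (volume D ^ (1 / p) * ENNReal.ofReal (ε * C₂)))
      (𝓝[>] 0) (𝓝 (B * N)) := by
    have h1 : Tendsto (fun ε : ℝ => ENNReal.ofReal (ε * C₂)) (𝓝[>] 0) (𝓝 0) := by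
      have : Continuous fun ε : ℝ => ENNReal.ofReal (ε * C₂) :=
        ENNReal.continuous_ofReal.comp (continuous_mul_const C₂)
      simpa using (this.tendsto 0).mono_left nhdsWithin_le_nhds
    have hvol : volume D ^ (1 / p) ≠ ⊤ :=
      ENNReal.rpow_ne_top_of_nonneg (by positivity) hDb.measure_lt_top.ne
    have h2 := ENNReal.Tendsto.const_mul (a := (C₁ : ℝ≥0∞))
      (ENNReal.Tendsto.const_mul h1 (Or.inr hvol)) (Or.inr ENNReal.coe_ne_top)
    simpa using h2.const_add (B * N)
  by_contra! hcon
  exact (hstep.and_eventually (hlim.eventually_lt_const hcon)).exists.elim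
    fun ε h => absurd h.1 (not_le.2 h.2)

/-- If the lower limit of `G_ε(u, Ω)` is finite, then `D_π u ∈ L^p(Ω)`. -/
theorem memLpD_of_bmoLower_lt_top (hp : 1 < p) (hΩ : IsOpen Ω) (hD : IsOpen D)
    (hne : D.Nonempty) (hDb : Bornology.IsBounded D) (hlsc : IsLpLowerSemicontinuous α)
    {P : Submodule ℝ (Mat m n)} (hP : IsCompl P (nullSpace α))
    {u : E n → E m} (hu : LpLoc p u) (hlow : bmoLower α u Ω < ⊤) :
    MemLpD p (P.projection (nullSpace α) hP) Ω u := by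
  have hpq := Real.HolderConjugate.conjExponent hp
  obtain ⟨κ, hκ0, -, hκ⟩ := exists_tendsto_density hD hne hDb
  obtain ⟨C₁, hC₁⟩ := exists_norm_projection_le α (mem_nullSpace_iff α hne hκ0 hκ) hP
  obtain ⟨C₂, hC₂⟩ := exists_root_tensorInt_le α hpq hΩ hD hne hDb hlsc hu hlow
  set π := P.projection (nullSpace α) hP
  obtain ⟨g, hg, hgT⟩ := exists_memLp_of_test_norm_bound (U := Ω) hpq
    (fun φ => -π (tensorInt u φ))
    (fun φ ψ hφ hψ => by
      have : tensorInt u (φ + ψ) = tensorInt u φ + tensorInt u ψ := by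
        unfold tensorInt
        rw [← integral_add (integrable_tensor hp.le hu hφ) (integrable_tensor hp.le hu hψ)]
        refine integral_congr_ae (Eventually.of_forall fun x => ?_)
        ext1 y
        beta_reduce
        rw [fderiv_add (hφ.smooth.differentiable (by simp) x) (hψ.smooth.differentiable (by simp) x)]
        simp [add_smul]
      rw [this, map_add, neg_add])
    (fun c φ hφ => by
      have : tensorInt u (c • φ) = c • tensorInt u φ := by
        unfold tensorInt
        rw [← integral_smul]
        refine integral_congr_ae (Eventually.of_forall fun x => ?_)
        ext1 y
        beta_reduce
        rw [fderiv_const_smul (hφ.smooth.differentiable (by simp) x)]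
        simp [smul_smul]
      rw [this, map_smul, smul_neg])
    (C := C₁ * C₂) (by positivity) fun φ hφ => by
      have hN := (hφ.memLp (ENNReal.ofReal p.conjExponent) (volume.restrict Ω)).eLpNorm_ne_top
      have h1 := ENNReal.toReal_mono (ENNReal.mul_ne_top ENNReal.coe_ne_top hN) (hC₂ φ hφ)
      rw [ENNReal.toReal_mul, ENNReal.coe_toReal, ENNReal.coe_toReal] at h1
      have h2 : ‖π (tensorInt u φ)‖ ≤ C₁ * root α (tensorInt u φ) := hC₁ (tensorInt u φ)
      rw [norm_neg, mul_assoc]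
      exact h2.trans (by gcongr)
  exact ⟨g, (isLpD_iff hp.le π hu).2 ⟨hg, fun φ hφ => by
    rw [← hφ.setIntegral_smul]; exact hgT φ hφ⟩⟩

end CoreBMO

end

/-! ### The empty reference set, and the conclusion. -/

noncomputable section

namespace CoreBMO

variable {n m : ℕ} {p : ℝ}

/-- The gradient bound over the empty set forces `α(u, ∅) = 0`, and every admissible family contains
at most the empty set. -/
theorem bmo_empty (α : Core m p (∅ : Set (E n))) {u : E n → E m} (hu : LpLoc p u) (ε : ℝ)
    (U : Set (E n)) : bmo α ε u U = 0 := by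
  have h0 : α.toFun u ∅ = 0 := by
    obtain ⟨c, -, hc⟩ := α.grad_bound
    have h := hc u 0 hu (by simp) ⟨by simp, fun φ _ => by simp [distD]⟩
    simpa using h
  unfold bmo
  refine mul_eq_zero_of_right _ ?_
  simp only [ENNReal.iSup_eq_zero, ENNReal.tsum_eq_zero, ENNReal.coe_eq_zero]
  intro 𝓕 h𝓕 _ D'
  obtain ⟨F, -, hF, -⟩ := h𝓕 D'.2
  rw [hF, image_empty, h0]

theorem isLpD_zero (hp : 1 ≤ p) {L : Mat m n →ₗ[ℝ] Mat m n} (hL : ∀ A, L A = 0) {U : Set (E n)}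
    {u : E n → E m} (hu : LpLoc p u) : IsLpD p L U u fun _ => 0 := by
  refine (isLpD_iff hp L hu).2 ⟨?_, fun φ _ => ?_⟩
  · have h : MemLp (fun _ : E n => (0 : ℝ)) (ENNReal.ofReal p) (volume.restrict U) := MemLp.zero'
    exact h.of_le aestronglyMeasurable_const
      (Eventually.of_forall fun x => by rw [norm_zero, norm_zero])
  · rw [hL, neg_zero]
    exact (integral_eq_zero_of_ae (Eventually.of_forall fun x => smul_zero (A := Mat m n) (φ x))).symm

end CoreBMO

end

theorem mainTheorem3 {n m : ℕ} (hm : 1 ≤ m) {p : ℝ} (hp : 1 < p)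
    {Ω D : Set (CoreBMO.E n)} (hΩ : IsOpen Ω) (hD : IsOpen D) (hDb : Bornology.IsBounded D)
    (α : CoreBMO.CoreFunctional m p D
      (CoreBMO.similarities (⊥ : Subgroup (Matrix.specialOrthogonalGroup (Fin n) ℝ))))
    (hα : CoreBMO.IsStrong α) (hlsc : CoreBMO.IsLpLowerSemicontinuous α)
    (P : Submodule ℝ (CoreBMO.Mat m n)) (hP : IsCompl P (CoreBMO.nullSpace α))
    (u : CoreBMO.E n → CoreBMO.E m) (hu : CoreBMO.LpLoc p u) :
    (∀ A : CoreBMO.Mat m n, CoreBMO.psi α A < ⊤ ∧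
      Tendsto (fun ε => CoreBMO.bmo α ε A (CoreBMO.unitCube n)) (𝓝[>] (0 : ℝ))
        (𝓝 (CoreBMO.psi α A))) ∧
    (CoreBMO.bmoLower α u Ω < ⊤ ↔
      CoreBMO.MemLpD p (P.projection (CoreBMO.nullSpace α) hP) Ω u) ∧
    ∀ g : CoreBMO.E n → CoreBMO.Mat m n,
      CoreBMO.IsLpD p (P.projection (CoreBMO.nullSpace α) hP) Ω u g →
        Tendsto (fun ε => CoreBMO.bmo α ε u Ω) (𝓝[>] (0 : ℝ))
          (𝓝 (∫⁻ x in Ω, CoreBMO.psi α (g x))) := by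
  open CoreBMO in
  rcases D.eq_empty_or_nonempty with rfl | hne
  -- For empty `D` there is no packing constant, but `ψ` vanishes, `𝒩` is everything and the
  -- projection is zero, so all assertions are trivial.
  · have hpsi : ∀ A : Mat m n, psi α A = 0 := fun A => by
      simp only [psi, bmo_empty α (lpLoc_mat A), limsup_const]
    have hproj : ∀ A, P.projection (nullSpace α) hP A = 0 := fun A =>
      (Submodule.projection_apply_eq_zero_iff hP).2 (hpsi A)
    refine ⟨fun A => ?_, ⟨fun _ => ⟨_, isLpD_zero hp.le hproj hu⟩, fun _ => ?_⟩, fun g _ => ?_⟩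
    · simp only [hpsi, bmo_empty α (lpLoc_mat A)]
      exact ⟨ENNReal.zero_lt_top, tendsto_const_nhds⟩
    · simp only [bmoLower, bmo_empty α hu, liminf_const]
      exact ENNReal.zero_lt_top
    · simp only [hpsi, bmo_empty α hu, lintegral_zero]
      exact tendsto_const_nhds
  · obtain ⟨κ, -, hκt, hκ⟩ := exists_tendsto_density hD hne hDb
    have hpsi : ∀ A : Mat m n, psi α A = κ * α.toFun A D := psi_eq α hne hκ
    have hlim : ∀ g, IsLpD p (P.projection (nullSpace α) hP) Ω u g →
        Tendsto (fun ε => bmo α ε u Ω) (𝓝[>] (0 : ℝ))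
          (𝓝 (κ * ∫⁻ x in Ω, (α.toFun (g x) D : ℝ≥0∞))) := fun g hg =>
      tendsto_bmo_of_isLpD hΩ hD hne hDb hα hκt hκ hP hu hg
    refine ⟨fun A => ⟨?_, ?_⟩,
      ⟨memLpD_of_bmoLower_lt_top α hp hΩ hD hne hDb hlsc hP hu, ?_⟩, fun g hg => ?_⟩
    · rw [hpsi]
      exact ENNReal.mul_lt_top hκt.lt_top ENNReal.coe_lt_top
    · rw [hpsi]
      exact tendsto_bmo_mat α hne hκ A
    · rintro ⟨g, hg⟩
      rw [bmoLower, (hlim g hg).liminf_eq]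
      exact ENNReal.mul_lt_top hκt.lt_top (lintegral_toFun_lt_top α hg.memLp)
    · simp only [hpsi]
      rw [lintegral_const_mul' _ _ hκt]
      exact hlim g hg
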